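/- **Theorem (Characterizations of fractional isomorphism of graphons).** Let $(X,\mathcal B,\mu)$ and $(Y,\mathcal A,\lambda)$ be standard Borel spaces with Borel probability measures (for instance the same space), and let $W$ be a graphon on $X$ and $U$ a graphon on $Y$; that is, $W:X\times X\to[0,1]$ is measurable with $W(x,y)=W(y,x)$ for $\mu\times\mu$-almost every $(x,y)$, and similarly for $U$. Then the following are equivalent: 1. $t(T,W)=t(T,U)$ for every finite tree $T$, where $t(T,W)=\int_{X^{V(T)}}\prod_{\{v,w\}\in E(T)}W(y(v),y(w))\,d\mu^{V(T)}(y)$. 2. $\nu_W=\nu_U$. 3. The quotient graphons $W/\mathcal C(W)$ and $U/\mathcal C(U)$ are isomorphic. 4. There is a Markov operator $S:L^2(Y,\lambda)\to L^2(X,\mu)$ such that $T_W\circ S=S\circ T_U$. 5. There are a $W$-invariant sub-$\sigma$-algebra $\mathcal C$ of $\mathcal B$ and a $U$-invariant sub-$\sigma$-algebra $\mathcal D$ of $\mathcal A$ such that $W_{\mathcal C}$ and $U_{\mathcal D}$ are weakly isomorphic. Here the following notions are used (all $L^2$-spaces are real). * *Distribution on iterated degree measures.* For a measurable space $Z$ let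 $\mathscr M_{\le1}(Z)$ be the space of measures on $Z$ of total mass at most $1$, with the $\sigma$-algebra generated by the evaluations $m\mapsto m(A)$ (for compact metric $Z$, the Borel $\sigma$-algebra of the weak* topology). Let $P^0$ be a one-point space, $\mathbb M_n=\prod_{i\le n}P^i$, $P^{n+1}=\mathscr M_{\le1}(\mathbb M_n)$ and $\mathbb M=\prod_{n\ge0}P^n$. Let $i_{W,0}:X\to\mathbb M_0$ be the constant map and, inductively, $i_{W,n+1}(x)=(i_{W,n}(x),m_{n,x})$, where $m_{n,x}(A)=\int_{i_{W,n}^{-1}(A)}W(x,y)\,d\mu(y)$. Let $i_W:X\to\mathbb M$ be the map with $i_W(x)(n)=i_{W,n}(x)(n)$ and let $\nu_W$ be the push-forward of $\mu$ under $i_W$. * *Operators.* $T_W:L^2(X,\mu)\to L^2(X,\mu)$ is given by $(T_Wf)(x)=\int_XW(x,y)f(y)\,d\mu(y)$. A bounded linear operator $S:L^2(Y,\lambda)\to L^2(X,\mu)$ is *Markov* if $Sf\ge0$ whenever $f\ge0$, $S\mathbf 1=\mathbf 1$ and $S^*\mathbf 1=\mathbf 1$. * *Invariant sub-$\sigma$-algebras.*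 Sub-$\sigma$-algebras $\mathcal C\subseteq\mathcal B$ are required to be relatively complete: $Z\in\mathcal C$ whenever $Z\in\mathcal B$ and $\mu(Z\triangle Z_0)=0$ for some $Z_0\in\mathcal C$. Such a $\mathcal C$ is *$W$-invariant* if $T_W(L^2(X,\mathcal C,\mu))\subseteq L^2(X,\mathcal C,\mu)$. There is a minimum $W$-invariant sub-$\sigma$-algebra, the intersection of all of them; it is denoted $\mathcal C(W)$. Put $W_{\mathcal C}=\mathbb E(W\mid\mathcal C\times\mathcal C)$. * *Quotients.* $q_{\mathcal C}:X\to X/\mathcal C$ is a $\mathcal C$-measurable map to a standard Borel space, with $\mu/\mathcal C$ the push-forward of $\mu$, such that every set in $\mathcal C$ agrees up to a $\mu$-null set with the preimage of a Borel set (it exists and is unique up to isomorphism modulo null sets). The quotient $W/\mathcal C$ is the function on $X/\mathcal C\times X/\mathcal C$ obtained by applying to $W_{\mathcal C}$ the adjoint of the isometric embedding $L^2(X/\mathcal C\times X/\mathcal C)\to L^2(X\times X)$, $f\mapsto f\circ(q_{\mathcal C}\times q_{\mathcal C})$; thus $W_{\mathcal C}(x,y)=(W/\mathcal C)(q_{\mathcal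 C}(x),q_{\mathcal C}(y))$ almost everywhere. * *Isomorphism.* Graphons $V$ on $(Q,\rho)$ and $V'$ on $(Q',\rho')$ are *isomorphic* if there is a measure preserving almost bijection $\varphi:Q\to Q'$ (a bijection up to null sets, with measurable inverse) with $V(x,y)=V'(\varphi(x),\varphi(y))$ for $\rho\times\rho$-almost every $(x,y)$. They are *weakly isomorphic* if their cut distance is $0$: $$\inf_\pi\ \sup_{A,B\subseteq Q\times Q'}\left|\int_{A\times B}\bigl(V(x,x')-V'(y,y')\bigr)\,d\pi(x,y)\,d\pi(x',y')\right|=0,$$ where $\pi$ runs over the couplings of $\rho$ and $\rho'$ (probability measures on $Q\times Q'$ with marginals $\rho$ and $\rho'$) and $A,B$ over the measurable sets. (For atomless spaces this is the usual cut distance, defined as an infimum over measure preserving bijections.) -/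

import Mathlib

open MeasureTheory
open scoped ENNReal symmDiff

noncomputable section

namespace FracIso

/-! ### Graphons, tree densities, integral operators -/

/-- A graphon on the probability space `(X, μ)`: a jointly measurable kernel with values in
`[0, 1]` that is symmetric almost everywhere. -/
structure Graphon {X : Type*} [MeasurableSpace X] (μ : Measure X) where
  /-- the underlying kernel -/
  ker : X × X → ℝ
  measurable_ker : Measurable ker
  nonneg : ∀ p, 0 ≤ ker p
  le_one : ∀ p, ker p ≤ 1
  symm : ∀ᵐ p ∂(μ.prod μ), ker p.swap = ker p

open Classical in
/-- The homomorphism density `t(F, W)` of a graph `F` on the vertex set `{0, …, n-1}`. The product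
runs over the edges `{i, j}` of `F`, each listed once, as the pair `(i, j)` with `i < j`. -/
def homDensity {X : Type*} [MeasurableSpace X] {μ : Measure X} {n : ℕ}
    (F : SimpleGraph (Fin n)) (W : Graphon μ) : ℝ :=
  ∫ y : Fin n → X,
    ∏ e ∈ Finset.univ.filter (fun e : Fin n × Fin n => e.1 < e.2 ∧ F.Adj e.1 e.2),
      W.ker (y e.1, y e.2) ∂(Measure.pi fun _ => μ)

section Operator

variable {X : Type*} [MeasurableSpace X] {μ : Measure X} [IsProbabilityMeasure μ]

theorem integrable_of_L2 (f : Lp ℝ 2 μ) : Integrable (f : X → ℝ) μ :=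
  (Lp.memLp f).integrable (by norm_num)

theorem integrable_ker_mul (W : Graphon μ) (f : Lp ℝ 2 μ) (x : X) :
    Integrable (fun y => W.ker (x, y) * f y) μ := by
  refine (integrable_of_L2 f).bdd_mul (c := 1)
    (W.measurable_ker.comp measurable_prodMk_left).aestronglyMeasurable ?_
  filter_upwards with y
  rw [Real.norm_of_nonneg (W.nonneg _)]
  exact W.le_one _

theorem norm_integral_ker_mul_le (W : Graphon μ) (f : Lp ℝ 2 μ) (x : X) :
    ‖∫ y, W.ker (x, y) * f y ∂μ‖ ≤ ‖f‖ := by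
  calc ‖∫ y, W.ker (x, y) * f y ∂μ‖ ≤ ∫ y, ‖f y‖ ∂μ := by
        refine norm_integral_le_of_norm_le (integrable_of_L2 f).norm ?_
        filter_upwards with y
        rw [norm_mul, Real.norm_of_nonneg (W.nonneg _)]
        exact mul_le_of_le_one_left (norm_nonneg _) (W.le_one _)
    _ = (eLpNorm f 1 μ).toReal := by
        rw [eLpNorm_one_eq_lintegral_enorm, integral_norm_eq_lintegral_enorm
          (Lp.aestronglyMeasurable f)]
    _ ≤ (eLpNorm f 2 μ).toReal :=
        ENNReal.toReal_mono (Lp.eLpNorm_ne_top f)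
          (eLpNorm_le_eLpNorm_of_exponent_le (by norm_num) (Lp.aestronglyMeasurable f))
    _ = ‖f‖ := (Lp.norm_def f).symm

theorem memLp_integral_ker_mul (W : Graphon μ) (f : Lp ℝ 2 μ) :
    MemLp (fun x => ∫ y, W.ker (x, y) * f y ∂μ) 2 μ := by
  refine MemLp.of_bound ?_ ‖f‖ (Filter.Eventually.of_forall (norm_integral_ker_mul_le W f))
  have h : StronglyMeasurable (fun p : X × X => W.ker p * f p.2) :=
    W.measurable_ker.stronglyMeasurable.mul
      ((Lp.stronglyMeasurable f).comp_measurable measurable_snd)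
  exact (h.integral_prod_right' (ν := μ)).aestronglyMeasurable

/-- The integral operator `T_W : L²(X, μ) → L²(X, μ)`, `(T_W f)(x) = ∫ W(x, y) f(y) dμ(y)`. -/
def graphonOp (W : Graphon μ) : Lp ℝ 2 μ →L[ℝ] Lp ℝ 2 μ :=
  LinearMap.mkContinuous
    { toFun := fun f => (memLp_integral_ker_mul W f).toLp _
      map_add' := fun f g => by
        rw [← MemLp.toLp_add]
        refine MemLp.toLp_congr _ _ (Filter.Eventually.of_forall fun x => ?_)
        simp only [Pi.add_apply]
        rw [← integral_add (integrable_ker_mul W f x) (integrable_ker_mul W g x)]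
        refine integral_congr_ae ?_
        filter_upwards [Lp.coeFn_add f g] with y hy
        rw [hy, Pi.add_apply, mul_add]
      map_smul' := fun c f => by
        rw [RingHom.id_apply, ← MemLp.toLp_const_smul]
        refine MemLp.toLp_congr _ _ (Filter.Eventually.of_forall fun x => ?_)
        simp only [Pi.smul_apply]
        rw [← integral_smul]
        refine integral_congr_ae ?_
        filter_upwards [Lp.coeFn_smul c f] with y hy
        rw [hy, Pi.smul_apply, smul_eq_mul, smul_eq_mul, mul_left_comm] }
    1 (fun f => by
      rw [one_mul]
      have h : ∀ᵐ x ∂μ, ‖(memLp_integral_ker_mul W f).toLp _ x‖ ≤ ‖f‖ := by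
        filter_upwards [(memLp_integral_ker_mul W f).coeFn_toLp] with x hx
        rw [hx]
        exact norm_integral_ker_mul_le W f x
      simpa [measureUnivNNReal] using Lp.norm_le_of_ae_bound (norm_nonneg f) h)

theorem coeFn_graphonOp (W : Graphon μ) (f : Lp ℝ 2 μ) :
    graphonOp W f =ᵐ[μ] fun x => ∫ y, W.ker (x, y) * f y ∂μ :=
  (memLp_integral_ker_mul W f).coeFn_toLp

/-- A Markov operator `L²(X, μ) → L²(Y, ν)`: positive, with `S 1 = 1` and `S* 1 = 1`. -/
structure IsMarkov {Y : Type*} [MeasurableSpace Y] {ν : Measure Y} [IsProbabilityMeasure ν]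
    (S : Lp ℝ 2 μ →L[ℝ] Lp ℝ 2 ν) : Prop where
  nonneg : ∀ f, 0 ≤ f → 0 ≤ S f
  map_one : S (Lp.const 2 μ (1 : ℝ)) = Lp.const 2 ν (1 : ℝ)
  adjoint_map_one : S.adjoint (Lp.const 2 ν (1 : ℝ)) = Lp.const 2 μ (1 : ℝ)

end Operator

/-! ### Invariant sub-σ-algebras -/

section SubAlgebra

variable {X : Type*} [mX : MeasurableSpace X]

/-- A `μ`-relatively complete sub-σ-algebra of the σ-algebra of `X`. -/
structure SubAlg (μ : Measure X) where
  alg : MeasurableSpace X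
  le : alg ≤ mX
  complete : ∀ Z Z₀ : Set X, MeasurableSet[mX] Z → MeasurableSet[alg] Z₀ → μ (Z ∆ Z₀) = 0 →
    MeasurableSet[alg] Z

variable {μ : Measure X} [IsProbabilityMeasure μ]

/-- `C` is `W`-invariant: `T_W` maps `L²(X, C, μ)` into itself. Here `lpMeas ℝ ℝ C.alg 2 μ` is the
subspace of those elements of `L²(X, μ)` that are (a.e. equal to) `C`-measurable functions. -/
def IsInvariant (W : Graphon μ) (C : SubAlg μ) : Prop :=
  ∀ f ∈ lpMeas ℝ ℝ C.alg 2 μ, graphonOp W f ∈ lpMeas ℝ ℝ C.alg 2 μ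

/-- The full σ-algebra. -/
def fullAlg (μ : Measure X) : SubAlg μ where
  alg := mX
  le := le_rfl
  complete := fun _ _ hZ _ _ => hZ

theorem isInvariant_full (W : Graphon μ) : IsInvariant W (fullAlg μ) := fun _ _ =>
  mem_lpMeas_iff_aestronglyMeasurable.2 (Lp.aestronglyMeasurable _)

/-- The σ-algebra `C(W)`: the intersection of all `W`-invariant relatively complete
sub-σ-algebras. -/
def minAlg (W : Graphon μ) : SubAlg μ where
  alg := ⨅ C : {C : SubAlg μ // IsInvariant W C}, C.1.alg
  le := iInf_le (fun C : {C : SubAlg μ // IsInvariant W C} => C.1.alg)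
    ⟨fullAlg μ, isInvariant_full W⟩
  complete := by
    intro Z Z₀ hZ hZ₀ h
    rw [MeasurableSpace.measurableSet_iInf] at hZ₀ ⊢
    exact fun C => C.1.complete Z Z₀ hZ (hZ₀ C) h

theorem aestronglyMeasurable_iff {μ : Measure X} (C : SubAlg μ) (f : Lp ℝ 2 μ) :
    AEStronglyMeasurable[C.alg] f μ ↔ Measurable[C.alg] (f : X → ℝ) := by
  constructor
  · rintro ⟨g, hg, hfg⟩ A hA
    refine C.complete _ (g ⁻¹' A) ((Lp.stronglyMeasurable f).measurable hA)
      (hg.measurable hA) ?_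
    rw [measure_symmDiff_eq_zero_iff]
    filter_upwards [hfg] with x hx
    simp only [eq_iff_iff]
    change f x ∈ A ↔ g x ∈ A
    rw [hx]
  · intro h
    exact h.stronglyMeasurable.aestronglyMeasurable

/-- `C(W)` is indeed the minimum `W`-invariant relatively complete sub-σ-algebra. -/
theorem minAlg_isLeast (W : Graphon μ) :
    IsInvariant W (minAlg W) ∧ ∀ C : SubAlg μ, IsInvariant W C → (minAlg W).alg ≤ C.alg := by
  have hle : ∀ C : SubAlg μ, IsInvariant W C → (minAlg W).alg ≤ C.alg :=
    fun C hC => iInf_le (fun C : {C : SubAlg μ // IsInvariant W C} => C.1.alg) ⟨C, hC⟩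
  refine ⟨fun f hf => ?_, hle⟩
  rw [mem_lpMeas_iff_aestronglyMeasurable] at hf ⊢
  rw [aestronglyMeasurable_iff] at hf ⊢
  intro A hA
  refine MeasurableSpace.measurableSet_iInf.2 ?_
  rintro ⟨C, hC⟩
  have h1 : AEStronglyMeasurable[C.alg] f μ :=
    (aestronglyMeasurable_iff C f).2 (hf.mono (hle C hC) le_rfl)
  exact (aestronglyMeasurable_iff C _).1
    (mem_lpMeas_iff_aestronglyMeasurable.1
      (hC f (mem_lpMeas_iff_aestronglyMeasurable.2 h1))) hA

/-- `W_C = E(W | C × C)`. -/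
def condKer (W : Graphon μ) (C : SubAlg μ) : X × X → ℝ :=
  (μ.prod μ)[W.ker | MeasurableSpace.prod C.alg C.alg]

theorem memLp_condKer (W : Graphon μ) (C : SubAlg μ) : MemLp (condKer W C) 2 (μ.prod μ) := by
  refine MemLp.condExp (by norm_num) (MemLp.of_bound W.measurable_ker.aestronglyMeasurable 1 ?_)
  filter_upwards with p
  rw [Real.norm_of_nonneg (W.nonneg p)]
  exact W.le_one p

end SubAlgebra

/-! ### Quotients -/

section Quotient

variable {X : Type*} [mX : MeasurableSpace X] [MeasurableSpace.CountablyGenerated X]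
  {μ : Measure X} [IsProbabilityMeasure μ]

/-- Up to null sets, a sub-σ-algebra is generated by a sequence of its members. -/
theorem exists_generating_seq (C : SubAlg μ) :
    ∃ A : ℕ → Set X, (∀ n, MeasurableSet[C.alg] (A n)) ∧
      ∀ B, MeasurableSet[C.alg] B →
        ∃ B', MeasurableSet[MeasurableSpace.generateFrom (Set.range A)] B' ∧ μ (B ∆ B') = 0 := by
  classical
  obtain ⟨D, hDc, hD⟩ := exists_countable_measureDense μ
  obtain ⟨d, hd⟩ := hDc.exists_eq_range hD.nonempty
  have key : ∀ n k : ℕ, ∃ A : Set X, MeasurableSet[C.alg] A ∧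
      ((∃ A', MeasurableSet[C.alg] A' ∧ μ (A' ∆ d n) < (2⁻¹ : ℝ≥0∞) ^ k) →
        μ (A ∆ d n) < (2⁻¹ : ℝ≥0∞) ^ k) := by
    intro n k
    by_cases h : ∃ A', MeasurableSet[C.alg] A' ∧ μ (A' ∆ d n) < (2⁻¹ : ℝ≥0∞) ^ k
    · obtain ⟨A', h1, h2⟩ := h
      exact ⟨A', h1, fun _ => h2⟩
    · exact ⟨∅, @MeasurableSet.empty X C.alg, fun h' => absurd h' h⟩
  choose A hA hA' using key
  refine ⟨fun m => A (Nat.unpair m).1 (Nat.unpair m).2, fun m => hA _ _, fun B hB => ?_⟩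
  have hn : ∀ k : ℕ, ∃ n, μ (B ∆ d n) < (2⁻¹ : ℝ≥0∞) ^ k := by
    intro k
    obtain ⟨t, ht, h⟩ := hD.approx B (C.le _ hB) (measure_ne_top _ _) ((2⁻¹ : ℝ) ^ k)
      (by positivity)
    rw [hd] at ht
    obtain ⟨n, rfl⟩ := ht
    refine ⟨n, h.trans_le (le_of_eq ?_)⟩
    rw [ENNReal.ofReal_pow (by positivity), ENNReal.ofReal_inv_of_pos (by positivity)]
    norm_num
  choose n hn using hn
  have hclose : ∀ k, μ (A (n k) k ∆ B) ≤ 2 * (2⁻¹ : ℝ≥0∞) ^ k := by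
    intro k
    have h1 := hA' (n k) k ⟨B, hB, hn k⟩
    have h2 := hn k
    rw [symmDiff_comm] at h2
    calc μ (A (n k) k ∆ B) ≤ μ (A (n k) k ∆ d (n k)) + μ (d (n k) ∆ B) :=
          (measure_mono (symmDiff_triangle _ _ _)).trans (measure_union_le _ _)
      _ ≤ (2⁻¹ : ℝ≥0∞) ^ k + (2⁻¹ : ℝ≥0∞) ^ k := add_le_add h1.le h2.le
      _ = 2 * (2⁻¹ : ℝ≥0∞) ^ k := (two_mul _).symm
  have hsum : ∑' k, μ (A (n k) k ∆ B) ≠ ∞ := by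
    refine ne_top_of_le_ne_top ?_ (ENNReal.tsum_le_tsum hclose)
    rw [ENNReal.tsum_mul_left, ENNReal.tsum_geometric, ENNReal.one_sub_inv_two, inv_inv]
    exact ENNReal.mul_ne_top (by norm_num) (by norm_num)
  refine ⟨⋂ i : ℕ, ⋃ j : ℕ, A (n (i + j)) (i + j), ?_, ?_⟩
  · refine @MeasurableSet.iInter _ _ (_) _ _ fun i => @MeasurableSet.iUnion _ _ (_) _ _ fun j => ?_
    refine MeasurableSpace.measurableSet_generateFrom ⟨Nat.pair (n (i + j)) (i + j), ?_⟩
    simp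
  · rw [measure_symmDiff_eq_zero_iff]
    filter_upwards [ae_eventually_notMem hsum] with x hx
    obtain ⟨N, hN⟩ := Filter.eventually_atTop.1 hx
    have hN' : ∀ k, N ≤ k → (x ∈ A (n k) k ↔ x ∈ B) := by
      intro k hk
      have := hN k hk
      rw [Set.mem_symmDiff] at this
      tauto
    simp only [eq_iff_iff]
    change x ∈ B ↔ x ∈ ⋂ i : ℕ, ⋃ j : ℕ, A (n (i + j)) (i + j)
    simp only [Set.mem_iInter, Set.mem_iUnion]
    constructor
    · intro hxB i
      exact ⟨N, (hN' _ (by omega)).2 hxB⟩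
    · intro h
      obtain ⟨j, hj⟩ := h N
      exact (hN' _ (by omega)).1 hj

/-- A sequence of members of `C` that generates `C` up to null sets. -/
def genSeq (C : SubAlg μ) : ℕ → Set X := (exists_generating_seq C).choose

open Classical in
/-- The quotient map `q_C : X → X/C`. The standard Borel space `X/C` is realised as the Cantor
space, with the image measure of `μ`; `q_C x` records which members of a sequence generating `C`
modulo null sets contain `x`. (Any two choices give quotients that are isomorphic mod 0.) -/
def quotMap (C : SubAlg μ) (x : X) : ℕ → Bool := fun n => decide (x ∈ genSeq C n)

theorem measurable_quotMap (C : SubAlg μ) : Measurable (quotMap C) := by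
  classical
  refine measurable_pi_lambda _ fun n => ?_
  refine measurable_to_bool ?_
  have : (fun x => quotMap C x n) ⁻¹' {true} = genSeq C n := by
    ext x
    simp [quotMap]
  rw [this]
  exact C.le _ ((exists_generating_seq C).choose_spec.1 n)

/-- The probability measure `μ/C` on `X/C`. -/
def quotMeasure (C : SubAlg μ) : Measure (ℕ → Bool) := μ.map (quotMap C)

instance (C : SubAlg μ) : IsProbabilityMeasure (quotMeasure C) :=
  Measure.isProbabilityMeasure_map (measurable_quotMap C).aemeasurable

theorem measurePreserving_quotMap (C : SubAlg μ) :
    MeasurePreserving (quotMap C) μ (quotMeasure C) := ⟨measurable_quotMap C, rfl⟩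

/-- The isometric embedding `f ↦ f ∘ (q_C × q_C)` from `L²(X/C × X/C)` to `L²(X × X)`. -/
def quotEmbed (C : SubAlg μ) :
    Lp ℝ 2 ((quotMeasure C).prod (quotMeasure C)) →L[ℝ] Lp ℝ 2 (μ.prod μ) :=
  (Lp.compMeasurePreservingₗᵢ ℝ (Prod.map (quotMap C) (quotMap C))
    ((measurePreserving_quotMap C).prod (measurePreserving_quotMap C))).toContinuousLinearMap

/-- The quotient graphon `W/C` on `X/C`: the image of `W_C` under the adjoint of the embedding
`L²(X/C × X/C) → L²(X × X)`. -/
def quotGraphon (W : Graphon μ) (C : SubAlg μ) :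
    Lp ℝ 2 ((quotMeasure C).prod (quotMeasure C)) :=
  (quotEmbed C).adjoint ((memLp_condKer W C).toLp _)

end Quotient

/-! ### Isomorphism and weak isomorphism -/

section Iso

variable {X Y : Type*} [MeasurableSpace X] [MeasurableSpace Y]

/-- Isomorphism of two kernels on probability spaces: `V = V'(φ(·), φ(·))` a.e. for a measure
preserving almost bijection `φ` (with measurable almost inverse `ψ`). -/
def KerIso (μ : Measure X) (ν : Measure Y) (V : X × X → ℝ) (V' : Y × Y → ℝ) : Prop :=
  ∃ (φ : X → Y) (ψ : Y → X), MeasurePreserving φ μ ν ∧ MeasurePreserving ψ ν μ ∧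
    (∀ᵐ x ∂μ, ψ (φ x) = x) ∧ (∀ᵐ y ∂ν, φ (ψ y) = y) ∧
    ∀ᵐ p ∂(μ.prod μ), V p = V' (φ p.1, φ p.2)

/-- The cut norm of a kernel: the supremum over measurable `A, B` of `|∫_{A × B} F|`. -/
def cutNorm (μ : Measure X) (F : X × X → ℝ) : ℝ :=
  sSup {r | ∃ A B : Set X, MeasurableSet A ∧ MeasurableSet B ∧
    r = |∫ p in A ×ˢ B, F p ∂(μ.prod μ)|}

/-- The cut distance `δ_□` of kernels on two probability spaces: the infimum over all couplings
`π` of `μ` and `ν` of the cut norm of `V(x, x') - V'(y, y')` on `(X × Y, π)`. This is the definition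
valid for all standard Borel probability spaces, with or without atoms; on atomless ones it is the
infimum over measure preserving bijections. -/
def cutDist (μ : Measure X) (ν : Measure Y) (V : X × X → ℝ) (V' : Y × Y → ℝ) : ℝ :=
  sInf {r | ∃ π : Measure (X × Y), π.fst = μ ∧ π.snd = ν ∧
    r = cutNorm π (fun p => V (p.1.1, p.2.1) - V' (p.1.2, p.2.2))}

/-- Weak isomorphism: cut distance zero. -/
def WeakIso (μ : Measure X) (ν : Measure Y) (V : X × X → ℝ) (V' : Y × Y → ℝ) : Prop :=
  cutDist μ ν V V' = 0

end Iso

/-! ### Iterated degree measures -/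

/-- Measures of total mass at most one, with the σ-algebra generated by the evaluations
`m ↦ m A`. On a compact metric space this is the Borel σ-algebra of the weak* topology. -/
abbrev SubProb (Z : Type) [MeasurableSpace Z] : Type := {m : Measure Z // m Set.univ ≤ 1}

/-- The measurable spaces `M_n`, with `M_0` a point and `M_{n+1} = M_n × 𝓜_{≤1}(M_n)`. -/
def idmStage : ℕ → Σ Z : Type, MeasurableSpace Z
  | 0 => ⟨Unit, inferInstance⟩
  | n + 1 => letI := (idmStage n).2; ⟨(idmStage n).1 × SubProb (idmStage n).1, inferInstance⟩

/-- `M_n = P^0 × ⋯ × P^n`. -/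
def IDMUpTo (n : ℕ) : Type := (idmStage n).1

instance (n : ℕ) : MeasurableSpace (IDMUpTo n) := (idmStage n).2

/-- `P^0` is a point and `P^{n+1} = 𝓜_{≤1}(M_n)`. -/
def DegSpace : ℕ → Type
  | 0 => Unit
  | n + 1 => SubProb (IDMUpTo n)

instance : (n : ℕ) → MeasurableSpace (DegSpace n)
  | 0 => inferInstanceAs (MeasurableSpace Unit)
  | n + 1 => inferInstanceAs (MeasurableSpace (SubProb (IDMUpTo n)))

/-- The space `𝕄 = ∏ₙ P^n` of iterated degree measures, with the product σ-algebra. -/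
abbrev IDM : Type := (n : ℕ) → DegSpace n

section Degree

variable {X : Type*} [MeasurableSpace X] {μ : Measure X} [IsProbabilityMeasure μ]

/-- For `i : X → Z`, the measure `A ↦ ∫_{i⁻¹(A)} W(x, y) dμ(y)` on `Z`. -/
def degMeasure {Z : Type} [MeasurableSpace Z] (W : Graphon μ) (i : X → Z) (x : X) : SubProb Z :=
  ⟨(μ.withDensity fun y => ENNReal.ofReal (W.ker (x, y))).map i, by
    have h : (μ.withDensity fun y => ENNReal.ofReal (W.ker (x, y))) Set.univ ≤ 1 := by
      rw [withDensity_apply _ MeasurableSet.univ, Measure.restrict_univ]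
      calc ∫⁻ y, ENNReal.ofReal (W.ker (x, y)) ∂μ ≤ ∫⁻ _, 1 ∂μ :=
            lintegral_mono fun y => by simpa using W.le_one (x, y)
        _ = 1 := by simp
    by_cases hi : AEMeasurable i (μ.withDensity fun y => ENNReal.ofReal (W.ker (x, y)))
    · rwa [Measure.map_apply_of_aemeasurable hi MeasurableSet.univ, Set.preimage_univ]
    · simp [Measure.map_of_not_aemeasurable hi]⟩

theorem degMeasure_apply {Z : Type} [MeasurableSpace Z] (W : Graphon μ) {i : X → Z}
    (hi : Measurable i) (x : X) {A : Set Z} (hA : MeasurableSet A) :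
    (degMeasure W i x).1 A = ∫⁻ y in i ⁻¹' A, ENNReal.ofReal (W.ker (x, y)) ∂μ := by
  rw [degMeasure, Measure.map_apply hi hA, withDensity_apply _ (hi hA)]

theorem measurable_degMeasure {Z : Type} [MeasurableSpace Z] (W : Graphon μ) {i : X → Z}
    (hi : Measurable i) : Measurable (degMeasure W i) := by
  refine Measurable.subtype_mk (Measure.measurable_of_measurable_coe _ fun A hA => ?_)
  have h := fun x => degMeasure_apply W hi x hA
  simp only [degMeasure] at h
  simp only [h]
  exact W.measurable_ker.ennreal_ofReal.lintegral_prod_right' (ν := μ.restrict (i ⁻¹' A))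

/-- The maps `i_{W,n} : X → M_n`. -/
def iterDegUpTo (W : Graphon μ) : (n : ℕ) → X → IDMUpTo n
  | 0 => fun _ => ()
  | n + 1 => fun x =>
    ((iterDegUpTo W n x, degMeasure (Z := IDMUpTo n) W (iterDegUpTo W n) x) :
      IDMUpTo n × SubProb (IDMUpTo n))

theorem measurable_iterDegUpTo (W : Graphon μ) : ∀ n, Measurable (iterDegUpTo W n)
  | 0 => measurable_const
  | n + 1 =>
    have h : Measurable fun x => (iterDegUpTo W n x, degMeasure W (iterDegUpTo W n) x) :=
      (measurable_iterDegUpTo W n).prodMk (measurable_degMeasure W (measurable_iterDegUpTo W n))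
    h

/-- The map `i_W : X → 𝕄`. -/
def iterDeg (W : Graphon μ) (x : X) : IDM
  | 0 => ()
  | n + 1 => degMeasure W (iterDegUpTo W n) x

theorem measurable_iterDeg (W : Graphon μ) : Measurable (iterDeg W) := by
  refine measurable_pi_lambda _ fun n => ?_
  cases n with
  | zero => exact measurable_const
  | succ n => exact measurable_degMeasure W (measurable_iterDegUpTo W n)

/-- The distribution on iterated degree measures `ν_W`, the push-forward of `μ` along `i_W`. -/
def didm (W : Graphon μ) : Measure IDM := μ.map (iterDeg W)

end Degree

end FracIso

end

namespace FracIso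

/-! ### Rooted tree functions -/

/-! All five conditions are compared with one hub: equality of the integrals of all rooted tree
functions. These functions start from the constant 1 and are closed under products (`glue`) and the
integral operator (`plant`). Pruning leaves turns a tree density into such an integral, and growing
a rooted tree at a vertex goes back, so the hub is equivalent to equality of tree densities
(`forall_homDensity_eq_iff`).

The map `treeMap W`, which records the values of all tree functions at a point, has its image among
the multiplicative points of a compact metrizable cube. On those points a product of coordinates is
again a coordinate. Hence, by Stone-Weierstrass, the integrals of coordinates determine a finite
measure carried by them (`measure_treeSpace_ext`), and the coordinates span a dense subspace of L²
(`eq_top_of_coordLp_mem`). The first fact shows that the hub fixes the law of the tree map. The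
second shows that the σ-algebra of the tree map is W-invariant, since T_W sends the coordinate τ to
the coordinate `plant τ`. As every invariant σ-algebra makes all tree functions measurable, the tree
map generates C(W) modulo null sets (`generates_treeMap`). The quotient W/C(W) is thereby realized
by a kernel on the cube. The mixed moments of this kernel are again tree integrals, so the hub
determines the kernel too: the two graphons share one quotient (`exists_common_kernel`).

A common quotient yields everything else. Any two realizations of a quotient are isomorphic;
coupling the two spaces over the quotient makes the cut norm vanish; if J and I are the embeddings
of L² of the quotient, then J I* is the required Markov operator; and iterated degree measures are
computed on the quotient.

Conversely, each condition returns the hub. Tree functions are integrals against iterated degree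
measures. Quotients by invariant σ-algebras preserve tree integrals (`IsFactor.integral_treeFun`).
Tree functions are Lipschitz for the cut norm under any coupling
(`exists_integral_abs_treeFun_sub_le`). Finally, a Markov operator intertwining T_U and T_W carries
tree functions to tree functions: products survive because equality holds in Jensen's inequality for
the square (`IsMarkov.isMappedTo_sq`). -/

/-- Terms describing finite rooted trees: a single vertex, two trees glued at their roots, and a
tree whose root hangs from a new root by an edge. -/
inductive TreeTerm : Type
  | point : TreeTerm
  | glue : TreeTerm → TreeTerm → TreeTerm
  | plant : TreeTerm → TreeTerm

/-- A numbering of tree terms. -/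
def TreeTerm.code : TreeTerm → ℕ
  | point => 0
  | glue a b => 2 * Nat.pair a.code b.code + 1
  | plant a => 2 * a.code + 2

theorem TreeTerm.code_injective : Function.Injective TreeTerm.code := by
  intro a
  induction a with
  | point => intro b h; cases b <;> simp [code] at h ⊢
  | glue a₁ a₂ ih₁ ih₂ =>
    intro b h
    cases b with
    | point => simp [code] at h
    | glue b₁ b₂ =>
      have h' : Nat.pair a₁.code a₂.code = Nat.pair b₁.code b₂.code := by
        simp only [code] at h; omega
      rw [Nat.pair_eq_pair] at h'
      rw [ih₁ h'.1, ih₂ h'.2]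
    | plant b => simp only [code] at h; omega
  | plant a ih =>
    intro b h
    cases b with
    | point => simp [code] at h
    | glue b₁ b₂ => simp only [code] at h; omega
    | plant b => rw [ih (by simp only [code] at h; omega : a.code = b.code)]

/-- Countability makes `TreeSpace` a countable power of the unit interval, hence Polish with the
product σ-algebra as its Borel σ-algebra, and allows null sets to be collected over all terms. -/
instance : Countable TreeTerm := TreeTerm.code_injective.countable

section TreeFun

variable {X : Type*} [MeasurableSpace X]

/-- The density of rooted copies of a tree in the kernel `K`, as a function of the root. -/
noncomputable def treeFun (K : X × X → ℝ) (μ : Measure X) : TreeTerm → X → ℝ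
  | .point, _ => 1
  | .glue a b, x => treeFun K μ a x * treeFun K μ b x
  | .plant a, x => ∫ y, K (x, y) * treeFun K μ a y ∂μ

/-- A measurable kernel with values in the unit interval. -/
structure IsUnitKernel (K : X × X → ℝ) : Prop where
  measurable : Measurable K
  nonneg : ∀ p, 0 ≤ K p
  le_one : ∀ p, K p ≤ 1

theorem Graphon.isUnitKernel {μ : Measure X} (W : Graphon μ) : IsUnitKernel W.ker :=
  ⟨W.measurable_ker, W.nonneg, W.le_one⟩

variable {K : X × X → ℝ} {μ : Measure X} [IsProbabilityMeasure μ]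

theorem IsUnitKernel.norm_le_one (hK : IsUnitKernel K) (p : X × X) : ‖K p‖ ≤ 1 := by
  rw [Real.norm_of_nonneg (hK.nonneg p)]; exact hK.le_one p

theorem IsUnitKernel.measurable_integral (hK : IsUnitKernel K) {h : X → ℝ} (hh : Measurable h) :
    Measurable fun x => ∫ y, K (x, y) * h y ∂μ := by
  have : StronglyMeasurable (fun p : X × X => K p * h p.2) :=
    (hK.measurable.mul (hh.comp measurable_snd)).stronglyMeasurable
  exact (this.integral_prod_right' (ν := μ)).measurable

theorem IsUnitKernel.integrable_mul (hK : IsUnitKernel K) {h : X → ℝ} (hh : Integrable h μ)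
    (x : X) : Integrable (fun y => K (x, y) * h y) μ :=
  hh.bdd_mul (c := 1) (hK.measurable.comp measurable_prodMk_left).aestronglyMeasurable
    (Filter.Eventually.of_forall fun _ => hK.norm_le_one _)

theorem IsUnitKernel.integrable (hK : IsUnitKernel K) (ν : Measure (X × X)) [IsFiniteMeasure ν] :
    Integrable K ν :=
  Integrable.of_bound hK.measurable.aestronglyMeasurable 1
    (Filter.Eventually.of_forall hK.norm_le_one)

theorem IsUnitKernel.integral_mem (hK : IsUnitKernel K) {h : X → ℝ} (hm : Measurable h)
    (h0 : ∀ y, 0 ≤ h y) (h1 : ∀ y, h y ≤ 1) (x : X) :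
    0 ≤ ∫ y, K (x, y) * h y ∂μ ∧ ∫ y, K (x, y) * h y ∂μ ≤ 1 := by
  refine ⟨integral_nonneg fun y => mul_nonneg (hK.nonneg _) (h0 y), ?_⟩
  have hi : Integrable h μ := Integrable.of_bound hm.aestronglyMeasurable 1
    (Filter.Eventually.of_forall fun y => by rw [Real.norm_of_nonneg (h0 y)]; exact h1 y)
  calc ∫ y, K (x, y) * h y ∂μ ≤ ∫ _, (1 : ℝ) ∂μ :=
        integral_mono (hK.integrable_mul hi x) (integrable_const _)
          fun y => mul_le_one₀ (hK.le_one _) (h0 y) (h1 y)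
    _ = 1 := by simp

theorem treeFun_spec (hK : IsUnitKernel K) (τ : TreeTerm) :
    Measurable (treeFun K μ τ) ∧ (∀ x, 0 ≤ treeFun K μ τ x) ∧ ∀ x, treeFun K μ τ x ≤ 1 := by
  induction τ with
  | point => exact ⟨measurable_const, fun _ => zero_le_one, fun _ => le_rfl⟩
  | glue a b iha ihb =>
    exact ⟨iha.1.mul ihb.1, fun x => mul_nonneg (iha.2.1 x) (ihb.2.1 x),
      fun x => mul_le_one₀ (iha.2.2 x) (ihb.2.1 x) (ihb.2.2 x)⟩
  | plant a ih =>
    exact ⟨hK.measurable_integral ih.1, fun x => (hK.integral_mem ih.1 ih.2.1 ih.2.2 x).1,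
      fun x => (hK.integral_mem ih.1 ih.2.1 ih.2.2 x).2⟩

theorem measurable_treeFun (hK : IsUnitKernel K) (τ : TreeTerm) : Measurable (treeFun K μ τ) :=
  (treeFun_spec hK τ).1

theorem treeFun_nonneg (hK : IsUnitKernel K) (τ : TreeTerm) (x : X) : 0 ≤ treeFun K μ τ x :=
  (treeFun_spec hK τ).2.1 x

theorem treeFun_le_one (hK : IsUnitKernel K) (τ : TreeTerm) (x : X) : treeFun K μ τ x ≤ 1 :=
  (treeFun_spec hK τ).2.2 x

theorem norm_treeFun_le_one (hK : IsUnitKernel K) (τ : TreeTerm) (x : X) :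
    ‖treeFun K μ τ x‖ ≤ 1 := by
  rw [Real.norm_of_nonneg (treeFun_nonneg hK τ x)]; exact treeFun_le_one hK τ x

theorem memLp_treeFun (hK : IsUnitKernel K) (τ : TreeTerm) (p : ℝ≥0∞) :
    MemLp (treeFun K μ τ) p μ :=
  MemLp.of_bound (measurable_treeFun hK τ).aestronglyMeasurable 1
    (Filter.Eventually.of_forall (norm_treeFun_le_one hK τ))

theorem integrable_treeFun (hK : IsUnitKernel K) (τ : TreeTerm) : Integrable (treeFun K μ τ) μ :=
  memLp_one_iff_integrable.1 (memLp_treeFun hK τ 1)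

/-! ### Factors -/

variable {Z : Type*} [MeasurableSpace Z] {V : Z × Z → ℝ} {ρ : Measure Z} [IsProbabilityMeasure ρ]

/-- The kernel `V` on `Z` is a factor of `K` by the measure preserving map `q`: the integral
operator of `K` restricted to functions of `q` is the integral operator of `V`. -/
structure IsFactor (K : X × X → ℝ) (μ : Measure X) (V : Z × Z → ℝ) (ρ : Measure Z) (q : X → Z) :
    Prop where
  measurePreserving : MeasurePreserving q μ ρ
  integral_eq : ∀ h : Z → ℝ, Measurable h → MemLp h 2 ρ →
    ∀ᵐ x ∂μ, ∫ y, K (x, y) * h (q y) ∂μ = ∫ z, V (q x, z) * h z ∂ρ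

/-- Only `plant` uses the factor property. By induction the integrand already depends on q(y) alone,
and on such functions the two integral operators agree; the kernels themselves need not agree. -/
theorem IsFactor.treeFun_ae_eq {q : X → Z} (h : IsFactor K μ V ρ q) (hV : IsUnitKernel V)
    (τ : TreeTerm) : ∀ᵐ x ∂μ, treeFun K μ τ x = treeFun V ρ τ (q x) := by
  induction τ with
  | point => exact Filter.Eventually.of_forall fun _ => rfl
  | glue a b iha ihb =>
    filter_upwards [iha, ihb] with x ha hb
    simp only [treeFun, ha, hb]
  | plant a ih =>
    filter_upwards [h.integral_eq _ (measurable_treeFun (μ := ρ) hV a) (memLp_treeFun hV a 2)]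
      with x hx
    simp only [treeFun]
    rw [← hx]
    refine integral_congr_ae ?_
    filter_upwards [ih] with y hy
    rw [hy]

theorem IsFactor.integral_treeFun {q : X → Z} (h : IsFactor K μ V ρ q) (hV : IsUnitKernel V)
    (τ : TreeTerm) : ∫ x, treeFun K μ τ x ∂μ = ∫ z, treeFun V ρ τ z ∂ρ := by
  rw [integral_congr_ae (h.treeFun_ae_eq hV τ), ← h.measurePreserving.map_eq,
    integral_map h.measurePreserving.measurable.aemeasurable]
  rw [h.measurePreserving.map_eq]
  exact (measurable_treeFun hV τ).aestronglyMeasurable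

theorem isFactor_of_ae_eq {q : X → Z} (hq : MeasurePreserving q μ ρ) (hV : IsUnitKernel V)
    (h : ∀ᵐ p ∂(μ.prod μ), K p = V (q p.1, q p.2)) : IsFactor K μ V ρ q := by
  refine ⟨hq, fun g hg _ => ?_⟩
  filter_upwards [Measure.ae_ae_of_ae_prod h] with x hx
  rw [← hq.map_eq, integral_map hq.measurable.aemeasurable]
  · refine integral_congr_ae ?_
    filter_upwards [hx] with y hy
    rw [hy]
  · exact ((hV.measurable.comp measurable_prodMk_left).mul hg).aestronglyMeasurable

end TreeFun

/-! ### Measures determined by moments -/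

section Moments

open BoundedContinuousFunction

/-- Finite measures on a Polish space that agree on a multiplicatively closed, point-separating
family of bounded continuous functions are equal. -/
theorem ext_of_integral_eq_of_submonoid {E : Type*} [TopologicalSpace E] [PolishSpace E]
    [MeasurableSpace E] [BorelSpace E] {P P' : Measure E} [IsFiniteMeasure P] [IsFiniteMeasure P']
    (S : Set (E →ᵇ ℝ)) (hsep : ∀ x y : E, x ≠ y → ∃ f ∈ S, f x ≠ f y)
    (heq : ∀ g ∈ Submonoid.closure S, ∫ x, g x ∂P = ∫ x, g x ∂P') : P = P' := by
  -- Over the reals the star is trivial, so every subalgebra is a star subalgebra. It is the linear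
  -- span of the products of members of S, so integrals need to be compared on products only.
  have hstar : ∀ f : E →ᵇ ℝ, star f = f := fun f => by ext x; simp
  let A : StarSubalgebra ℝ (E →ᵇ ℝ) :=
    { Algebra.adjoin ℝ S with star_mem' := fun {a} ha => by rw [hstar]; exact ha }
  have hA : ∀ f, f ∈ A ↔ f ∈ Submodule.span ℝ (Submonoid.closure S : Set (E →ᵇ ℝ)) := fun f => by
    rw [← Algebra.adjoin_eq_span]; rfl
  refine ext_of_forall_mem_subalgebra_integral_eq_of_polish (𝕜 := ℝ) (A := A) ?_ ?_
  · intro x y hxy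
    obtain ⟨f, hf, hne⟩ := hsep x y hxy
    refine ⟨f, ⟨toContinuousMapStarₐ ℝ f, ⟨f, ?_, rfl⟩, rfl⟩, hne⟩
    exact (hA f).2 (Submodule.subset_span (Submonoid.subset_closure hf))
  · intro g hg
    rw [hA] at hg
    induction hg using Submodule.span_induction with
    | mem g hg => exact heq g hg
    | zero => simp
    | add f g _ _ hf hg =>
      simp only [BoundedContinuousFunction.coe_add, Pi.add_apply]
      rw [integral_add (f.integrable P) (g.integrable P), integral_add (f.integrable P')
        (g.integrable P'), hf, hg]
    | smul c f _ hf =>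
      simp only [BoundedContinuousFunction.coe_smul, smul_eq_mul, integral_const_mul]
      rw [hf]

end Moments

/-! ### Moments of measures on the space of tree values -/

/-- The space of values of all rooted tree functions. -/
abbrev TreeSpace : Type := TreeTerm → unitInterval

/-- The coordinate functions of `TreeSpace`, as bounded continuous functions on a space that
maps to it. -/
noncomputable def treeCoord {E : Type*} [TopologicalSpace E] (π : C(E, TreeSpace)) (τ : TreeTerm) :
    BoundedContinuousFunction E ℝ :=
  BoundedContinuousFunction.ofNormedAddCommGroup (fun x => (π x τ : ℝ))
    (continuous_subtype_val.comp ((continuous_apply τ).comp π.continuous)) 1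
    (fun x => by rw [Real.norm_of_nonneg (π x τ).2.1]; exact (π x τ).2.2)

/-- The points of `TreeSpace` that respect gluing. -/
def IsMultiplicative (z : TreeSpace) : Prop :=
  (z .point : ℝ) = 1 ∧ ∀ a b, (z (.glue a b) : ℝ) = z a * z b

/-- On multiplicative points each monomial in the coordinates equals a single coordinate, so the
first moments already contain all mixed moments, and Stone-Weierstrass applies. -/
theorem measure_treeSpace_ext {P P' : Measure TreeSpace} [IsFiniteMeasure P] [IsFiniteMeasure P']
    (hP : ∀ᵐ z ∂P, IsMultiplicative z) (hP' : ∀ᵐ z ∂P', IsMultiplicative z)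
    (h : ∀ τ, ∫ z, (z τ : ℝ) ∂P = ∫ z, (z τ : ℝ) ∂P') : P = P' := by
  refine ext_of_integral_eq_of_submonoid (Set.range (treeCoord (ContinuousMap.id TreeSpace)))
    ?_ ?_
  · intro x y hxy
    obtain ⟨τ, hτ⟩ := Function.ne_iff.1 hxy
    exact ⟨_, ⟨τ, rfl⟩, fun h => hτ (Subtype.ext h)⟩
  · intro g hg
    have key : ∃ τ, ∀ z, IsMultiplicative z → g z = z τ := by
      induction hg using Submonoid.closure_induction with
      | mem g hg => obtain ⟨τ, rfl⟩ := hg; exact ⟨τ, fun z _ => rfl⟩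
      | one => exact ⟨.point, fun z hz => hz.1.symm⟩
      | mul f g _ _ hf hg =>
        obtain ⟨a, ha⟩ := hf
        obtain ⟨b, hb⟩ := hg
        refine ⟨.glue a b, fun z hz => ?_⟩
        rw [BoundedContinuousFunction.mul_apply, ha z hz, hb z hz, hz.2]
    obtain ⟨τ, hτ⟩ := key
    rw [integral_congr_ae (hP.mono hτ), integral_congr_ae (hP'.mono hτ), h]

/-- With two variables a monomial collapses to one coordinate in each variable. Applied to the
measures with densities k and l, this identifies kernels on the quotient. -/
theorem measure_treeSpace_prod_ext {P P' : Measure (TreeSpace × TreeSpace)} [IsFiniteMeasure P]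
    [IsFiniteMeasure P']
    (hP : ∀ᵐ z ∂P, IsMultiplicative z.1 ∧ IsMultiplicative z.2)
    (hP' : ∀ᵐ z ∂P', IsMultiplicative z.1 ∧ IsMultiplicative z.2)
    (h : ∀ σ τ, ∫ z, (z.1 σ * z.2 τ : ℝ) ∂P = ∫ z, (z.1 σ * z.2 τ : ℝ) ∂P') : P = P' := by
  refine ext_of_integral_eq_of_submonoid (Set.range (treeCoord ⟨Prod.fst, continuous_fst⟩) ∪
    Set.range (treeCoord ⟨Prod.snd, continuous_snd⟩)) ?_ ?_
  · intro x y hxy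
    by_cases h1 : x.1 = y.1
    · have h2 : x.2 ≠ y.2 := fun h2 => hxy (Prod.ext h1 h2)
      obtain ⟨τ, hτ⟩ := Function.ne_iff.1 h2
      exact ⟨_, Or.inr ⟨τ, rfl⟩, fun h => hτ (Subtype.ext h)⟩
    · obtain ⟨τ, hτ⟩ := Function.ne_iff.1 h1
      exact ⟨_, Or.inl ⟨τ, rfl⟩, fun h => hτ (Subtype.ext h)⟩
  · intro g hg
    have key : ∃ σ τ, ∀ z : TreeSpace × TreeSpace,
        IsMultiplicative z.1 ∧ IsMultiplicative z.2 → g z = z.1 σ * z.2 τ := by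
      induction hg using Submonoid.closure_induction with
      | mem g hg =>
        rcases hg with ⟨τ, rfl⟩ | ⟨τ, rfl⟩
        · exact ⟨τ, .point, fun z hz => by rw [hz.2.1, mul_one]; rfl⟩
        · exact ⟨.point, τ, fun z hz => by rw [hz.1.1, one_mul]; rfl⟩
      | one => exact ⟨.point, .point, fun z hz => by rw [hz.1.1, hz.2.1]; simp⟩
      | mul f g _ _ hf hg =>
        obtain ⟨a, b, hab⟩ := hf
        obtain ⟨c, d, hcd⟩ := hg
        refine ⟨.glue a c, .glue b d, fun z hz => ?_⟩
        rw [BoundedContinuousFunction.mul_apply, hab z hz, hcd z hz, hz.1.2, hz.2.2]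
        ring
    obtain ⟨σ, τ, hg⟩ := key
    rw [integral_congr_ae (hP.mono hg), integral_congr_ae (hP'.mono hg), h]

/-! ### The tree map -/

section TreeMap

variable {X : Type*} [MeasurableSpace X] {μ : Measure X} [IsProbabilityMeasure μ]

/-- The map recording all rooted tree densities. -/
noncomputable def treeMap (W : Graphon μ) (x : X) : TreeSpace := fun τ =>
  ⟨treeFun W.ker μ τ x, treeFun_nonneg W.isUnitKernel τ x, treeFun_le_one W.isUnitKernel τ x⟩

theorem measurable_treeMap (W : Graphon μ) : Measurable (treeMap W) :=
  measurable_pi_lambda _ fun τ => (measurable_treeFun W.isUnitKernel τ).subtype_mk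

theorem isMultiplicative_treeMap (W : Graphon μ) (x : X) : IsMultiplicative (treeMap W x) :=
  ⟨rfl, fun _ _ => rfl⟩

theorem measurableSet_isMultiplicative : MeasurableSet {z | IsMultiplicative z} := by
  have h : ∀ τ : TreeTerm, Measurable fun z : TreeSpace => (z τ : ℝ) := fun τ =>
    measurable_subtype_coe.comp (measurable_pi_apply τ)
  have : {z | IsMultiplicative z} = {z : TreeSpace | (z .point : ℝ) = 1} ∩
      ⋂ a, ⋂ b, {z : TreeSpace | (z (.glue a b) : ℝ) = z a * z b} := by
    ext z; simp [IsMultiplicative]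
  rw [this]
  exact (measurableSet_eq_fun (h _) measurable_const).inter <| MeasurableSet.iInter fun a =>
    MeasurableSet.iInter fun b => measurableSet_eq_fun (h _) ((h a).mul (h b))

theorem ae_isMultiplicative (W : Graphon μ) :
    ∀ᵐ z ∂(μ.map (treeMap W)), IsMultiplicative z :=
  (ae_map_iff (measurable_treeMap W).aemeasurable measurableSet_isMultiplicative).2
    (Filter.Eventually.of_forall (isMultiplicative_treeMap W))

theorem integral_map_treeMap (W : Graphon μ) (τ : TreeTerm) :
    ∫ z, (z τ : ℝ) ∂(μ.map (treeMap W)) = ∫ x, treeFun W.ker μ τ x ∂μ :=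
  integral_map (measurable_treeMap W).aemeasurable
    (measurable_subtype_coe.comp (measurable_pi_apply τ)).aestronglyMeasurable

theorem map_treeMap_eq {Y : Type*} [MeasurableSpace Y] {ν : Measure Y} [IsProbabilityMeasure ν]
    (W : Graphon μ) (U : Graphon ν)
    (h : ∀ τ, ∫ x, treeFun W.ker μ τ x ∂μ = ∫ y, treeFun U.ker ν τ y ∂ν) :
    μ.map (treeMap W) = ν.map (treeMap U) := by
  have := Measure.isProbabilityMeasure_map (μ := μ) (measurable_treeMap W).aemeasurable
  have := Measure.isProbabilityMeasure_map (μ := ν) (measurable_treeMap U).aemeasurable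
  refine measure_treeSpace_ext (ae_isMultiplicative W) (ae_isMultiplicative U) fun τ => ?_
  rw [integral_map_treeMap, integral_map_treeMap, h]

end TreeMap

end FracIso

namespace FracIso

/-! ### Tree densities as integrals of rooted tree functions -/

section EdgeProd

variable {X : Type*}

open Classical in
/-- The product of a kernel over the edges of a graph on `{0, …, n-1}`. -/
noncomputable def edgeProd {n : ℕ} (F : SimpleGraph (Fin n)) (K : X × X → ℝ) (y : Fin n → X) : ℝ :=
  ∏ e ∈ Finset.univ.filter (fun e : Fin n × Fin n => e.1 < e.2 ∧ F.Adj e.1 e.2), K (y e.1, y e.2)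

/-- `ℓ` is a leaf of `F` with neighbour `u` (numbered after the deletion of `ℓ`). -/
def IsLeafAt {n : ℕ} (F : SimpleGraph (Fin (n + 1))) (ℓ : Fin (n + 1)) (u : Fin n) : Prop :=
  ∀ v, F.Adj ℓ v ↔ v = ℓ.succAbove u

theorem edgeProd_of_isLeafAt {n : ℕ} {F : SimpleGraph (Fin (n + 1))} {ℓ : Fin (n + 1)} {u : Fin n}
    (h : IsLeafAt F ℓ u) {K : X × X → ℝ} (hK : ∀ x y, K (x, y) = K (y, x))
    (y : Fin (n + 1) → X) :
    edgeProd F K y = K (y (ℓ.succAbove u), y ℓ) *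
      edgeProd (F.comap ℓ.succAbove) K (fun i => y (ℓ.succAbove i)) := by
  classical
  have expand : ∀ {m : ℕ} (G : SimpleGraph (Fin m)) (z : Fin m → X), edgeProd G K z =
      ∏ i, ∏ j, if i < j ∧ G.Adj i j then K (z i, z j) else 1 := by
    intro m G z
    rw [edgeProd, Finset.prod_filter, ← Finset.univ_product_univ, Finset.prod_product]
  have h' : ∀ i, F.Adj (ℓ.succAbove i) ℓ ↔ i = u := fun i => by
    rw [F.adj_comm, h]; exact Fin.succAbove_right_inj
  have h'' : ∀ i, F.Adj ℓ (ℓ.succAbove i) ↔ i = u := fun i => by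
    rw [h]; exact Fin.succAbove_right_inj
  rw [expand, expand, Fin.prod_univ_succAbove _ ℓ]
  simp_rw [Fin.prod_univ_succAbove _ ℓ]
  rw [Finset.prod_mul_distrib, ← mul_assoc]
  congr 1
  · simp only [lt_irrefl, false_and, if_false, one_mul, h', h'']
    rw [Finset.prod_eq_single u (fun b _ hb => if_neg fun h => hb h.2) (by simp),
      Finset.prod_eq_single u (fun b _ hb => if_neg fun h => hb h.2) (by simp)]
    -- The numbering decides which of the two ordered pairs represents the leaf edge. If ℓ comes
    -- first, symmetry of K at every point turns the factor around.
    rcases lt_or_gt_of_ne (Fin.succAbove_ne ℓ u) with hlt | hlt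
    · simp [hlt, hlt.not_gt]
    · simp [hlt, hlt.not_gt, hK (y ℓ)]
  · simp [SimpleGraph.comap_adj]

theorem isTree_comap_of_isLeafAt {n : ℕ} {F : SimpleGraph (Fin (n + 1))} {ℓ : Fin (n + 1)}
    {u : Fin n} (hF : F.IsTree) (h : IsLeafAt F ℓ u) : (F.comap ℓ.succAbove).IsTree := by
  classical
  refine ⟨?_, hF.isAcyclic.of_comap ⟨ℓ.succAbove, Fin.succAbove_right_injective⟩⟩
  have hdeg : F.degree ℓ = 1 := by
    rw [SimpleGraph.degree_eq_one_iff_existsUnique_adj]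
    exact ⟨ℓ.succAbove u, (h _).2 rfl, fun v hv => (h v).1 hv⟩
  have hc := hF.connected.induce_compl_singleton_of_degree_eq_one hdeg
  let e : F.comap ℓ.succAbove ≃g F.induce {ℓ}ᶜ :=
    { toEquiv := (finSuccAboveEquiv ℓ)
      map_rel_iff' := by intro a b; rfl }
  exact e.connected_iff.2 hc

theorem exists_isLeafAt {n : ℕ} {F : SimpleGraph (Fin (n + 2))} (hF : F.IsTree) :
    ∃ ℓ u, IsLeafAt F ℓ u := by
  classical
  obtain ⟨ℓ, hℓ⟩ := hF.exists_vert_degree_one_of_nontrivial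
  obtain ⟨w, hw, huniq⟩ := SimpleGraph.degree_eq_one_iff_existsUnique_adj.1 hℓ
  obtain ⟨u, hu⟩ := Fin.exists_succAbove_eq (F.ne_of_adj hw).symm
  refine ⟨ℓ, u, fun v => ⟨fun hv => ?_, fun hv => ?_⟩⟩
  · rw [hu]; exact huniq v hv
  · rw [hv, hu]; exact hw

/-- Attach a new leaf to the vertex `v`. -/
def addLeaf {n : ℕ} (F : SimpleGraph (Fin n)) (v : Fin n) : SimpleGraph (Fin (n + 1)) :=
  F.map Fin.castSuccEmb ⊔ SimpleGraph.edge (Fin.last n) v.castSucc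

theorem comap_addLeaf {n : ℕ} (F : SimpleGraph (Fin n)) (v : Fin n) :
    (addLeaf F v).comap (Fin.last n).succAbove = F := by
  ext a b
  simp only [SimpleGraph.comap_adj, addLeaf, SimpleGraph.sup_adj, Fin.succAbove_last,
    SimpleGraph.edge_adj, SimpleGraph.map_adj]
  constructor
  · rintro (⟨c, d, h, hc, hd⟩ | ⟨⟨h, -⟩ | ⟨-, h⟩, -⟩)
    · obtain rfl : c = a := Fin.castSucc_injective _ hc
      obtain rfl : d = b := Fin.castSucc_injective _ hd
      exact h
    · exact absurd h (Fin.castSucc_ne_last _)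
    · exact absurd h (Fin.castSucc_ne_last _)
  · exact fun h => Or.inl ⟨a, b, h, rfl, rfl⟩

theorem isLeafAt_addLeaf {n : ℕ} (F : SimpleGraph (Fin n)) (v : Fin n) :
    IsLeafAt (addLeaf F v) (Fin.last n) v := by
  intro w
  simp only [addLeaf, SimpleGraph.sup_adj, Fin.succAbove_last, SimpleGraph.edge_adj,
    SimpleGraph.map_adj]
  constructor
  · rintro (⟨c, d, h, hc, hd⟩ | ⟨⟨-, h⟩ | ⟨h, -⟩, -⟩)
    · exact absurd hc (Fin.castSucc_ne_last _)
    · exact h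
    · exact absurd h.symm (Fin.castSucc_ne_last _)
  · rintro rfl
    exact Or.inr ⟨Or.inl ⟨trivial, rfl⟩, (Fin.castSucc_ne_last _).symm⟩

/-- Acyclicity follows from counting: the graph stays connected, while one vertex and one edge are
added. -/
theorem isTree_addLeaf {n : ℕ} {F : SimpleGraph (Fin n)} (hF : F.IsTree) (v : Fin n) :
    (addLeaf F v).IsTree := by
  rw [SimpleGraph.isTree_iff_connected_and_card] at hF ⊢
  obtain ⟨hc, hcard⟩ := hF
  have hreach : ∀ a, (addLeaf F v).Reachable v.castSucc a := by
    intro a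
    induction a using Fin.lastCases with
    | last => exact (((isLeafAt_addLeaf F v) _).2 (Fin.succAbove_last_apply v).symm).symm.reachable
    | cast a =>
      have : F.map Fin.castSuccEmb ≤ addLeaf F v := le_sup_left
      exact ((hc.preconnected v a).map
        (SimpleGraph.Embedding.map Fin.castSuccEmb F).toHom).mono this
  refine ⟨(SimpleGraph.connected_iff _).2
    ⟨fun a b => (hreach a).symm.trans (hreach b), ⟨v.castSucc⟩⟩, ?_⟩
  have hne : Fin.last n ≠ v.castSucc := (Fin.castSucc_ne_last _).symm
  have : (addLeaf F v).edgeSet =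
      insert s(Fin.last n, v.castSucc) (Fin.castSuccEmb.sym2Map '' F.edgeSet) := by
    rw [addLeaf, SimpleGraph.edgeSet_sup, SimpleGraph.edgeSet_map,
      SimpleGraph.edgeSet_edge_of_ne hne, Set.union_comm]
    rfl
  rw [Nat.card_coe_set_eq, this, Set.ncard_insert_of_notMem _ (Set.toFinite _),
    Set.ncard_image_of_injective _ (Function.Embedding.injective _), ← Nat.card_coe_set_eq, hcard]
  · simp
  -- The new edge contains the new vertex, so it is not the image of an old edge.
  · rintro ⟨e, -, he⟩
    have : Fin.last n ∈ Fin.castSuccEmb.sym2Map e := by rw [he]; simp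
    rw [Function.Embedding.sym2Map_apply, Sym2.mem_map] at this
    obtain ⟨a, -, ha⟩ := this
    exact Fin.castSucc_ne_last _ ha

variable [MeasurableSpace X]

theorem measurable_edgeProd {n : ℕ} (F : SimpleGraph (Fin n)) {K : X × X → ℝ} (hK : Measurable K) :
    Measurable (edgeProd F K) := by
  classical
  exact Finset.measurable_prod _ fun e _ =>
    hK.comp ((measurable_pi_apply e.1).prodMk (measurable_pi_apply e.2))

theorem norm_edgeProd_le_one {n : ℕ} (F : SimpleGraph (Fin n)) {K : X × X → ℝ}
    (hK : IsUnitKernel K) (y : Fin n → X) : ‖edgeProd F K y‖ ≤ 1 := by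
  classical
  rw [edgeProd, norm_prod]
  exact Finset.prod_le_one (fun _ _ => norm_nonneg _) fun _ _ => hK.norm_le_one _

variable {μ : Measure X} [IsProbabilityMeasure μ]

theorem integral_pi_one (g : (Fin 1 → X) → ℝ) :
    ∫ y, g y ∂(Measure.pi fun _ => μ) = ∫ x, g (fun _ => x) ∂μ := by
  rw [← (measurePreserving_funUnique μ (Fin 1)).integral_comp'
    (fun x => g (fun _ => x))]
  refine integral_congr_ae (Filter.Eventually.of_forall fun y => ?_)
  simp only
  congr 1
  ext i
  rw [Subsingleton.elim i default]
  rfl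

/-- By Fubini the coordinate of the leaf is integrated first. It occurs only in f and in the single
edge to u, which leaves the integral operator applied to f, evaluated at the vertex u. -/
theorem integral_of_isLeafAt {n : ℕ} {F : SimpleGraph (Fin (n + 1))} {ℓ : Fin (n + 1)} {u : Fin n}
    (h : IsLeafAt F ℓ u) {K : X × X → ℝ} (hK : IsUnitKernel K) (hs : ∀ x y, K (x, y) = K (y, x))
    {g : (Fin n → X) → ℝ} (hg : Measurable g) (hg1 : ∀ y, ‖g y‖ ≤ 1) {f : X → ℝ}
    (hf : Measurable f) (hf1 : ∀ x, ‖f x‖ ≤ 1) :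
    ∫ y, g (fun i => y (ℓ.succAbove i)) * f (y ℓ) * edgeProd F K y ∂(Measure.pi fun _ => μ) =
      ∫ y, g y * (∫ t, K (y u, t) * f t ∂μ) * edgeProd (F.comap ℓ.succAbove) K y
        ∂(Measure.pi fun _ => μ) := by
  set F' := F.comap ℓ.succAbove
  let H : X × (Fin n → X) → ℝ := fun p => g p.2 * (K (p.2 u, p.1) * f p.1) * edgeProd F' K p.2
  have hHm : Measurable H :=
    ((hg.comp measurable_snd).mul ((hK.measurable.comp
      (((measurable_pi_apply u).comp measurable_snd).prodMk measurable_fst)).mul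
      (hf.comp measurable_fst))).mul ((measurable_edgeProd F' hK.measurable).comp measurable_snd)
  have hHi : Integrable H (μ.prod (Measure.pi fun _ => μ)) := by
    refine Integrable.of_bound hHm.aestronglyMeasurable 1 (Filter.Eventually.of_forall fun p => ?_)
    simp only [H, norm_mul]
    exact mul_le_one₀ (mul_le_one₀ (hg1 _) (by positivity)
      (mul_le_one₀ (hK.norm_le_one _) (norm_nonneg _) (hf1 _))) (norm_nonneg _)
      (norm_edgeProd_le_one F' hK _)
  calc _ = ∫ y, H (MeasurableEquiv.piFinSuccAbove (fun _ => X) ℓ y) ∂(Measure.pi fun _ => μ) := by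
        refine integral_congr_ae (Filter.Eventually.of_forall fun y => ?_)
        change _ = g (fun i => y (ℓ.succAbove i)) * (K (y (ℓ.succAbove u), y ℓ) * f (y ℓ)) *
          edgeProd F' K (fun i => y (ℓ.succAbove i))
        simp only [edgeProd_of_isLeafAt h hs]
        ring
    _ = ∫ p, H p ∂(μ.prod (Measure.pi fun _ => μ)) :=
        (measurePreserving_piFinSuccAbove (fun _ => μ) ℓ).integral_comp' H
    _ = ∫ y, ∫ t, H (t, y) ∂μ ∂(Measure.pi fun _ => μ) := integral_prod_symm _ hHi
    _ = _ := by
        refine integral_congr_ae (Filter.Eventually.of_forall fun y => ?_)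
        simp only [H]
        rw [integral_mul_const, integral_const_mul]

/-- Integrating a tree whose vertices carry rooted trees, one removes a leaf `ℓ` by hanging the
tree it carries from its neighbour. -/
theorem integral_prod_treeFun_of_isLeafAt {n : ℕ} {F : SimpleGraph (Fin (n + 1))}
    {ℓ : Fin (n + 1)} {u : Fin n} (h : IsLeafAt F ℓ u) {K : X × X → ℝ} (hK : IsUnitKernel K)
    (hs : ∀ x y, K (x, y) = K (y, x)) (w : Fin (n + 1) → TreeTerm) :
    ∫ y, (∏ i, treeFun K μ (w i) (y i)) * edgeProd F K y ∂(Measure.pi fun _ => μ) =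
      ∫ y, (∏ i, treeFun K μ (if i = u then .glue (w (ℓ.succAbove i)) (.plant (w ℓ))
        else w (ℓ.succAbove i)) (y i)) * edgeProd (F.comap ℓ.succAbove) K y
        ∂(Measure.pi fun _ => μ) := by
  have := integral_of_isLeafAt (μ := μ) h hK hs
    (g := fun y => ∏ i, treeFun K μ (w (ℓ.succAbove i)) (y i))
    (Finset.measurable_prod _ fun i _ => (measurable_treeFun hK _).comp (measurable_pi_apply i))
    (fun y => by
      rw [norm_prod]
      exact Finset.prod_le_one (fun _ _ => norm_nonneg _) fun _ _ => norm_treeFun_le_one hK _ _)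
    (measurable_treeFun (μ := μ) hK (w ℓ)) (norm_treeFun_le_one hK (w ℓ))
  refine (integral_congr_ae (Filter.Eventually.of_forall fun y => ?_)).trans
    (this.trans (integral_congr_ae (Filter.Eventually.of_forall fun y => ?_)))
  · simp only
    rw [Fin.prod_univ_succAbove _ ℓ, mul_comm (treeFun K μ (w ℓ) (y ℓ))]
  · have : ∀ i, treeFun K μ (if i = u then .glue (w (ℓ.succAbove i)) (.plant (w ℓ))
        else w (ℓ.succAbove i)) (y i) = treeFun K μ (w (ℓ.succAbove i)) (y i) *
          if i = u then treeFun K μ (.plant (w ℓ)) (y i) else 1 := by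
      intro i
      split_ifs
      · rfl
      · rw [mul_one]
    simp only [this]
    rw [Finset.prod_mul_distrib, Finset.prod_ite_eq' Finset.univ u]
    simp [treeFun]

end EdgeProd

/-! ### Passing between trees and rooted tree terms -/

section Densities

variable {X Y : Type*} [MeasurableSpace X] [MeasurableSpace Y] {μ : Measure X} {ν : Measure Y}
  [IsProbabilityMeasure μ] [IsProbabilityMeasure ν] {K : X × X → ℝ} {L : Y × Y → ℝ}

/-- The density of a tree is the integral of a rooted tree function. -/
theorem exists_term_of_isTree (hK : IsUnitKernel K) (hKs : ∀ x y, K (x, y) = K (y, x))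
    (hL : IsUnitKernel L) (hLs : ∀ x y, L (x, y) = L (y, x)) :
    ∀ (n : ℕ) (T : SimpleGraph (Fin (n + 1))) (_ : T.IsTree) (w : Fin (n + 1) → TreeTerm),
      ∃ σ, ∫ y, (∏ i, treeFun K μ (w i) (y i)) * edgeProd T K y ∂(Measure.pi fun _ => μ) =
          ∫ x, treeFun K μ σ x ∂μ ∧
        ∫ y, (∏ i, treeFun L ν (w i) (y i)) * edgeProd T L y ∂(Measure.pi fun _ => ν) =
          ∫ x, treeFun L ν σ x ∂ν
  | 0, T, _, w => by
    refine ⟨w 0, ?_, ?_⟩ <;>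
    · rw [integral_pi_one]
      simp [edgeProd, Subsingleton.elim _ (0 : Fin 1)]
  | n + 1, T, hT, w => by
    -- The weights w store the branches pruned so far. Leaf and new weights are chosen without
    -- reference to the kernels, so one term σ serves both.
    obtain ⟨ℓ, u, h⟩ := exists_isLeafAt hT
    obtain ⟨σ, h1, h2⟩ := exists_term_of_isTree hK hKs hL hLs n _ (isTree_comap_of_isLeafAt hT h)
      (fun i => if i = u then .glue (w (ℓ.succAbove i)) (.plant (w ℓ)) else w (ℓ.succAbove i))
    exact ⟨σ, by rw [integral_prod_treeFun_of_isLeafAt h hK hKs, h1],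
      by rw [integral_prod_treeFun_of_isLeafAt h hL hLs, h2]⟩

/-- `T'` arises from `T` by growing the rooted tree `τ` at the vertex `v`, as far as densities
in `K` are concerned; `e` embeds the vertices. -/
def GrowsAt (K : X × X → ℝ) (μ : Measure X) {n n' : ℕ} (T : SimpleGraph (Fin n))
    (T' : SimpleGraph (Fin n')) (e : Fin n → Fin n') (v : Fin n) (τ : TreeTerm) : Prop :=
  ∀ g : (Fin n → X) → ℝ, Measurable g → (∀ y, ‖g y‖ ≤ 1) →
    ∫ y, g (fun i => y (e i)) * edgeProd T' K y ∂(Measure.pi fun _ => μ) =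
      ∫ y, g y * treeFun K μ τ (y v) * edgeProd T K y ∂(Measure.pi fun _ => μ)

/-- This is why `GrowsAt` quantifies over test functions: after b has been grown at the image of v,
its tree function evaluated at v is absorbed into the test function when a is treated. -/
theorem GrowsAt.glue (hK : IsUnitKernel K) {n n' n'' : ℕ} {T : SimpleGraph (Fin n)}
    {T' : SimpleGraph (Fin n')} {T'' : SimpleGraph (Fin n'')} {e : Fin n → Fin n'}
    {e' : Fin n' → Fin n''} {v : Fin n} {a b : TreeTerm} (ha : GrowsAt K μ T T' e v a)
    (hb : GrowsAt K μ T' T'' e' (e v) b) :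
    GrowsAt K μ T T'' (fun i => e' (e i)) v (.glue a b) := by
  intro g hg hg1
  have h1 := hb (fun y => g fun i => y (e i))
    (hg.comp (measurable_pi_lambda _ fun i => measurable_pi_apply _)) (fun y => hg1 _)
  have h2 := ha (fun y => g y * treeFun K μ b (y v))
    (hg.mul ((measurable_treeFun hK b).comp (measurable_pi_apply v)))
    (fun y => by
      rw [norm_mul]; exact mul_le_one₀ (hg1 _) (norm_nonneg _) (norm_treeFun_le_one hK _ _))
  rw [h1, h2]
  refine integral_congr_ae (Filter.Eventually.of_forall fun y => ?_)
  simp only [treeFun]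
  ring

/-- Growing a at a fresh leaf weights that leaf by the tree function of a; integrating the leaf out,
with a test function that ignores it, leaves the planted function at v. -/
theorem GrowsAt.plant (hK : IsUnitKernel K) (hs : ∀ x y, K (x, y) = K (y, x)) {n n' : ℕ}
    {T : SimpleGraph (Fin n)} {T' : SimpleGraph (Fin n')} {e : Fin (n + 1) → Fin n'} {v : Fin n}
    {a : TreeTerm} (ha : GrowsAt K μ (addLeaf T v) T' e (Fin.last n) a) :
    GrowsAt K μ T T' (fun i => e i.castSucc) v (.plant a) := by
  intro g hg hg1
  have h1 := ha (fun y => g fun i => y i.castSucc)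
    (hg.comp (measurable_pi_lambda _ fun i => measurable_pi_apply _)) (fun y => hg1 _)
  have h2 := integral_of_isLeafAt (μ := μ) (isLeafAt_addLeaf T v) hK hs hg hg1
    (measurable_treeFun (μ := μ) hK a) (norm_treeFun_le_one hK a)
  rw [comap_addLeaf] at h2
  simp only [Fin.succAbove_last] at h2
  rw [h1, h2]
  rfl

/-- The two kernels are carried through one induction so that the same tree T' is obtained for both.
-/
theorem exists_growsAt (hK : IsUnitKernel K) (hKs : ∀ x y, K (x, y) = K (y, x))
    (hL : IsUnitKernel L) (hLs : ∀ x y, L (x, y) = L (y, x)) (τ : TreeTerm) :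
    ∀ (n : ℕ) (T : SimpleGraph (Fin n)) (_ : T.IsTree) (v : Fin n),
      ∃ (n' : ℕ) (T' : SimpleGraph (Fin n')) (e : Fin n → Fin n'), T'.IsTree ∧
        GrowsAt K μ T T' e v τ ∧ GrowsAt L ν T T' e v τ := by
  induction τ with
  | point =>
    intro n T hT v
    refine ⟨n, T, id, hT, ?_, ?_⟩ <;>
    · intro g _ _
      simp [treeFun]
  | glue a b iha ihb =>
    intro n T hT v
    obtain ⟨n', T', e, hT', h1, h2⟩ := iha n T hT v
    obtain ⟨n'', T'', e', hT'', h1', h2'⟩ := ihb n' T' hT' (e v)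
    exact ⟨n'', T'', _, hT'', h1.glue hK h1', h2.glue hL h2'⟩
  | plant a ih =>
    intro n T hT v
    obtain ⟨n', T', e, hT', h1, h2⟩ := ih (n + 1) (addLeaf T v) (isTree_addLeaf hT v) (Fin.last n)
    exact ⟨n', T', _, hT', h1.plant hK hKs, h2.plant hL hLs⟩

/-- Rooted tree functions integrate to densities of trees. -/
theorem exists_isTree_of_term (hK : IsUnitKernel K) (hKs : ∀ x y, K (x, y) = K (y, x))
    (hL : IsUnitKernel L) (hLs : ∀ x y, L (x, y) = L (y, x)) (τ : TreeTerm) :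
    ∃ (n : ℕ) (T : SimpleGraph (Fin n)), T.IsTree ∧
      ∫ y, edgeProd T K y ∂(Measure.pi fun _ => μ) = ∫ x, treeFun K μ τ x ∂μ ∧
      ∫ y, edgeProd T L y ∂(Measure.pi fun _ => ν) = ∫ x, treeFun L ν τ x ∂ν := by
  -- Growth starts from the one-vertex tree with test function 1.
  obtain ⟨n, T, e, hT, h1, h2⟩ := exists_growsAt (μ := μ) (ν := ν) hK hKs hL hLs τ 1 ⊥
    SimpleGraph.IsTree.of_subsingleton 0
  refine ⟨n, T, hT, ?_, ?_⟩
  · have := h1 (fun _ => 1) measurable_const (by simp)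
    rw [integral_pi_one] at this
    simpa [edgeProd] using this
  · have := h2 (fun _ => 1) measurable_const (by simp)
    rw [integral_pi_one] at this
    simpa [edgeProd] using this

/-! ### Reduction to kernels that are symmetric everywhere -/

/-- The symmetrization of the kernel of a graphon. -/
noncomputable def Graphon.symKer (W : Graphon μ) (p : X × X) : ℝ := (W.ker p + W.ker p.swap) / 2

theorem Graphon.isUnitKernel_symKer (W : Graphon μ) : IsUnitKernel W.symKer where
  measurable := (W.measurable_ker.add (W.measurable_ker.comp measurable_swap)).div_const 2
  nonneg p := by
    have := W.nonneg p
    have := W.nonneg p.swap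
    unfold Graphon.symKer
    positivity
  le_one p := by
    have := W.le_one p
    have := W.le_one p.swap
    unfold Graphon.symKer
    linarith

theorem Graphon.symKer_symm (W : Graphon μ) (x y : X) : W.symKer (x, y) = W.symKer (y, x) := by
  simp [Graphon.symKer, add_comm]

theorem Graphon.symKer_ae_eq (W : Graphon μ) : ∀ᵐ p ∂(μ.prod μ), W.ker p = W.symKer p := by
  filter_upwards [W.symm] with p hp
  rw [Graphon.symKer, hp]
  ring

/-- A kernel that agrees almost everywhere is a factor by the identity map. -/
theorem Graphon.integral_treeFun_symKer (W : Graphon μ) (τ : TreeTerm) :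
    ∫ x, treeFun W.ker μ τ x ∂μ = ∫ x, treeFun W.symKer μ τ x ∂μ :=
  (isFactor_of_ae_eq (MeasurePreserving.id μ) W.isUnitKernel_symKer
    W.symKer_ae_eq).integral_treeFun W.isUnitKernel_symKer τ

theorem measurePreserving_pair {n : ℕ} {i j : Fin n} (hij : i ≠ j) :
    MeasurePreserving (fun y : Fin n → X => (y i, y j)) (Measure.pi fun _ => μ) (μ.prod μ) := by
  refine ⟨(measurable_pi_apply i).prodMk (measurable_pi_apply j), ?_⟩
  have h : ProbabilityTheory.iIndepFun (fun (i : Fin n) (y : Fin n → X) => y i)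
      (Measure.pi fun _ => μ) :=
    ProbabilityTheory.iIndepFun_pi (X := fun _ x => x) fun _ => aemeasurable_id
  rw [(h.indepFun hij).map_prod_eq_prod_map_map (measurable_pi_apply i).aemeasurable
    (measurable_pi_apply j).aemeasurable, (measurePreserving_eval (fun _ : Fin n => μ) i).map_eq,
    (measurePreserving_eval (fun _ : Fin n => μ) j).map_eq]

/-- A change of the kernel on a null set is harmless, because the two ends of an edge are distinct
and hence independent coordinates; along the diagonal this would fail. -/
theorem Graphon.homDensity_eq (W : Graphon μ) {n : ℕ} (T : SimpleGraph (Fin n)) :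
    homDensity T W = ∫ y, edgeProd T W.symKer y ∂(Measure.pi fun _ => μ) := by
  classical
  have h : ∀ i j : Fin n, i < j → ∀ᵐ y ∂(Measure.pi fun _ => μ),
      W.ker (y i, y j) = W.symKer (y i, y j) := fun i j hij =>
    (measurePreserving_pair hij.ne).quasiMeasurePreserving.ae W.symKer_ae_eq
  have h' : ∀ᵐ y ∂(Measure.pi fun _ => μ), ∀ i j : Fin n, i < j →
      W.ker (y i, y j) = W.symKer (y i, y j) := by
    refine ae_all_iff.2 fun i => ae_all_iff.2 fun j => ?_
    by_cases hij : i < j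
    · filter_upwards [h i j hij] with y hy _ using hy
    · exact Filter.Eventually.of_forall fun _ h => absurd h hij
  refine integral_congr_ae ?_
  filter_upwards [h'] with y hy
  refine Finset.prod_congr rfl fun e he => ?_
  exact hy _ _ (Finset.mem_filter.1 he).2.1

/-- Two graphons have the same tree densities if and only if their rooted tree functions have the
same integrals. -/
theorem forall_homDensity_eq_iff (W : Graphon μ) (U : Graphon ν) :
    (∀ (n : ℕ) (T : SimpleGraph (Fin n)), T.IsTree → homDensity T W = homDensity T U) ↔
      ∀ τ, ∫ x, treeFun W.ker μ τ x ∂μ = ∫ y, treeFun U.ker ν τ y ∂ν := by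
  simp only [Graphon.homDensity_eq, Graphon.integral_treeFun_symKer]
  constructor
  · intro h τ
    obtain ⟨n, T, hT, h1, h2⟩ := exists_isTree_of_term (μ := μ) (ν := ν) W.isUnitKernel_symKer
      W.symKer_symm U.isUnitKernel_symKer U.symKer_symm τ
    rw [← h1, ← h2, h n T hT]
  · intro h n T hT
    cases n with
    | zero => exact (hT.connected.nonempty.some).elim0
    | succ n =>
      obtain ⟨σ, h1, h2⟩ := exists_term_of_isTree (μ := μ) (ν := ν) W.isUnitKernel_symKer
        W.symKer_symm U.isUnitKernel_symKer U.symKer_symm n T hT fun _ => .point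
      simp only [treeFun, Finset.prod_const_one, one_mul] at h1 h2
      rw [h1, h2, h σ]

end Densities

end FracIso

namespace FracIso

/-! ### Maps generating a sub-σ-algebra modulo null sets -/

/-- Integrals over sets do not notice null sets, so testing against the smaller σ-algebra already
tests against the larger one. -/
theorem condExp_ae_eq_condExp_of_le {X : Type*} {m₁ m₂ m₀ : MeasurableSpace X} {μ : Measure X}
    [IsFiniteMeasure μ] (h₁₂ : m₁ ≤ m₂) (h₂ : m₂ ≤ m₀)
    (h : ∀ s, MeasurableSet[m₂] s → ∃ t, MeasurableSet[m₁] t ∧ s =ᵐ[μ] t) {f : X → ℝ}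
    (hf : Integrable f μ) : μ[f | m₁] =ᵐ[μ] μ[f | m₂] := by
  refine ae_eq_condExp_of_forall_setIntegral_eq h₂ hf
    (fun s _ _ => integrable_condExp.integrableOn) (fun s hs _ => ?_)
    (stronglyMeasurable_condExp.mono h₁₂).aestronglyMeasurable
  obtain ⟨t, ht, hst⟩ := h s hs
  rw [setIntegral_congr_set hst, setIntegral_congr_set hst,
    setIntegral_condExp (h₁₂.trans h₂) hf ht]

section Generates

variable {X : Type*} [mX : MeasurableSpace X] {μ : Measure X} {Z : Type*} [MeasurableSpace Z]

/-- The map `q` generates the sub-σ-algebra `C` modulo null sets. -/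
structure Generates (q : X → Z) (C : SubAlg μ) : Prop where
  measurable_alg : Measurable[C.alg] q
  exists_preimage : ∀ B, MeasurableSet[C.alg] B → ∃ B', MeasurableSet B' ∧ B =ᵐ[μ] q ⁻¹' B'

theorem Generates.measurable {q : X → Z} {C : SubAlg μ} (h : Generates q C) : Measurable q :=
  h.measurable_alg.mono C.le le_rfl

/-- Relative completeness turns measurability up to null sets into genuine measurability. -/
theorem SubAlg.measurable_of_ae_eq (C : SubAlg μ) {α : Type*} [MeasurableSpace α] {f g : X → α}
    (hf : Measurable f) (hg : Measurable[C.alg] g) (h : f =ᵐ[μ] g) : Measurable[C.alg] f := by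
  intro A hA
  refine C.complete _ (g ⁻¹' A) (hf hA) (hg hA) ?_
  rw [measure_symmDiff_eq_zero_iff]
  filter_upwards [h] with x hx
  simp only [eq_iff_iff]
  change f x ∈ A ↔ g x ∈ A
  rw [hx]

/-- The relatively complete sub-σ-algebra generated by a map. -/
def SubAlg.ofMap (μ : Measure X) (q : X → Z) : SubAlg μ where
  alg :=
    { MeasurableSet' := fun s => MeasurableSet[mX] s ∧ ∃ t, MeasurableSet t ∧ s =ᵐ[μ] q ⁻¹' t
      measurableSet_empty := ⟨MeasurableSet.empty, ∅, MeasurableSet.empty, by simp⟩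
      measurableSet_compl := by
        rintro s ⟨hs, t, ht, hst⟩
        exact ⟨hs.compl, tᶜ, ht.compl, hst.compl⟩
      measurableSet_iUnion := by
        intro f hf
        choose hm t ht hft using hf
        refine ⟨MeasurableSet.iUnion hm, ⋃ i, t i, MeasurableSet.iUnion ht, ?_⟩
        rw [Set.preimage_iUnion]
        exact Filter.EventuallyEq.countable_iUnion hft }
  le := fun _ hs => hs.1
  complete := by
    rintro s s₀ hs ⟨_, t, ht, hst⟩ h
    exact ⟨hs, t, ht, (measure_symmDiff_eq_zero_iff.1 h).trans hst⟩

theorem generates_ofMap {q : X → Z} (hq : Measurable q) : Generates q (SubAlg.ofMap μ q) :=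
  ⟨fun t ht => ⟨hq ht, t, ht, Filter.EventuallyEq.rfl⟩, fun _ hB => hB.2⟩

variable [IsProbabilityMeasure μ]

/-- Conditioning on C and on the σ-algebra of q gives the same result. The former fixes f, the
latter is a function of q by the Doob-Dynkin factorization. -/
theorem Generates.exists_eq_comp_real {q : X → Z} {C : SubAlg μ} (h : Generates q C) {f : X → ℝ}
    (hf : Measurable[C.alg] f) (hfi : Integrable f μ) :
    ∃ g : Z → ℝ, Measurable g ∧ f =ᵐ[μ] g ∘ q := by
  have hle : MeasurableSpace.comap q inferInstance ≤ C.alg := h.measurable_alg.comap_le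
  obtain ⟨g, hg, hgq⟩ := (stronglyMeasurable_condExp (μ := μ) (f := f)
    (m := MeasurableSpace.comap q inferInstance)).exists_eq_measurable_comp
  refine ⟨g, hg.measurable, ?_⟩
  rw [← hgq]
  have h1 := condExp_ae_eq_condExp_of_le hle C.le (fun s hs => by
    obtain ⟨t, ht, hst⟩ := h.exists_preimage s hs
    exact ⟨_, ⟨t, ht, rfl⟩, hst⟩) hfi
  rw [condExp_of_stronglyMeasurable C.le hf.stronglyMeasurable hfi] at h1
  exact h1.symm

theorem Generates.exists_eq_comp {q : X → Z} {C : SubAlg μ} (h : Generates q C) {Z' : Type*}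
    [MeasurableSpace Z'] [StandardBorelSpace Z'] [Nonempty Z'] {f : X → Z'}
    (hf : Measurable[C.alg] f) : ∃ g : Z → Z', Measurable g ∧ f =ᵐ[μ] g ∘ q := by
  obtain ⟨e, he⟩ := exists_measurableEmbedding_real Z'
  -- The arctangent keeps the embedding and makes it bounded, so that the composite with f is
  -- integrable and the real case applies.
  have he' := (Real.continuous_arctan.measurableEmbedding Real.arctan_injective).comp he
  have hb : ∀ x, ‖(Real.arctan ∘ e) (f x)‖ ≤ Real.pi / 2 := fun x =>
    abs_le.2 ⟨(Real.neg_pi_div_two_lt_arctan _).le, (Real.arctan_lt_pi_div_two _).le⟩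
  have hm : Measurable[C.alg] fun x => (Real.arctan ∘ e) (f x) := he'.measurable.comp hf
  obtain ⟨g, hg, hgq⟩ := h.exists_eq_comp_real hm
    (Integrable.of_bound (hm.mono C.le le_rfl).aestronglyMeasurable _
      (Filter.Eventually.of_forall hb))
  refine ⟨fun z => he'.invFun (g z), he'.measurable_invFun.comp hg, ?_⟩
  filter_upwards [hgq] with x hx
  simp only [Function.comp_apply] at hx ⊢
  rw [← hx]
  exact (he'.leftInverse_invFun (f x)).symm

/-! ### The conditional expectation of a graphon as a kernel on a quotient -/

/-- Rectangles are replaced side by side, and the sets that can be replaced form a σ-algebra. -/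
theorem Generates.exists_preimage_prod {q : X → Z} {C : SubAlg μ} (h : Generates q C)
    {s : Set (X × X)} (hs : MeasurableSet[MeasurableSpace.prod C.alg C.alg] s) :
    ∃ t, MeasurableSet[MeasurableSpace.comap (Prod.map q q) inferInstance] t ∧
      s =ᵐ[μ.prod μ] t := by
  change MeasurableSet[@Prod.instMeasurableSpace _ _ C.alg C.alg] s at hs
  rw [← @generateFrom_prod X X C.alg C.alg] at hs
  induction s, hs using MeasurableSpace.generateFrom_induction with
  | hC s hs _ =>
    obtain ⟨A, hA, B, hB, rfl⟩ := hs
    obtain ⟨A', hA', hAA'⟩ := h.exists_preimage A hA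
    obtain ⟨B', hB', hBB'⟩ := h.exists_preimage B hB
    refine ⟨_, ⟨A' ×ˢ B', hA'.prod hB', rfl⟩, ?_⟩
    have h1 : (Prod.fst ⁻¹' A : Set (X × X)) =ᵐ[μ.prod μ] Prod.fst ⁻¹' (q ⁻¹' A') :=
      Measure.quasiMeasurePreserving_fst.preimage_ae_eq hAA'
    have h2 : (Prod.snd ⁻¹' B : Set (X × X)) =ᵐ[μ.prod μ] Prod.snd ⁻¹' (q ⁻¹' B') :=
      Measure.quasiMeasurePreserving_snd.preimage_ae_eq hBB'
    exact h1.inter h2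
  | empty => exact ⟨∅, @MeasurableSet.empty _ (_), Filter.EventuallyEq.rfl⟩
  | compl s _ ih =>
    obtain ⟨t, ht, hst⟩ := ih
    exact ⟨tᶜ, @MeasurableSet.compl _ _ (_) ht, hst.compl⟩
  | iUnion f _ ih =>
    choose t ht hft using ih
    exact ⟨⋃ i, t i, @MeasurableSet.iUnion _ _ (_) _ _ ht, Filter.EventuallyEq.countable_iUnion hft⟩

theorem SubAlg.prod_le (C : SubAlg μ) :
    MeasurableSpace.prod C.alg C.alg ≤ MeasurableSpace.prod mX mX :=
  sup_le_sup (MeasurableSpace.comap_mono C.le) (MeasurableSpace.comap_mono C.le)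

theorem condKer_mem (W : Graphon μ) (C : SubAlg μ) :
    ∀ᵐ p ∂(μ.prod μ), 0 ≤ condKer W C p ∧ condKer W C p ≤ 1 := by
  have hi := W.isUnitKernel.integrable (μ.prod μ)
  have h0 : 0 ≤ᵐ[μ.prod μ] condKer W C :=
    condExp_nonneg (Filter.Eventually.of_forall W.nonneg)
  have h1 : condKer W C ≤ᵐ[μ.prod μ] fun _ => (1 : ℝ) := by
    have := condExp_mono (m := MeasurableSpace.prod C.alg C.alg) hi (integrable_const (1 : ℝ))
      (Filter.Eventually.of_forall W.le_one)
    rwa [condExp_const C.prod_le] at this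
  filter_upwards [h0, h1] with p h0 h1 using ⟨h0, h1⟩

/-- Truncation of a kernel to the unit interval. -/
noncomputable def clampKer {Z : Type*} (k : Z × Z → ℝ) (p : Z × Z) : ℝ := max 0 (min 1 (k p))

theorem isUnitKernel_clampKer {k : Z × Z → ℝ} (hk : Measurable k) : IsUnitKernel (clampKer k) :=
  ⟨measurable_const.max (measurable_const.min hk), fun _ => le_max_left _ _,
    fun _ => max_le zero_le_one (min_le_left _ _)⟩

theorem clampKer_of_mem {k : Z × Z → ℝ} {p : Z × Z} (h : 0 ≤ k p ∧ k p ≤ 1) :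
    clampKer k p = k p := by
  rw [clampKer, min_eq_right h.2, max_eq_right h.1]

/-- Conditioning on C × C is, modulo null sets, conditioning on the pair (q(x), q(y)). No invariance
is involved. -/
theorem Generates.exists_condKer_eq {q : X → Z} {C : SubAlg μ} (h : Generates q C)
    (W : Graphon μ) : ∃ k : Z × Z → ℝ, IsUnitKernel k ∧
      ∀ᵐ p ∂(μ.prod μ), condKer W C p = k (q p.1, q p.2) := by
  have hm : Measurable[MeasurableSpace.prod C.alg C.alg] (Prod.map q q) :=
    @Measurable.prodMap _ _ _ _ C.alg _ C.alg _ _ _ h.measurable_alg h.measurable_alg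
  obtain ⟨k, hk, hkq⟩ := (stronglyMeasurable_condExp (μ := μ.prod μ) (f := W.ker)
    (m := MeasurableSpace.comap (Prod.map q q) inferInstance)).exists_eq_measurable_comp
  -- The factorized kernel lies in the unit interval only almost everywhere; truncation makes this
  -- hold at every point without changing it almost everywhere.
  refine ⟨clampKer k, isUnitKernel_clampKer hk.measurable, ?_⟩
  have h1 := condExp_ae_eq_condExp_of_le hm.comap_le C.prod_le
    (fun s hs => h.exists_preimage_prod hs) (W.isUnitKernel.integrable (μ.prod μ))
  filter_upwards [h1, condKer_mem W C] with p hp hmem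
  have hp' : condKer W C p = k (q p.1, q p.2) := by
    rw [condKer, ← hp, hkq]; rfl
  rw [hp'] at hmem ⊢
  exact (clampKer_of_mem hmem).symm

/-- The function 1_A(x) f(y) is measurable for C × C and can be pulled out of the conditional
expectation. -/
theorem setIntegral_condKer_mul (W : Graphon μ) (C : SubAlg μ) {f : X → ℝ}
    (hf : Measurable[C.alg] f) (hfi : Integrable f μ) {A : Set X} (hA : MeasurableSet[C.alg] A) :
    ∫ x in A, ∫ y, W.ker (x, y) * f y ∂μ ∂μ =
      ∫ p, condKer W C p * (A.indicator (fun _ => 1) p.1 * f p.2) ∂(μ.prod μ) := by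
  have hA' := C.le A hA
  have hind : Measurable[C.alg] (A.indicator fun _ => (1 : ℝ)) :=
    (@measurable_const ℝ X _ C.alg 1).indicator hA
  have hφ : Measurable[MeasurableSpace.prod C.alg C.alg]
      fun p : X × X => A.indicator (fun _ => (1 : ℝ)) p.1 * f p.2 :=
    (hind.comp (@measurable_fst _ _ C.alg C.alg)).mul (hf.comp (@measurable_snd _ _ C.alg C.alg))
  have hφi : Integrable (fun p : X × X => A.indicator (fun _ => (1 : ℝ)) p.1 * f p.2)
      (μ.prod μ) :=
    ((integrable_const (1 : ℝ)).indicator hA').mul_prod hfi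
  have hWφ : Integrable (fun p => W.ker p * (A.indicator (fun _ => (1 : ℝ)) p.1 * f p.2))
      (μ.prod μ) :=
    hφi.bdd_mul (c := 1) W.measurable_ker.aestronglyMeasurable
      (Filter.Eventually.of_forall W.isUnitKernel.norm_le_one)
  have hpull := condExp_mul_of_stronglyMeasurable_right (m := MeasurableSpace.prod C.alg C.alg)
    (μ := μ.prod μ) hφ.stronglyMeasurable hWφ (W.isUnitKernel.integrable _)
  calc _ = ∫ x, ∫ y, W.ker (x, y) * (A.indicator (fun _ => 1) x * f y) ∂μ ∂μ := by
        rw [← integral_indicator hA']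
        refine integral_congr_ae (Filter.Eventually.of_forall fun x => ?_)
        by_cases hx : x ∈ A <;> simp [hx]
    _ = ∫ p, W.ker p * (A.indicator (fun _ => 1) p.1 * f p.2) ∂(μ.prod μ) :=
        (integral_prod _ hWφ).symm
    _ = ∫ p, ((μ.prod μ)[fun p => W.ker p * (A.indicator (fun _ => 1) p.1 * f p.2) |
          MeasurableSpace.prod C.alg C.alg]) p ∂(μ.prod μ) := (integral_condExp C.prod_le).symm
    _ = _ := integral_congr_ae hpull

/-- Quotients by invariant sub-σ-algebras are factors. -/
theorem Generates.isFactor {q : X → Z} {C : SubAlg μ} (h : Generates q C) {W : Graphon μ}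
    (hC : IsInvariant W C) {k : Z × Z → ℝ} (hk : IsUnitKernel k)
    (hkW : ∀ᵐ p ∂(μ.prod μ), condKer W C p = k (q p.1, q p.2)) :
    IsFactor W.ker μ k (μ.map q) q := by
  have hq := h.measurable
  have := Measure.isProbabilityMeasure_map (μ := μ) hq.aemeasurable
  refine ⟨hq.measurePreserving μ, fun g hg hgL => ?_⟩
  have hf : Measurable[C.alg] (g ∘ q) := hg.comp h.measurable_alg
  have hfL : MemLp (g ∘ q) 2 μ := hgL.comp_measurePreserving (hq.measurePreserving μ)
  have hfi : Integrable (g ∘ q) μ := hfL.integrable (by norm_num)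
  have hgi : Integrable g (μ.map q) := hgL.integrable (by norm_num)
  have hT : graphonOp W (hfL.toLp _) =ᵐ[μ] fun x => ∫ y, W.ker (x, y) * g (q y) ∂μ := by
    filter_upwards [coeFn_graphonOp W (hfL.toLp _)] with x hx
    rw [hx]
    refine integral_congr_ae ?_
    filter_upwards [hfL.coeFn_toLp] with y hy
    rw [hy, Function.comp_apply]
  -- Invariance enters here only. It makes the left side measurable for C, so that it suffices to
  -- compare integrals over sets of C, and these do not distinguish W from W_C.
  have hu : AEStronglyMeasurable[C.alg] (fun x => ∫ y, W.ker (x, y) * g (q y) ∂μ) μ := by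
    refine AEStronglyMeasurable.congr ?_ hT
    exact mem_lpMeas_iff_aestronglyMeasurable.1 (hC _ (mem_lpMeas_iff_aestronglyMeasurable.2
      (hf.stronglyMeasurable.aestronglyMeasurable.congr hfL.coeFn_toLp.symm)))
  have hv : Measurable[C.alg] fun x => ∫ z, k (q x, z) * g z ∂(μ.map q) :=
    (hk.measurable_integral (μ := μ.map q) hg).comp h.measurable_alg
  have hui : Integrable (fun x => ∫ y, W.ker (x, y) * g (q y) ∂μ) μ :=
    (integrable_of_L2 _).congr hT
  have hkint : Integrable (fun p : Z × Z => k p * g p.2) ((μ.map q).prod (μ.map q)) :=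
    (hgi.comp_snd _).bdd_mul (c := 1) hk.measurable.aestronglyMeasurable
      (Filter.Eventually.of_forall hk.norm_le_one)
  have hvi : Integrable (fun x => ∫ z, k (q x, z) * g z ∂(μ.map q)) μ :=
    (hq.measurePreserving μ).integrable_comp_of_integrable hkint.integral_prod_left
  refine ae_eq_of_forall_setIntegral_eq_of_sigmaFinite' C.le
    (fun s _ _ => hui.integrableOn) (fun s _ _ => hvi.integrableOn) (fun A hA _ => ?_) hu
    hv.stronglyMeasurable.aestronglyMeasurable
  have hφi : Integrable (fun p : X × X => A.indicator (fun _ => (1 : ℝ)) p.1 * g (q p.2))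
      (μ.prod μ) :=
    ((integrable_const (1 : ℝ)).indicator (C.le A hA)).mul_prod hfi
  have hint : Integrable (fun p : X × X =>
      k (q p.1, q p.2) * (A.indicator (fun _ => (1 : ℝ)) p.1 * g (q p.2))) (μ.prod μ) :=
    hφi.bdd_mul (c := 1) (hk.measurable.comp ((hq.comp measurable_fst).prodMk
      (hq.comp measurable_snd))).aestronglyMeasurable
      (Filter.Eventually.of_forall fun _ => hk.norm_le_one _)
  have h1 := setIntegral_condKer_mul W C hf hfi hA
  simp only [Function.comp_apply] at h1
  rw [h1, integral_congr_ae (g := fun p : X × X =>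
      k (q p.1, q p.2) * (A.indicator (fun _ => (1 : ℝ)) p.1 * g (q p.2)))
      (by filter_upwards [hkW] with p hp; rw [hp]), integral_prod _ hint,
    ← integral_indicator (C.le A hA)]
  refine integral_congr_ae (Filter.Eventually.of_forall fun x => ?_)
  by_cases hx : x ∈ A
  · simp only [hx, Set.indicator_of_mem, one_mul]
    exact (integral_map hq.aemeasurable (f := fun z => k (q x, z) * g z)
      ((hk.measurable.comp measurable_prodMk_left).mul hg).aestronglyMeasurable).symm
  · simp [hx]

end Generates

/-! ### The quotient on the Cantor space -/

section QuotMap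

variable {X : Type*} [mX : MeasurableSpace X] [MeasurableSpace.CountablyGenerated X]
  {μ : Measure X} [IsProbabilityMeasure μ]

theorem generates_quotMap (C : SubAlg μ) : Generates (quotMap C) C := by
  classical
  have hpre : ∀ n, quotMap C ⁻¹' {z | z n = true} = genSeq C n := fun n => by
    ext x
    simp [quotMap]
  have hspec := (exists_generating_seq C).choose_spec
  refine ⟨@measurable_pi_lambda X ℕ (fun _ => Bool) C.alg _ _ fun n =>
    @measurable_to_bool X C.alg _ ?_, fun B hB => ?_⟩
  · have : (fun x => quotMap C x n) ⁻¹' {true} = genSeq C n := hpre n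
    rw [this]
    exact hspec.1 n
  · obtain ⟨B', hB', hBB'⟩ := hspec.2 B hB
    have hle : MeasurableSpace.generateFrom (Set.range (genSeq C)) ≤
        MeasurableSpace.comap (quotMap C) inferInstance := by
      refine MeasurableSpace.generateFrom_le ?_
      rintro _ ⟨n, rfl⟩
      exact ⟨_, measurable_pi_apply n (measurableSet_singleton true), hpre n⟩
    obtain ⟨t, ht, rfl⟩ := hle B' hB'
    exact ⟨t, ht, measure_symmDiff_eq_zero_iff.1 hBB'⟩

theorem quotGraphon_ae_eq (W : Graphon μ) (C : SubAlg μ) {k : (ℕ → Bool) × (ℕ → Bool) → ℝ}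
    (hk : IsUnitKernel k)
    (h : ∀ᵐ p ∂(μ.prod μ), condKer W C p = k (quotMap C p.1, quotMap C p.2)) :
    quotGraphon W C =ᵐ[(quotMeasure C).prod (quotMeasure C)] k := by
  have hkL : MemLp k 2 ((quotMeasure C).prod (quotMeasure C)) :=
    MemLp.of_bound hk.measurable.aestronglyMeasurable 1
      (Filter.Eventually.of_forall hk.norm_le_one)
  have h1 : (memLp_condKer W C).toLp _ = quotEmbed C (hkL.toLp _) := by
    refine (MemLp.toLp_congr _ (hkL.comp_measurePreserving
      ((measurePreserving_quotMap C).prod (measurePreserving_quotMap C))) ?_).trans rfl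
    filter_upwards [h] with p hp
    rw [hp]; rfl
  -- W_C is the image of k under the embedding, and the adjoint of an isometry is a left inverse of
  -- it.
  have h2 : (quotEmbed C).adjoint ∘L quotEmbed C = 1 :=
    (ContinuousLinearMap.norm_map_iff_adjoint_comp_self _).1
      fun x => LinearIsometry.norm_map _ x
  have h3 : quotGraphon W C = hkL.toLp _ := by
    rw [quotGraphon, h1]
    exact congrArg (fun T => T (hkL.toLp _)) h2
  rw [h3]
  exact hkL.coeFn_toLp

end QuotMap

end FracIso

namespace FracIso

/-! ### The tree map generates the minimum invariant sub-σ-algebra -/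

section Density

/-- The coordinate functions of `TreeSpace` in `L²`. -/
noncomputable def coordLp (ρ : Measure TreeSpace) [IsProbabilityMeasure ρ] (τ : TreeTerm) :
    Lp ℝ 2 ρ :=
  MemLp.toLp (fun z : TreeSpace => (z τ : ℝ))
    (MemLp.of_bound (measurable_subtype_coe.comp (measurable_pi_apply τ)).aestronglyMeasurable 1
      (Filter.Eventually.of_forall fun z => by
        rw [Real.norm_of_nonneg (z τ).2.1]; exact (z τ).2.2))

variable {ρ : Measure TreeSpace} [IsProbabilityMeasure ρ]

theorem coeFn_coordLp (τ : TreeTerm) : coordLp ρ τ =ᵐ[ρ] fun z => (z τ : ℝ) :=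
  MemLp.coeFn_toLp _

theorem measurable_coord (τ : TreeTerm) : Measurable fun z : TreeSpace => (z τ : ℝ) :=
  measurable_subtype_coe.comp (measurable_pi_apply τ)

theorem integral_withDensity_ofReal {α : Type*} [MeasurableSpace α] {ρ : Measure α} {g f : α → ℝ}
    (hg : Measurable g) :
    ∫ z, f z ∂(ρ.withDensity fun z => ENNReal.ofReal (g z)) = ∫ z, max (g z) 0 * f z ∂ρ := by
  rw [integral_withDensity_eq_integral_toReal_smul hg.ennreal_ofReal
    (Filter.Eventually.of_forall fun _ => ENNReal.ofReal_lt_top)]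
  simp only [ENNReal.toReal_ofReal', smul_eq_mul]

/-- The coordinates span a dense subspace of `L²` for a measure carried by multiplicative points. -/
theorem eq_top_of_coordLp_mem (hρ : ∀ᵐ z ∂ρ, IsMultiplicative z) (K : Submodule ℝ (Lp ℝ 2 ρ))
    (hK : IsClosed (K : Set (Lp ℝ 2 ρ))) (h : ∀ τ, coordLp ρ τ ∈ K) : K = ⊤ := by
  rw [← hK.submodule_topologicalClosure_eq, Submodule.topologicalClosure_eq_top_iff,
    Submodule.eq_bot_iff]
  intro g hg
  have hgi : Integrable g ρ := integrable_of_L2 g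
  have hgm : Measurable g := (Lp.stronglyMeasurable g).measurable
  have hgm' : Measurable fun z => -g z := hgm.neg
  have horth : ∀ τ, ∫ z, g z * (z τ : ℝ) ∂ρ = 0 := fun τ => by
    have := hg _ (h τ)
    rw [L2.inner_def] at this
    rw [← this]
    refine integral_congr_ae ?_
    filter_upwards [coeFn_coordLp (ρ := ρ) τ] with z hz
    rw [hz]; simp
  have hfin : ∀ f : TreeSpace → ℝ, Integrable f ρ →
      IsFiniteMeasure (ρ.withDensity fun z => ENNReal.ofReal (f z)) := fun f hf =>
    isFiniteMeasure_withDensity_ofReal hf.2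
  have := hfin g hgi
  have := hfin (fun z => -g z) hgi.neg
  have hac : ∀ f : TreeSpace → ℝ, ∀ᵐ z ∂(ρ.withDensity fun z => ENNReal.ofReal (f z)),
      IsMultiplicative z := fun f => (withDensity_absolutelyContinuous ρ _).ae_le hρ
  -- A function g orthogonal to all coordinates has positive and negative parts with equal
  -- coordinate integrals. The measures with these densities therefore coincide, so the two parts
  -- agree almost everywhere; as they are never both positive, g vanishes.
  have heq : (ρ.withDensity fun z => ENNReal.ofReal (g z)) =
      ρ.withDensity fun z => ENNReal.ofReal (-g z) := by
    refine measure_treeSpace_ext (hac g) (hac fun z => -g z) fun τ => ?_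
    rw [integral_withDensity_ofReal hgm, integral_withDensity_ofReal hgm', ← sub_eq_zero,
      ← integral_sub]
    · refine Eq.trans ?_ (horth τ)
      refine integral_congr_ae (Filter.Eventually.of_forall fun z => ?_)
      simp only
      rw [← sub_mul]
      congr 1
      rcases le_total (g z) 0 with hz | hz
      · rw [max_eq_right hz, max_eq_left (by linarith)]; ring
      · rw [max_eq_left hz, max_eq_right (by linarith)]; ring
    · exact hgi.pos_part.mul_bdd (c := 1) (measurable_coord τ).aestronglyMeasurable
        (Filter.Eventually.of_forall fun z => by
          rw [Real.norm_of_nonneg (z τ).2.1]; exact (z τ).2.2)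
    · exact hgi.neg.pos_part.mul_bdd (c := 1) (measurable_coord τ).aestronglyMeasurable
        (Filter.Eventually.of_forall fun z => by
          rw [Real.norm_of_nonneg (z τ).2.1]; exact (z τ).2.2)
  rw [withDensity_eq_iff hgm.ennreal_ofReal.aemeasurable hgm'.ennreal_ofReal.aemeasurable] at heq
  · rw [Lp.eq_zero_iff_ae_eq_zero]
    filter_upwards [heq] with z hz
    rcases le_total (g z) 0 with h0 | h0
    · rw [ENNReal.ofReal_of_nonpos h0, eq_comm, ENNReal.ofReal_eq_zero] at hz
      simp only [Pi.zero_apply]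
      linarith
    · rw [ENNReal.ofReal_of_nonpos (p := -g z) (by linarith), ENNReal.ofReal_eq_zero] at hz
      simp only [Pi.zero_apply]
      linarith
  · exact hgi.lintegral_lt_top.ne

end Density

section MinAlg

variable {X : Type*} [mX : MeasurableSpace X] {μ : Measure X} [IsProbabilityMeasure μ]

theorem coeFn_graphonOp_toLp (W : Graphon μ) {f : X → ℝ} (hf : MemLp f 2 μ) :
    graphonOp W (hf.toLp f) =ᵐ[μ] fun x => ∫ y, W.ker (x, y) * f y ∂μ := by
  filter_upwards [coeFn_graphonOp W (hf.toLp f)] with x hx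
  rw [hx]
  refine integral_congr_ae ?_
  filter_upwards [hf.coeFn_toLp] with y hy
  rw [hy]

/-- Invariance gives the step for `plant` only up to a null set; relative completeness of C removes
that set. -/
theorem IsInvariant.measurable_treeFun {W : Graphon μ} {C : SubAlg μ} (hC : IsInvariant W C)
    (τ : TreeTerm) : Measurable[C.alg] (treeFun W.ker μ τ) := by
  induction τ with
  | point => exact @measurable_const ℝ X _ C.alg 1
  | glue a b iha ihb => exact iha.mul ihb
  | plant a ih =>
    have hL := memLp_treeFun (μ := μ) W.isUnitKernel a 2
    have h1 := hC _ (mem_lpMeas_iff_aestronglyMeasurable.2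
      (ih.stronglyMeasurable.aestronglyMeasurable.congr hL.coeFn_toLp.symm))
    obtain ⟨g, hg, hgeq⟩ := mem_lpMeas_iff_aestronglyMeasurable.1 h1
    exact C.measurable_of_ae_eq (FracIso.measurable_treeFun W.isUnitKernel (.plant a))
      hg.measurable ((coeFn_graphonOp_toLp W hL).symm.trans hgeq)

theorem IsInvariant.measurable_treeMap {W : Graphon μ} {C : SubAlg μ} (hC : IsInvariant W C) :
    Measurable[C.alg] (treeMap W) :=
  @measurable_pi_lambda X TreeTerm (fun _ => unitInterval) C.alg _ _ fun τ =>
    (hC.measurable_treeFun τ).subtype_mk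

/-- Composition with a measure preserving map, as an operator on `L²`. -/
noncomputable abbrev compLp {Z : Type*} [MeasurableSpace Z] {ρ : Measure Z} {q : X → Z}
    (hq : MeasurePreserving q μ ρ) : Lp ℝ 2 ρ →L[ℝ] Lp ℝ 2 μ :=
  (Lp.compMeasurePreservingₗᵢ ℝ q hq).toContinuousLinearMap

theorem coeFn_compLp {Z : Type*} [MeasurableSpace Z] {ρ : Measure Z} {q : X → Z}
    (hq : MeasurePreserving q μ ρ) (f : Lp ℝ 2 ρ) : compLp hq f =ᵐ[μ] f ∘ q :=
  Lp.coeFn_compMeasurePreserving f hq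

/-- The functions h on `TreeSpace` for which T_W(h ∘ treeMap) is measurable for this σ-algebra form
a closed subspace of L². It contains every coordinate τ, whose image is the coordinate `plant τ`,
and the coordinates span a dense subspace. -/
theorem isInvariant_ofMap_treeMap (W : Graphon μ) :
    IsInvariant W (SubAlg.ofMap μ (treeMap W)) := by
  set D := SubAlg.ofMap μ (treeMap W)
  have hq := measurable_treeMap W
  have hgen : Generates (treeMap W) D := generates_ofMap hq
  have := Measure.isProbabilityMeasure_map (μ := μ) hq.aemeasurable
  have hqp := hq.measurePreserving μ
  let T := graphonOp W ∘L compLp hqp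
  have hclosed : IsClosed (lpMeas ℝ ℝ D.alg 2 μ : Set (Lp ℝ 2 μ)) := by
    have : (lpMeas ℝ ℝ D.alg 2 μ : Set (Lp ℝ 2 μ)) =
        {f : Lp ℝ 2 μ | AEStronglyMeasurable[D.alg] f μ} := by
      ext f; exact mem_lpMeas_iff_aestronglyMeasurable
    rw [this]
    exact isClosed_aestronglyMeasurable D.le
  have htop := eq_top_of_coordLp_mem (ae_isMultiplicative W)
    ((lpMeas ℝ ℝ D.alg 2 μ).comap T.toLinearMap) (hclosed.preimage T.continuous) fun τ => by
      have hL := memLp_treeFun (μ := μ) W.isUnitKernel τ 2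
      have h1 : compLp hqp (coordLp _ τ) = hL.toLp _ := rfl
      change graphonOp W (compLp hqp (coordLp _ τ)) ∈ lpMeas ℝ ℝ D.alg 2 μ
      rw [h1, mem_lpMeas_iff_aestronglyMeasurable]
      have hm : Measurable[D.alg] (treeFun W.ker μ (.plant τ)) :=
        (measurable_coord (.plant τ)).comp hgen.measurable_alg
      exact hm.stronglyMeasurable.aestronglyMeasurable.congr (coeFn_graphonOp_toLp W hL).symm
  intro f hf
  rw [mem_lpMeas_iff_aestronglyMeasurable, aestronglyMeasurable_iff] at hf
  -- A function measurable for the σ-algebra of the tree map comes from `TreeSpace`, where density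
  -- applies.
  obtain ⟨g, hg, hfg⟩ := hgen.exists_eq_comp_real hf (integrable_of_L2 f)
  have hgL : MemLp g 2 (μ.map (treeMap W)) := by
    rw [memLp_map_measure_iff hg.aestronglyMeasurable hq.aemeasurable]
    exact (Lp.memLp f).ae_eq hfg
  have hf' : f = compLp hqp (hgL.toLp g) := by
    refine Lp.ext (hfg.trans ?_)
    have h1 : compLp hqp (hgL.toLp g) = (hgL.comp_measurePreserving hqp).toLp _ := rfl
    rw [h1]
    exact (hgL.comp_measurePreserving hqp).coeFn_toLp.symm
  rw [hf']
  have : hgL.toLp g ∈ (lpMeas ℝ ℝ D.alg 2 μ).comap T.toLinearMap := by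
    rw [htop]; exact Submodule.mem_top
  exact this

/-- The tree functions are measurable for every invariant σ-algebra, and the σ-algebra they generate
is itself invariant. -/
theorem generates_treeMap (W : Graphon μ) : Generates (treeMap W) (minAlg W) :=
  ⟨(minAlg_isLeast W).1.measurable_treeMap, fun B hB =>
    (generates_ofMap (μ := μ) (measurable_treeMap W)).exists_preimage B
      ((minAlg_isLeast W).2 _ (isInvariant_ofMap_treeMap W) B hB)⟩

end MinAlg

/-! ### The common quotient of graphons with equal tree densities -/

section Common

variable {X : Type*} [MeasurableSpace X] {μ : Measure X} [IsProbabilityMeasure μ]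

/-- The mixed moments of the quotient kernel are tree integrals: a tree σ at one end of an edge and
τ at the other glue to the term `glue σ (plant τ)`. Tree integrals thus determine the kernel. -/
theorem IsFactor.integral_mul_coord {W : Graphon μ} {k : TreeSpace × TreeSpace → ℝ}
    (hk : IsUnitKernel k) (h : IsFactor W.ker μ k (μ.map (treeMap W)) (treeMap W))
    (σ τ : TreeTerm) :
    ∫ z, k z * (z.1 σ * z.2 τ : ℝ) ∂((μ.map (treeMap W)).prod (μ.map (treeMap W))) =
      ∫ x, treeFun W.ker μ (.glue σ (.plant τ)) x ∂μ := by
  set ρ := μ.map (treeMap W)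
  have : IsProbabilityMeasure ρ := 
    Measure.isProbabilityMeasure_map (measurable_treeMap W).aemeasurable
  -- The quotient reproduces its own points: the tree functions of k at z are the coordinates of z.
  have hcoord : ∀ τ, ∀ᵐ z ∂ρ, (z τ : ℝ) = treeFun k ρ τ z := fun τ =>
    (ae_map_iff (measurable_treeMap W).aemeasurable
      (measurableSet_eq_fun (measurable_coord τ) (measurable_treeFun hk τ))).2
      (h.treeFun_ae_eq hk τ)
  have hb : ∀ z : TreeSpace, ∀ τ, ‖(z τ : ℝ)‖ ≤ 1 := fun z τ => by
    rw [Real.norm_of_nonneg (z τ).2.1]; exact (z τ).2.2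
  have hi : Integrable (fun z : TreeSpace × TreeSpace => k z * (z.1 σ * z.2 τ : ℝ))
      (ρ.prod ρ) := by
    refine Integrable.of_bound (hk.measurable.mul (((measurable_coord σ).comp measurable_fst).mul
      ((measurable_coord τ).comp measurable_snd))).aestronglyMeasurable 1
      (Filter.Eventually.of_forall fun z => ?_)
    simp only [norm_mul]
    exact mul_le_one₀ (hk.norm_le_one z) (by positivity)
      (mul_le_one₀ (hb _ _) (norm_nonneg _) (hb _ _))
  rw [h.integral_treeFun hk, integral_prod _ hi]
  refine integral_congr_ae ?_
  filter_upwards [hcoord σ] with z hz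
  simp only [treeFun]
  rw [← hz, ← integral_const_mul]
  refine integral_congr_ae ?_
  filter_upwards [hcoord τ] with z' hz'
  rw [← hz']
  ring

/-- Graphons with equal tree densities have a common quotient, carried by `TreeSpace`. -/
theorem exists_common_kernel {Y : Type*} [MeasurableSpace Y] {ν : Measure Y}
    [IsProbabilityMeasure ν] (W : Graphon μ) (U : Graphon ν)
    (h : ∀ τ, ∫ x, treeFun W.ker μ τ x ∂μ = ∫ y, treeFun U.ker ν τ y ∂ν) :
    ∃ k : TreeSpace × TreeSpace → ℝ, IsUnitKernel k ∧
      (∀ᵐ p ∂(μ.prod μ), condKer W (minAlg W) p = k (treeMap W p.1, treeMap W p.2)) ∧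
      ∀ᵐ p ∂(ν.prod ν), condKer U (minAlg U) p = k (treeMap U p.1, treeMap U p.2) := by
  obtain ⟨k, hk, hkW⟩ := (generates_treeMap W).exists_condKer_eq W
  obtain ⟨l, hl, hlU⟩ := (generates_treeMap U).exists_condKer_eq U
  refine ⟨k, hk, hkW, ?_⟩
  have hWf := (generates_treeMap W).isFactor (minAlg_isLeast W).1 hk hkW
  have hUf := (generates_treeMap U).isFactor (minAlg_isLeast U).1 hl hlU
  have hmap := map_treeMap_eq W U h
  have h1 := hWf.integral_mul_coord hk
  have h2 := hUf.integral_mul_coord hl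
  have hmult := ae_isMultiplicative W
  rw [← hmap] at h2
  have hprob := Measure.isProbabilityMeasure_map (μ := μ) (measurable_treeMap W).aemeasurable
  set ρ := μ.map (treeMap W)
  have hmult' : ∀ᵐ z ∂(ρ.prod ρ), IsMultiplicative z.1 ∧ IsMultiplicative z.2 :=
    (Measure.quasiMeasurePreserving_fst.ae hmult).and (Measure.quasiMeasurePreserving_snd.ae hmult)
  have hfin : ∀ {f : TreeSpace × TreeSpace → ℝ}, IsUnitKernel f →
      IsFiniteMeasure ((ρ.prod ρ).withDensity fun z => ENNReal.ofReal (f z)) := fun hf =>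
    isFiniteMeasure_withDensity_ofReal (hf.integrable _).2
  have := hfin hk
  have := hfin hl
  -- Both kernels now live over the same law ρ, and their mixed moments are equal tree integrals of
  -- W and of U.
  have heq : (ρ.prod ρ).withDensity (fun z => ENNReal.ofReal (k z)) =
      (ρ.prod ρ).withDensity fun z => ENNReal.ofReal (l z) := by
    refine measure_treeSpace_prod_ext ((withDensity_absolutelyContinuous _ _).ae_le hmult')
      ((withDensity_absolutelyContinuous _ _).ae_le hmult') fun σ τ => ?_
    rw [integral_withDensity_ofReal hk.measurable, integral_withDensity_ofReal hl.measurable]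
    simp only [max_eq_left (hk.nonneg _), max_eq_left (hl.nonneg _)]
    rw [h1, h2, h]
  rw [withDensity_eq_iff hk.measurable.ennreal_ofReal.aemeasurable
    hl.measurable.ennreal_ofReal.aemeasurable (Integrable.lintegral_lt_top (hk.integrable _)).ne] at heq
  have hkl : ∀ᵐ z ∂(ρ.prod ρ), k z = l z := by
    filter_upwards [heq] with z hz
    exact (ENNReal.ofReal_eq_ofReal_iff (hk.nonneg z) (hl.nonneg z)).1 hz
  have hmp : MeasurePreserving (treeMap U) ν ρ := ⟨measurable_treeMap U, hmap.symm⟩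
  filter_upwards [hlU, (hmp.prod hmp).quasiMeasurePreserving.ae hkl] with p hp hp'
  rw [hp]
  exact hp'.symm

end Common

end FracIso

namespace FracIso

/-! ### Isomorphism of quotients -/

section Iso

theorem KerIso.symm {X Y : Type*} [MeasurableSpace X] [MeasurableSpace Y] {μ : Measure X}
    {ν : Measure Y} [SFinite μ] [SFinite ν] {V : X × X → ℝ} {V' : Y × Y → ℝ}
    (h : KerIso μ ν V V') : KerIso ν μ V' V := by
  obtain ⟨φ, ψ, hφ, hψ, hψφ, hφψ, hV⟩ := h
  refine ⟨ψ, φ, hψ, hφ, hφψ, hψφ, ?_⟩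
  filter_upwards [(hψ.prod hψ).quasiMeasurePreserving.ae hV,
    Measure.quasiMeasurePreserving_fst.ae hφψ, Measure.quasiMeasurePreserving_snd.ae hφψ]
    with p hp h1 h2
  simp only [Prod.map_fst, Prod.map_snd, h1, h2] at hp
  exact hp.symm

theorem KerIso.trans {X Y Z : Type*} [MeasurableSpace X] [MeasurableSpace Y] [MeasurableSpace Z]
    {μ : Measure X} {ν : Measure Y} {ρ : Measure Z} [SFinite μ] [SFinite ν] [SFinite ρ]
    {V : X × X → ℝ} {V' : Y × Y → ℝ} {V'' : Z × Z → ℝ} (h : KerIso μ ν V V')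
    (h' : KerIso ν ρ V' V'') : KerIso μ ρ V V'' := by
  obtain ⟨φ, ψ, hφ, hψ, hψφ, hφψ, hV⟩ := h
  obtain ⟨φ', ψ', hφ', hψ', hψφ', hφψ', hV'⟩ := h'
  refine ⟨φ' ∘ φ, ψ ∘ ψ', hφ'.comp hφ, hψ.comp hψ', ?_, ?_, ?_⟩
  · filter_upwards [hψφ, hφ.quasiMeasurePreserving.ae hψφ'] with x h1 h2
    simp only [Function.comp_apply, h2, h1]
  · filter_upwards [hφψ', hψ'.quasiMeasurePreserving.ae hφψ] with x h1 h2
    simp only [Function.comp_apply, h2, h1]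
  · filter_upwards [hV, (hφ.prod hφ).quasiMeasurePreserving.ae hV'] with p h1 h2
    rw [h1]
    exact h2

theorem KerIso.congr {X Y : Type*} [MeasurableSpace X] [MeasurableSpace Y] {μ : Measure X}
    {ν : Measure Y} [SFinite μ] [SFinite ν] {V V₁ : X × X → ℝ} {V' V₁' : Y × Y → ℝ}
    (h : KerIso μ ν V V') (hV : V =ᵐ[μ.prod μ] V₁) (hV' : V' =ᵐ[ν.prod ν] V₁') :
    KerIso μ ν V₁ V₁' := by
  obtain ⟨φ, ψ, hφ, hψ, hψφ, hφψ, hVV⟩ := h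
  refine ⟨φ, ψ, hφ, hψ, hψφ, hφψ, ?_⟩
  filter_upwards [hV, (hφ.prod hφ).quasiMeasurePreserving.ae hV', hVV] with p h1 h2 h3
  rw [← h1, h3]
  exact h2

/-- Two realizations of the quotient by the same sub-σ-algebra are isomorphic. -/
theorem Generates.kerIso {X : Type*} [MeasurableSpace X] {μ : Measure X} [IsProbabilityMeasure μ]
    {Z Z' : Type*} [MeasurableSpace Z] [MeasurableSpace Z'] [StandardBorelSpace Z]
    [StandardBorelSpace Z'] {C : SubAlg μ} {q : X → Z} {q' : X → Z'} (h : Generates q C)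
    (h' : Generates q' C) {V : Z × Z → ℝ} {V' : Z' × Z' → ℝ} (hV : Measurable V)
    (hV' : Measurable V') (heq : ∀ᵐ p ∂(μ.prod μ), V (q p.1, q p.2) = V' (q' p.1, q' p.2)) :
    KerIso (μ.map q) (μ.map q') V V' := by
  obtain ⟨x⟩ : Nonempty X := nonempty_of_isProbabilityMeasure μ
  have : Nonempty Z := ⟨q x⟩
  have : Nonempty Z' := ⟨q' x⟩
  have hq := h.measurable
  have hq' := h'.measurable
  -- Each of q and q' is measurable for C, so each factors through the other; the two factorizations
  -- are mutually inverse almost everywhere.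
  obtain ⟨α, hα, hαq⟩ := h.exists_eq_comp h'.measurable_alg
  obtain ⟨β, hβ, hβq⟩ := h'.exists_eq_comp h.measurable_alg
  have := Measure.isProbabilityMeasure_map (μ := μ) hq.aemeasurable
  refine ⟨α, β, ⟨hα, ?_⟩, ⟨hβ, ?_⟩, ?_, ?_, ?_⟩
  · rw [Measure.map_map hα hq, Measure.map_congr hαq]
  · rw [Measure.map_map hβ hq', Measure.map_congr hβq]
  · refine (ae_map_iff hq.aemeasurable (measurableSet_eq_fun (hβ.comp hα) measurable_id)).2 ?_
    filter_upwards [hαq, hβq] with x h1 h2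
    simp only [Function.comp_apply, id_eq] at h1 h2 ⊢
    rw [← h1, ← h2]
  · refine (ae_map_iff hq'.aemeasurable (measurableSet_eq_fun (hα.comp hβ) measurable_id)).2 ?_
    filter_upwards [hαq, hβq] with x h1 h2
    simp only [Function.comp_apply, id_eq] at h1 h2 ⊢
    rw [← h2, ← h1]
  · have hm := (hq.measurePreserving μ).prod (hq.measurePreserving μ)
    rw [← hm.map_eq]
    refine (ae_map_iff hm.measurable.aemeasurable (measurableSet_eq_fun hV
      (hV'.comp ((hα.comp measurable_fst).prodMk (hα.comp measurable_snd))))).2 ?_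
    filter_upwards [heq, Measure.quasiMeasurePreserving_fst.ae hαq,
      Measure.quasiMeasurePreserving_snd.ae hαq] with p hp h1 h2
    simp only [Function.comp_apply] at h1 h2
    simp only [Prod.map_fst, Prod.map_snd, Prod.map_apply', Function.comp_apply]
    rw [hp, h1, h2]

variable {X Y : Type*} [MeasurableSpace X] [StandardBorelSpace X] [MeasurableSpace Y]
  [StandardBorelSpace Y] {μ : Measure X} {ν : Measure Y} [IsProbabilityMeasure μ]
  [IsProbabilityMeasure ν]

/-- The quotient graphon by an invariant sub-σ-algebra is a factor. -/
theorem exists_quotGraphon_factor (W : Graphon μ) (C : SubAlg μ) (hC : IsInvariant W C) :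
    ∃ k, IsUnitKernel k ∧ quotGraphon W C =ᵐ[(quotMeasure C).prod (quotMeasure C)] k ∧
      (∀ᵐ p ∂(μ.prod μ), condKer W C p = k (quotMap C p.1, quotMap C p.2)) ∧
      IsFactor W.ker μ k (quotMeasure C) (quotMap C) := by
  obtain ⟨k, hk, hkW⟩ := (generates_quotMap C).exists_condKer_eq W
  exact ⟨k, hk, quotGraphon_ae_eq W C hk hkW, hkW, (generates_quotMap C).isFactor hC hk hkW⟩

/-- An isomorphism is in particular a factor map, so tree integrals pass from W to its quotient,
across to the other quotient, and back to U. -/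
theorem integral_treeFun_eq_of_kerIso (W : Graphon μ) (U : Graphon ν)
    (h : KerIso (quotMeasure (minAlg W)) (quotMeasure (minAlg U)) (quotGraphon W (minAlg W))
      (quotGraphon U (minAlg U))) (τ : TreeTerm) :
    ∫ x, treeFun W.ker μ τ x ∂μ = ∫ y, treeFun U.ker ν τ y ∂ν := by
  obtain ⟨k, hk, hk1, -, hk2⟩ := exists_quotGraphon_factor W _ (minAlg_isLeast W).1
  obtain ⟨l, hl, hl1, -, hl2⟩ := exists_quotGraphon_factor U _ (minAlg_isLeast U).1
  obtain ⟨φ, ψ, hφ, -, -, -, hkl⟩ := h.congr hk1 hl1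
  rw [hk2.integral_treeFun hk, hl2.integral_treeFun hl,
    (isFactor_of_ae_eq hφ hl hkl).integral_treeFun hl]

/-- Both quotients are isomorphic to the common kernel over the law of the tree maps, as `quotMap`
and `treeMap` generate the same σ-algebra. -/
theorem kerIso_of_integral_treeFun_eq (W : Graphon μ) (U : Graphon ν)
    (h : ∀ τ, ∫ x, treeFun W.ker μ τ x ∂μ = ∫ y, treeFun U.ker ν τ y ∂ν) :
    KerIso (quotMeasure (minAlg W)) (quotMeasure (minAlg U)) (quotGraphon W (minAlg W))
      (quotGraphon U (minAlg U)) := by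
  obtain ⟨k, hk, hk1, hk2, -⟩ := exists_quotGraphon_factor W _ (minAlg_isLeast W).1
  obtain ⟨l, hl, hl1, hl2, -⟩ := exists_quotGraphon_factor U _ (minAlg_isLeast U).1
  obtain ⟨m, hm, hmW, hmU⟩ := exists_common_kernel W U h
  have hW : KerIso (quotMeasure (minAlg W)) (μ.map (treeMap W)) k m :=
    (generates_quotMap _).kerIso (generates_treeMap W) hk.measurable hm.measurable (by
      filter_upwards [hk2, hmW] with p h1 h2
      rw [← h1, h2])
  have hU : KerIso (quotMeasure (minAlg U)) (ν.map (treeMap U)) l m :=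
    (generates_quotMap _).kerIso (generates_treeMap U) hl.measurable hm.measurable (by
      filter_upwards [hl2, hmU] with p h1 h2
      rw [← h1, h2])
  rw [← map_treeMap_eq W U h] at hU
  exact (hW.trans hU.symm).congr hk1.symm hl1.symm

end Iso

/-! ### The cut norm -/

section CutNorm

variable {Ω : Type*} [MeasurableSpace Ω] {π : Measure Ω} [IsProbabilityMeasure π]
  {F : Ω × Ω → ℝ}

theorem cutNorm_nonneg (π : Measure Ω) (F : Ω × Ω → ℝ) : 0 ≤ cutNorm π F :=
  Real.sSup_nonneg (by rintro _ ⟨A, B, -, -, rfl⟩; exact abs_nonneg _)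

theorem cutNorm_congr {F' : Ω × Ω → ℝ} (h : F =ᵐ[π.prod π] F') : cutNorm π F = cutNorm π F' := by
  have : ∀ A B : Set Ω, ∫ p in A ×ˢ B, F p ∂(π.prod π) = ∫ p in A ×ˢ B, F' p ∂(π.prod π) :=
    fun A B => integral_congr_ae (ae_restrict_of_ae h)
  simp only [cutNorm, this]

theorem cutNorm_zero : cutNorm π (fun _ => 0) = 0 := by
  refine le_antisymm (Real.sSup_le ?_ le_rfl) (cutNorm_nonneg _ _)
  rintro _ ⟨A, B, -, -, rfl⟩
  simp

theorem abs_setIntegral_le_cutNorm (hF : Integrable F (π.prod π)) {A B : Set Ω}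
    (hA : MeasurableSet A) (hB : MeasurableSet B) :
    |∫ p in A ×ˢ B, F p ∂(π.prod π)| ≤ cutNorm π F := by
  refine le_csSup ⟨∫ p, |F p| ∂(π.prod π), ?_⟩ ⟨A, B, hA, hB, rfl⟩
  rintro _ ⟨A, B, -, -, rfl⟩
  exact abs_integral_le_integral_abs.trans (setIntegral_le_integral hF.abs
    (Filter.Eventually.of_forall fun _ => abs_nonneg _))

/-- For fixed A the integral has the form ∫ g b. Among weights b with values in the unit interval it
is extremal at the indicators of {g ≤ 0} and {g ≥ 0}, for which it is an integral of F over a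
rectangle. -/
theorem abs_setIntegral_mul_le_cutNorm (hFm : Measurable F) (hF1 : ∀ p, ‖F p‖ ≤ 1) {b : Ω → ℝ}
    (hb : Measurable b) (hb0 : ∀ ω, 0 ≤ b ω) (hb1 : ∀ ω, b ω ≤ 1) {A : Set Ω}
    (hA : MeasurableSet A) :
    |∫ ω in A, ∫ ω', F (ω, ω') * b ω' ∂π ∂π| ≤ cutNorm π F := by
  have hFi : Integrable F (π.prod π) := Integrable.of_bound hFm.aestronglyMeasurable 1
    (Filter.Eventually.of_forall hF1)
  set g : Ω → ℝ := fun ω' => ∫ ω in A, F (ω, ω') ∂π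
  have hFA : Integrable F ((π.restrict A).prod π) := Integrable.of_bound
    hFm.aestronglyMeasurable 1 (Filter.Eventually.of_forall hF1)
  have hgm : Measurable g :=
    (hFm.stronglyMeasurable.integral_prod_left' (μ := π.restrict A)).measurable
  have hgi : Integrable g π := hFA.integral_prod_right
  have hgb : Integrable (fun ω' => g ω' * b ω') π :=
    hgi.mul_bdd (c := 1) hb.aestronglyMeasurable
      (Filter.Eventually.of_forall fun ω => by rw [Real.norm_of_nonneg (hb0 ω)]; exact hb1 ω)
  have h1 : ∫ ω in A, ∫ ω', F (ω, ω') * b ω' ∂π ∂π = ∫ ω', g ω' * b ω' ∂π := by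
    rw [integral_integral_swap (f := fun ω ω' => F (ω, ω') * b ω')]
    · simp only [integral_mul_const, g]
    · exact hFA.mul_bdd (c := 1) (hb.comp measurable_snd).aestronglyMeasurable
        (Filter.Eventually.of_forall fun p => by
          rw [Real.norm_of_nonneg (hb0 p.2)]; exact hb1 p.2)
  have hset : ∀ B, MeasurableSet B → |∫ ω' in B, g ω' ∂π| ≤ cutNorm π F := fun B hB => by
    have h2 : ∫ ω' in B, g ω' ∂π = ∫ p in A ×ˢ B, F p ∂(π.prod π) := by
      rw [← Measure.prod_restrict, integral_prod_symm]
      rw [Measure.prod_restrict]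
      exact hFi.integrableOn
    rw [h2]
    exact abs_setIntegral_le_cutNorm hFi hA hB
  rw [h1, abs_le]
  constructor
  · have hB : MeasurableSet {ω | g ω ≤ 0} := hgm measurableSet_Iic
    refine (neg_le_of_abs_le (hset _ hB)).trans ?_
    rw [← integral_indicator hB]
    refine integral_mono (hgi.indicator hB) hgb fun ω => ?_
    by_cases hω : g ω ≤ 0
    · rw [Set.indicator_of_mem (by exact hω)]
      nlinarith [hb1 ω]
    · rw [Set.indicator_of_notMem (by exact hω)]
      exact mul_nonneg (not_le.1 hω).le (hb0 ω)
  · have hB : MeasurableSet {ω | 0 ≤ g ω} := hgm measurableSet_Ici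
    refine le_trans ?_ ((le_abs_self _).trans (hset _ hB))
    rw [← integral_indicator hB]
    refine integral_mono hgb (hgi.indicator hB) fun ω => ?_
    by_cases hω : 0 ≤ g ω
    · rw [Set.indicator_of_mem (by exact hω)]
      simp only
      nlinarith [hb1 ω]
    · rw [Set.indicator_of_notMem (by exact hω)]
      exact mul_nonpos_of_nonpos_of_nonneg (not_le.1 hω).le (hb0 ω)

/-- The `L¹` norm of the image of a function with values in the unit interval is controlled by
the cut norm. -/
theorem integral_abs_integral_mul_le_cutNorm (hFm : Measurable F) (hF1 : ∀ p, ‖F p‖ ≤ 1)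
    {b : Ω → ℝ} (hb : Measurable b) (hb0 : ∀ ω, 0 ≤ b ω) (hb1 : ∀ ω, b ω ≤ 1) :
    ∫ ω, |∫ ω', F (ω, ω') * b ω' ∂π| ∂π ≤ 2 * cutNorm π F := by
  set u : Ω → ℝ := fun ω => ∫ ω', F (ω, ω') * b ω' ∂π
  have hFb : Measurable fun p : Ω × Ω => F p * b p.2 := hFm.mul (hb.comp measurable_snd)
  have hum : Measurable u := (hFb.stronglyMeasurable.integral_prod_right' (ν := π)).measurable
  have hFbi : Integrable (fun p : Ω × Ω => F p * b p.2) (π.prod π) :=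
    Integrable.of_bound hFb.aestronglyMeasurable 1 (Filter.Eventually.of_forall fun p => by
      rw [norm_mul, Real.norm_of_nonneg (hb0 _)]
      exact mul_le_one₀ (hF1 p) (hb0 _) (hb1 _))
  have hui : Integrable u π := hFbi.integral_prod_left
  -- The absolute value is resolved by splitting along the sign of u; each half costs one cut norm,
  -- whence the factor 2.
  have hB : MeasurableSet {ω | 0 ≤ u ω} := hum measurableSet_Ici
  have h1 := abs_setIntegral_mul_le_cutNorm (π := π) hFm hF1 hb hb0 hb1 hB
  have h2 := abs_setIntegral_mul_le_cutNorm (π := π) hFm hF1 hb hb0 hb1 hB.compl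
  rw [← integral_add_compl hB hui.abs]
  have e1 : ∫ ω in {ω | 0 ≤ u ω}, |u ω| ∂π = ∫ ω in {ω | 0 ≤ u ω}, u ω ∂π :=
    setIntegral_congr_fun hB fun ω hω => abs_of_nonneg hω
  have e2 : ∫ ω in {ω | 0 ≤ u ω}ᶜ, |u ω| ∂π = -∫ ω in {ω | 0 ≤ u ω}ᶜ, u ω ∂π := by
    rw [← integral_neg]
    exact setIntegral_congr_fun hB.compl fun ω hω => abs_of_neg (not_le.1 hω)
  rw [e1, e2]
  have := le_abs_self (∫ ω in {ω | 0 ≤ u ω}, u ω ∂π)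
  have := neg_le_abs (∫ ω in {ω | 0 ≤ u ω}ᶜ, u ω ∂π)
  linarith

end CutNorm

/-! ### Tree densities and the cut distance -/

section CutDist

variable {X Y : Type*} [MeasurableSpace X] [MeasurableSpace Y] {μ : Measure X} {ν : Measure Y}
  [IsProbabilityMeasure μ] [IsProbabilityMeasure ν]

theorem measurePreserving_fst_of_fst_eq {π : Measure (X × Y)} (h : π.fst = μ) :
    MeasurePreserving Prod.fst π μ := ⟨measurable_fst, h⟩

theorem measurePreserving_snd_of_snd_eq {π : Measure (X × Y)} (h : π.snd = ν) :
    MeasurePreserving Prod.snd π ν := ⟨measurable_snd, h⟩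

theorem isProbabilityMeasure_of_fst_eq {π : Measure (X × Y)} (h : π.fst = μ) :
    IsProbabilityMeasure π :=
  ⟨by rw [← Measure.fst_univ, h, measure_univ]⟩

theorem _root_.MeasureTheory.MeasurePreserving.integral_comp_of_measurable {α β : Type*}
    [MeasurableSpace α] [MeasurableSpace β] {π : Measure α} {ρ : Measure β} {q : α → β}
    (hq : MeasurePreserving q π ρ) {f : β → ℝ} (hf : Measurable f) :
    ∫ x, f (q x) ∂π = ∫ z, f z ∂ρ := by
  rw [← hq.map_eq, integral_map hq.measurable.aemeasurable hf.aestronglyMeasurable]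

/-- Under a coupling, rooted tree functions differ in `L¹` by a multiple of the cut norm. -/
theorem exists_integral_abs_treeFun_sub_le {K : X × X → ℝ} {L : Y × Y → ℝ} (hK : IsUnitKernel K)
    (hL : IsUnitKernel L) (τ : TreeTerm) :
    ∃ c : ℝ, 0 ≤ c ∧ ∀ π : Measure (X × Y), π.fst = μ → π.snd = ν →
      ∫ ω, |treeFun K μ τ ω.1 - treeFun L ν τ ω.2| ∂π ≤
        c * cutNorm π (fun p => K (p.1.1, p.2.1) - L (p.1.2, p.2.2)) := by
  have hmeas : ∀ τ, Measurable fun ω : X × Y => treeFun K μ τ ω.1 - treeFun L ν τ ω.2 := fun τ =>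
    ((measurable_treeFun hK τ).comp measurable_fst).sub
      ((measurable_treeFun hL τ).comp measurable_snd)
  have hbd : ∀ τ (ω : X × Y), ‖treeFun K μ τ ω.1 - treeFun L ν τ ω.2‖ ≤ 1 := fun τ ω => by
    rw [Real.norm_eq_abs, abs_le]
    have := treeFun_nonneg (μ := μ) hK τ ω.1
    have := treeFun_le_one (μ := μ) hK τ ω.1
    have := treeFun_nonneg (μ := ν) hL τ ω.2
    have := treeFun_le_one (μ := ν) hL τ ω.2
    constructor <;> linarith
  have hint : ∀ τ (π : Measure (X × Y)), π.fst = μ →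
      Integrable (fun ω => treeFun K μ τ ω.1 - treeFun L ν τ ω.2) π := fun τ π hπ => by
    have := isProbabilityMeasure_of_fst_eq hπ
    exact Integrable.of_bound (hmeas τ).aestronglyMeasurable 1
      (Filter.Eventually.of_forall (hbd τ))
  induction τ with
  | point => exact ⟨0, le_rfl, fun π _ _ => by simp [treeFun]⟩
  | glue a b iha ihb =>
    obtain ⟨c, hc, hca⟩ := iha
    obtain ⟨d, hd, hdb⟩ := ihb
    refine ⟨c + d, by positivity, fun π h1 h2 => ?_⟩
    have := isProbabilityMeasure_of_fst_eq h1
    rw [add_mul]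
    refine le_trans ?_ (add_le_add (hca π h1 h2) (hdb π h1 h2))
    rw [← integral_add (hint a π h1).abs (hint b π h1).abs]
    refine integral_mono (hint (.glue a b) π h1).abs
      ((hint a π h1).abs.add (hint b π h1).abs) fun ω => ?_
    simp only [treeFun, Pi.add_apply]
    -- Telescoping: the factors are exchanged one at a time, and the remaining factor is at most 1.
    have e : treeFun K μ a ω.1 * treeFun K μ b ω.1 - treeFun L ν a ω.2 * treeFun L ν b ω.2 =
      (treeFun K μ a ω.1 - treeFun L ν a ω.2) * treeFun K μ b ω.1 +
        treeFun L ν a ω.2 * (treeFun K μ b ω.1 - treeFun L ν b ω.2) := by ring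
    rw [e]
    refine (abs_add_le _ _).trans (add_le_add ?_ ?_)
    · rw [abs_mul]
      exact mul_le_of_le_one_right (abs_nonneg _) (norm_treeFun_le_one hK b ω.1)
    · rw [abs_mul]
      exact mul_le_of_le_one_left (abs_nonneg _) (norm_treeFun_le_one hL a ω.2)
  | plant a ih =>
    obtain ⟨c, hc, hca⟩ := ih
    -- Replacing K by L against the fixed weight coming from X costs twice the cut norm; replacing
    -- the weight under L costs c by induction.
    refine ⟨2 + c, by positivity, fun π h1 h2 => ?_⟩
    have := isProbabilityMeasure_of_fst_eq h1
    set F : (X × Y) × (X × Y) → ℝ := fun p => K (p.1.1, p.2.1) - L (p.1.2, p.2.2)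
    have hFm : Measurable F := by
      refine (hK.measurable.comp ?_).sub (hL.measurable.comp ?_) <;> fun_prop
    have hF1 : ∀ p, ‖F p‖ ≤ 1 := fun p => by
      rw [Real.norm_eq_abs, abs_le]
      have := hK.nonneg (p.1.1, p.2.1)
      have := hK.le_one (p.1.1, p.2.1)
      have := hL.nonneg (p.1.2, p.2.2)
      have := hL.le_one (p.1.2, p.2.2)
      constructor <;> simp only [F] <;> linarith
    have hb : Measurable fun ω : X × Y => treeFun K μ a ω.1 :=
      (measurable_treeFun hK a).comp measurable_fst
    have hcut := integral_abs_integral_mul_le_cutNorm (π := π) hFm hF1 hb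
      (fun ω => treeFun_nonneg hK a ω.1) (fun ω => treeFun_le_one hK a ω.1)
    set u : X × Y → ℝ := fun ω => ∫ ω', F (ω, ω') * treeFun K μ a ω'.1 ∂π
    set d : ℝ := ∫ ω, |treeFun K μ a ω.1 - treeFun L ν a ω.2| ∂π
    have hFb : Integrable (fun p : (X × Y) × (X × Y) => F p * treeFun K μ a p.2.1)
        (π.prod π) := by
      refine Integrable.of_bound (hFm.mul (hb.comp measurable_snd)).aestronglyMeasurable 1
        (Filter.Eventually.of_forall fun p => ?_)
      rw [norm_mul]
      exact mul_le_one₀ (hF1 p) (norm_nonneg _) (norm_treeFun_le_one hK a _)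
    have hpt : ∀ ω : X × Y,
        |treeFun K μ (.plant a) ω.1 - treeFun L ν (.plant a) ω.2| ≤ |u ω| + d := by
      intro ω
      have hLm : Measurable fun ω' : X × Y => L (ω.2, ω'.2) :=
        hL.measurable.comp (measurable_const.prodMk measurable_snd)
      have hLi : Integrable (fun ω' : X × Y =>
          L (ω.2, ω'.2) * (treeFun K μ a ω'.1 - treeFun L ν a ω'.2)) π :=
        (hint a π h1).bdd_mul (c := 1) hLm.aestronglyMeasurable
          (Filter.Eventually.of_forall fun _ => hL.norm_le_one _)
      have hFi : Integrable (fun ω' => F (ω, ω') * treeFun K μ a ω'.1) π := by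
        refine Integrable.of_bound ((hFm.comp measurable_prodMk_left).mul hb).aestronglyMeasurable 1
          (Filter.Eventually.of_forall fun ω' => ?_)
        rw [norm_mul]
        exact mul_le_one₀ (hF1 _) (norm_nonneg _) (norm_treeFun_le_one hK a _)
      have hKi : Integrable (fun ω' : X × Y => K (ω.1, ω'.1) * treeFun K μ a ω'.1) π :=
        (measurePreserving_fst_of_fst_eq h1).integrable_comp_of_integrable
          (hK.integrable_mul (integrable_treeFun hK a) ω.1)
      have hLi' : Integrable (fun ω' : X × Y => L (ω.2, ω'.2) * treeFun L ν a ω'.2) π :=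
        (measurePreserving_snd_of_snd_eq h2).integrable_comp_of_integrable
          (hL.integrable_mul (integrable_treeFun hL a) ω.2)
      have e : treeFun K μ (.plant a) ω.1 - treeFun L ν (.plant a) ω.2 =
          u ω + ∫ ω', L (ω.2, ω'.2) * (treeFun K μ a ω'.1 - treeFun L ν a ω'.2) ∂π := by
        simp only [treeFun]
        rw [← (measurePreserving_fst_of_fst_eq h1).integral_comp_of_measurable
            (f := fun x => K (ω.1, x) * treeFun K μ a x)
            ((hK.measurable.comp measurable_prodMk_left).mul (measurable_treeFun hK a)),
          ← (measurePreserving_snd_of_snd_eq h2).integral_comp_of_measurable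
            (f := fun x => L (ω.2, x) * treeFun L ν a x)
            ((hL.measurable.comp measurable_prodMk_left).mul (measurable_treeFun hL a)),
          ← integral_sub hKi hLi', ← integral_add hFi hLi]
        refine integral_congr_ae (Filter.Eventually.of_forall fun ω' => ?_)
        simp only [F]
        ring
      rw [e]
      refine (abs_add_le _ _).trans (add_le_add le_rfl ?_)
      refine abs_integral_le_integral_abs.trans (integral_mono hLi.abs (hint a π h1).abs
        fun ω' => ?_)
      simp only [abs_mul]
      exact mul_le_of_le_one_left (abs_nonneg _) (hL.norm_le_one _)
    have hui : Integrable u π := hFb.integral_prod_left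
    calc ∫ ω, |treeFun K μ (.plant a) ω.1 - treeFun L ν (.plant a) ω.2| ∂π
        ≤ ∫ ω, (|u ω| + d) ∂π :=
          integral_mono (hint (.plant a) π h1).abs (hui.abs.add (integrable_const d)) hpt
      _ = ∫ ω, |u ω| ∂π + d := by
          rw [integral_add hui.abs (integrable_const d)]
          simp
      _ ≤ _ := by
          rw [add_mul]
          exact add_le_add hcut (hca π h1 h2)

theorem cutNorm_coupling_congr {π : Measure (X × Y)} (h1 : π.fst = μ) (h2 : π.snd = ν)
    {V V' : X × X → ℝ} {V₁ V₁' : Y × Y → ℝ} (h : V =ᵐ[μ.prod μ] V')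
    (h' : V₁ =ᵐ[ν.prod ν] V₁') :
    cutNorm π (fun p => V (p.1.1, p.2.1) - V₁ (p.1.2, p.2.2)) =
      cutNorm π (fun p => V' (p.1.1, p.2.1) - V₁' (p.1.2, p.2.2)) := by
  have := isProbabilityMeasure_of_fst_eq h1
  have m1 := measurePreserving_fst_of_fst_eq h1
  have m2 := measurePreserving_snd_of_snd_eq h2
  refine cutNorm_congr ?_
  filter_upwards [(m1.prod m1).quasiMeasurePreserving.ae h,
    (m2.prod m2).quasiMeasurePreserving.ae h'] with p hp hp'
  simp only [Prod.map_apply'] at hp hp'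
  rw [hp, hp']

/-- The Lipschitz constant does not depend on the coupling, so couplings with arbitrarily small cut
norm suffice; the infimum need not be attained. -/
theorem WeakIso.integral_treeFun_eq {V K : X × X → ℝ} {V' L : Y × Y → ℝ}
    (h : WeakIso μ ν V V') (hK : IsUnitKernel K) (hL : IsUnitKernel L)
    (hV : V =ᵐ[μ.prod μ] K) (hV' : V' =ᵐ[ν.prod ν] L) (τ : TreeTerm) :
    ∫ x, treeFun K μ τ x ∂μ = ∫ y, treeFun L ν τ y ∂ν := by
  obtain ⟨c, hc, hcπ⟩ := exists_integral_abs_treeFun_sub_le (μ := μ) (ν := ν) hK hL τ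
  rw [← sub_eq_zero, ← abs_nonpos_iff]
  refine le_of_forall_pos_le_add fun ε hε => ?_
  -- The denominator is c + 1 because c may be 0.
  have hlt : sInf {r | ∃ π : Measure (X × Y), π.fst = μ ∧ π.snd = ν ∧
      r = cutNorm π (fun p => V (p.1.1, p.2.1) - V' (p.1.2, p.2.2))} < ε / (c + 1) := by
    have : cutDist μ ν V V' < ε / (c + 1) := by rw [h]; positivity
    exact this
  obtain ⟨_, ⟨π, h1, h2, rfl⟩, hr⟩ := exists_lt_of_csInf_lt
    (by exact ⟨_, μ.prod ν, Measure.fst_prod, Measure.snd_prod, rfl⟩) hlt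
  rw [cutNorm_coupling_congr h1 h2 hV hV'] at hr
  have hi1 := (measurePreserving_fst_of_fst_eq h1).integrable_comp_of_integrable
    (integrable_treeFun (μ := μ) hK τ)
  have hi2 := (measurePreserving_snd_of_snd_eq h2).integrable_comp_of_integrable
    (integrable_treeFun (μ := ν) hL τ)
  calc |∫ x, treeFun K μ τ x ∂μ - ∫ y, treeFun L ν τ y ∂ν|
      = |∫ ω, (treeFun K μ τ ω.1 - treeFun L ν τ ω.2) ∂π| := by
        rw [← (measurePreserving_fst_of_fst_eq h1).integral_comp_of_measurable
            (measurable_treeFun hK τ),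
          ← (measurePreserving_snd_of_snd_eq h2).integral_comp_of_measurable
            (measurable_treeFun hL τ)]
        exact congrArg _ (integral_sub hi1 hi2).symm
    _ ≤ ∫ ω, |treeFun K μ τ ω.1 - treeFun L ν τ ω.2| ∂π := abs_integral_le_integral_abs
    _ ≤ c * cutNorm π (fun p => K (p.1.1, p.2.1) - L (p.1.2, p.2.2)) := hcπ π h1 h2
    _ ≤ (c + 1) * (ε / (c + 1)) := by
        have := cutNorm_nonneg π (fun p => K (p.1.1, p.2.1) - L (p.1.2, p.2.2))
        gcongr
        linarith
    _ = 0 + ε := by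
        field_simp
        ring

theorem IsUnitKernel.comp {Z : Type*} [MeasurableSpace Z] {k : Z × Z → ℝ} (hk : IsUnitKernel k)
    {q : X → Z} (hq : Measurable q) : IsUnitKernel fun p : X × X => k (q p.1, q p.2) :=
  ⟨hk.measurable.comp ((hq.comp measurable_fst).prodMk (hq.comp measurable_snd)),
    fun _ => hk.nonneg _, fun _ => hk.le_one _⟩

/-- The kernel on X/C is a factor both of W, by invariance, and of its own pullback, which is W_C
almost everywhere. So W and W_C have the same tree integrals. -/
theorem integral_treeFun_eq_of_weakIso [StandardBorelSpace X] [StandardBorelSpace Y]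
    (W : Graphon μ) (U : Graphon ν) {C : SubAlg μ} {D : SubAlg ν} (hC : IsInvariant W C)
    (hD : IsInvariant U D) (h : WeakIso μ ν (condKer W C) (condKer U D)) (τ : TreeTerm) :
    ∫ x, treeFun W.ker μ τ x ∂μ = ∫ y, treeFun U.ker ν τ y ∂ν := by
  obtain ⟨k, hk, -, hk1, hk2⟩ := exists_quotGraphon_factor W _ hC
  obtain ⟨l, hl, -, hl1, hl2⟩ := exists_quotGraphon_factor U _ hD
  have := h.integral_treeFun_eq (hk.comp (measurable_quotMap C))
    (hl.comp (measurable_quotMap D)) hk1 hl1 τ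
  rw [(isFactor_of_ae_eq (measurePreserving_quotMap C) hk
      (Filter.Eventually.of_forall fun _ => rfl)).integral_treeFun hk,
    (isFactor_of_ae_eq (measurePreserving_quotMap D) hl
      (Filter.Eventually.of_forall fun _ => rfl)).integral_treeFun hl] at this
  rw [hk2.integral_treeFun hk, hl2.integral_treeFun hl, this]

end CutDist

/-! ### Couplings over a common quotient -/

section Coupling

open ProbabilityTheory

variable {X Y : Type*} [MeasurableSpace X] [StandardBorelSpace X] [MeasurableSpace Y]
  [StandardBorelSpace Y] {μ : Measure X} {ν : Measure Y} [IsProbabilityMeasure μ]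
  [IsProbabilityMeasure ν]

/-- Two maps with the same law can be coupled so as to be almost surely equal. -/
theorem exists_coupling_of_map_eq {Z : Type*} [MeasurableSpace Z] [StandardBorelSpace Z]
    {q : X → Z} {q' : Y → Z} (hq : Measurable q) (hq' : Measurable q')
    (h : μ.map q = ν.map q') :
    ∃ π : Measure (X × Y), π.fst = μ ∧ π.snd = ν ∧ ∀ᵐ p ∂π, q p.1 = q' p.2 := by
  have : Nonempty X := nonempty_of_isProbabilityMeasure μ
  have : Nonempty Y := nonempty_of_isProbabilityMeasure ν
  have := Measure.isProbabilityMeasure_map (μ := μ) hq.aemeasurable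
  set κ := condDistrib id q μ
  set η := condDistrib id q' ν
  have hκ : (μ.map q) ⊗ₘ κ = μ.map fun x => (q x, x) :=
    compProd_map_condDistrib measurable_id.aemeasurable
  have hη : (μ.map q) ⊗ₘ η = ν.map fun y => (q' y, y) := by
    rw [h]; exact compProd_map_condDistrib measurable_id.aemeasurable
  -- The relatively independent coupling: z is drawn from the common law, then x and y independently
  -- from the conditional laws given q(x) = z and q'(y) = z.
  set Q := (μ.map q) ⊗ₘ (κ ×ₖ η)
  have h1 : Q.map (Prod.map id Prod.fst) = μ.map fun x => (q x, x) := by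
    rw [← hκ, ← Measure.compProd_map measurable_fst, ← Kernel.fst_eq, Kernel.fst_prod]
  have h2 : Q.map (Prod.map id Prod.snd) = ν.map fun y => (q' y, y) := by
    rw [← hη, ← Measure.compProd_map measurable_snd, ← Kernel.snd_eq, Kernel.snd_prod]
  have m1 : Measurable (Prod.map id Prod.fst : Z × (X × Y) → Z × X) :=
    measurable_id.prodMap measurable_fst
  have m2 : Measurable (Prod.map id Prod.snd : Z × (X × Y) → Z × Y) :=
    measurable_id.prodMap measurable_snd
  refine ⟨Q.map Prod.snd, ?_, ?_, ?_⟩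
  · rw [Measure.fst, Measure.map_map measurable_fst measurable_snd]
    have : (Prod.fst ∘ Prod.snd : Z × (X × Y) → X) = Prod.snd ∘ Prod.map id Prod.fst := rfl
    rw [this, ← Measure.map_map measurable_snd m1, h1,
      Measure.map_map measurable_snd (hq.prodMk measurable_id')]
    exact Measure.map_id
  · rw [Measure.snd, Measure.map_map measurable_snd measurable_snd]
    have : (Prod.snd ∘ Prod.snd : Z × (X × Y) → Y) = Prod.snd ∘ Prod.map id Prod.snd := rfl
    rw [this, ← Measure.map_map measurable_snd m2, h2,
      Measure.map_map measurable_snd (hq'.prodMk measurable_id')]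
    exact Measure.map_id
  · refine (ae_map_iff measurable_snd.aemeasurable
      (measurableSet_eq_fun (hq.comp measurable_fst) (hq'.comp measurable_snd))).2 ?_
    have a1 : ∀ᵐ p ∂Q, p.1 = q p.2.1 := by
      refine ae_of_ae_map (p := fun z : Z × X => z.1 = q z.2) m1.aemeasurable ?_
      rw [h1]
      exact (ae_map_iff (hq.prodMk measurable_id').aemeasurable (measurableSet_eq_fun
        measurable_fst (hq.comp measurable_snd))).2 (Filter.Eventually.of_forall fun _ => rfl)
    have a2 : ∀ᵐ p ∂Q, p.1 = q' p.2.2 := by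
      refine ae_of_ae_map (p := fun z : Z × Y => z.1 = q' z.2) m2.aemeasurable ?_
      rw [h2]
      exact (ae_map_iff (hq'.prodMk measurable_id').aemeasurable (measurableSet_eq_fun
        measurable_fst (hq'.comp measurable_snd))).2 (Filter.Eventually.of_forall fun _ => rfl)
    filter_upwards [a1, a2] with p h1 h2
    exact h1.symm.trans h2

/-- Under a coupling for which the two tree maps agree, both conditional kernels equal the common
kernel at the same points, and their difference vanishes almost everywhere. -/
theorem weakIso_of_integral_treeFun_eq (W : Graphon μ) (U : Graphon ν)
    (h : ∀ τ, ∫ x, treeFun W.ker μ τ x ∂μ = ∫ y, treeFun U.ker ν τ y ∂ν) :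
    WeakIso μ ν (condKer W (minAlg W)) (condKer U (minAlg U)) := by
  obtain ⟨k, hk, hkW, hkU⟩ := exists_common_kernel W U h
  obtain ⟨π, h1, h2, hπ⟩ := exists_coupling_of_map_eq (measurable_treeMap W)
    (measurable_treeMap U) (map_treeMap_eq W U h)
  have := isProbabilityMeasure_of_fst_eq h1
  have hzero : cutNorm π (fun p => condKer W (minAlg W) (p.1.1, p.2.1) -
      condKer U (minAlg U) (p.1.2, p.2.2)) = 0 := by
    rw [cutNorm_coupling_congr h1 h2 hkW hkU, ← cutNorm_zero (π := π)]
    refine cutNorm_congr ?_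
    filter_upwards [Measure.quasiMeasurePreserving_fst.ae hπ,
      Measure.quasiMeasurePreserving_snd.ae hπ] with p hp hp'
    rw [hp, hp', sub_self]
  have hnn : ∀ r ∈ {r | ∃ π : Measure (X × Y), π.fst = μ ∧ π.snd = ν ∧
      r = cutNorm π (fun p => condKer W (minAlg W) (p.1.1, p.2.1) -
        condKer U (minAlg U) (p.1.2, p.2.2))}, 0 ≤ r := by
    rintro _ ⟨π, -, -, rfl⟩
    exact cutNorm_nonneg _ _
  exact le_antisymm (csInf_le ⟨0, hnn⟩ ⟨π, h1, h2, hzero.symm⟩) (Real.sInf_nonneg hnn)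

end Coupling

end FracIso

namespace FracIso

/-! ### Markov operators -/

section Markov

open scoped InnerProductSpace

variable {X Y : Type*} [MeasurableSpace X] [MeasurableSpace Y] {μ : Measure X} {ν : Measure Y}
  [IsProbabilityMeasure μ] [IsProbabilityMeasure ν]

theorem inner_L2_eq (f g : Lp ℝ 2 μ) : ⟪f, g⟫_ℝ = ∫ x, f x * g x ∂μ := by
  rw [L2.inner_def]
  refine integral_congr_ae (Filter.Eventually.of_forall fun x => ?_)
  simp [mul_comm]

theorem inner_const_one (f : Lp ℝ 2 μ) : ⟪f, Lp.const 2 μ (1 : ℝ)⟫_ℝ = ∫ x, f x ∂μ := by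
  rw [inner_L2_eq]
  refine integral_congr_ae ?_
  filter_upwards [Lp.coeFn_const (p := 2) (μ := μ) (1 : ℝ)] with x hx
  rw [hx]
  simp

theorem Lp_nonneg_of_inner_nonneg {f : Lp ℝ 2 μ} (h : ∀ g : Lp ℝ 2 μ, 0 ≤ g → 0 ≤ ⟪g, f⟫_ℝ) :
    0 ≤ f := by
  rw [← Lp.coeFn_nonneg]
  refine ae_nonneg_of_forall_setIntegral_nonneg (integrable_of_L2 f) fun s hs hμs => ?_
  rw [← L2.inner_indicatorConstLp_one (𝕜 := ℝ) hs hμs.ne]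
  refine h _ ?_
  rw [← Lp.coeFn_nonneg]
  filter_upwards [indicatorConstLp_coeFn (p := 2) (hs := hs) (hμs := hμs.ne) (c := (1 : ℝ))]
    with x hx
  rw [hx]
  exact Set.indicator_nonneg (fun _ _ => zero_le_one) x

theorem inner_nonneg_of_nonneg {f g : Lp ℝ 2 μ} (hf : 0 ≤ f) (hg : 0 ≤ g) : 0 ≤ ⟪f, g⟫_ℝ := by
  rw [inner_L2_eq]
  refine integral_nonneg_of_ae ?_
  filter_upwards [(Lp.coeFn_nonneg f).2 hf, (Lp.coeFn_nonneg g).2 hg] with x h1 h2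
    using mul_nonneg h1 h2

theorem adjoint_nonneg {S : Lp ℝ 2 ν →L[ℝ] Lp ℝ 2 μ} (hS : ∀ f, 0 ≤ f → 0 ≤ S f)
    {g : Lp ℝ 2 μ} (hg : 0 ≤ g) : 0 ≤ S.adjoint g := by
  refine Lp_nonneg_of_inner_nonneg fun f hf => ?_
  rw [ContinuousLinearMap.adjoint_inner_right]
  exact inner_nonneg_of_nonneg (hS f hf) hg

theorem IsMarkov.adjoint {S : Lp ℝ 2 ν →L[ℝ] Lp ℝ 2 μ} (hS : IsMarkov S) :
    IsMarkov S.adjoint where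
  nonneg _ hg := adjoint_nonneg hS.nonneg hg
  map_one := hS.adjoint_map_one
  adjoint_map_one := by rw [ContinuousLinearMap.adjoint_adjoint]; exact hS.map_one

theorem adjoint_graphonOp (W : Graphon μ) : (graphonOp W).adjoint = graphonOp W := by
  refine (ContinuousLinearMap.eq_adjoint_iff _ _).2 (fun f g => ?_) |>.symm
  have hint : ∀ f g : Lp ℝ 2 μ, Integrable (fun p : X × X => W.ker p * (f p.1 * g p.2))
      (μ.prod μ) := fun f g =>
    ((integrable_of_L2 f).mul_prod (integrable_of_L2 g)).bdd_mul (c := 1)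
      W.measurable_ker.aestronglyMeasurable
      (Filter.Eventually.of_forall W.isUnitKernel.norm_le_one)
  have key : ∀ f g : Lp ℝ 2 μ,
      ⟪f, graphonOp W g⟫_ℝ = ∫ p, W.ker p * (f p.1 * g p.2) ∂(μ.prod μ) := fun f g => by
    rw [inner_L2_eq, integral_prod _ (hint f g)]
    refine integral_congr_ae ?_
    filter_upwards [coeFn_graphonOp W g] with x hx
    rw [hx, ← integral_const_mul]
    refine integral_congr_ae (Filter.Eventually.of_forall fun y => ?_)
    simp only
    ring
  rw [real_inner_comm, key, key, ← integral_prod_swap]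
  refine integral_congr_ae ?_
  filter_upwards [W.symm] with p hp
  rw [hp]
  simp only [Prod.fst_swap, Prod.snd_swap]
  ring

/-- Bounded functions `f`, `g` that correspond to each other under the operator `S`. -/
structure IsMappedTo (S : Lp ℝ 2 ν →L[ℝ] Lp ℝ 2 μ) (f : Y → ℝ) (g : X → ℝ) : Prop where
  left : MemLp f ∞ ν
  right : MemLp g ∞ μ
  map_eq : S ((left.mono_exponent le_top).toLp f) = (right.mono_exponent le_top).toLp g

variable {S : Lp ℝ 2 ν →L[ℝ] Lp ℝ 2 μ} {f f' : Y → ℝ} {g g' : X → ℝ}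

theorem IsMappedTo.add (h : IsMappedTo S f g) (h' : IsMappedTo S f' g') :
    IsMappedTo S (f + f') (g + g') where
  left := h.left.add h'.left
  right := h.right.add h'.right
  map_eq := by
    rw [MemLp.toLp_add (h.left.mono_exponent le_top) (h'.left.mono_exponent le_top), map_add,
      h.map_eq, h'.map_eq]
    rfl

theorem IsMappedTo.smul (c : ℝ) (h : IsMappedTo S f g) : IsMappedTo S (c • f) (c • g) where
  left := h.left.const_smul c
  right := h.right.const_smul c
  map_eq := by
    rw [MemLp.toLp_const_smul c (h.left.mono_exponent le_top), map_smul, h.map_eq]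
    rfl

theorem toLp_fun_const (c : ℝ) :
    (memLp_const c : MemLp (fun _ : X => c) 2 μ).toLp _ = c • Lp.const 2 μ (1 : ℝ) := by
  refine Lp.ext ((memLp_const c).coeFn_toLp.trans ?_)
  filter_upwards [Lp.coeFn_smul c (Lp.const 2 μ (1 : ℝ)), Lp.coeFn_const (p := 2) (μ := μ) (1 : ℝ)]
    with x h1 h2
  rw [h1, Pi.smul_apply, h2]
  simp

theorem IsMarkov.isMappedTo_const (hS : IsMarkov S) (c : ℝ) :
    IsMappedTo S (fun _ => c) fun _ => c where
  left := memLp_const c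
  right := memLp_const c
  map_eq := by rw [toLp_fun_const, toLp_fun_const, map_smul, hS.map_one]

theorem IsMappedTo.ae_eq_map (h : IsMappedTo S f g) :
    S ((h.left.mono_exponent le_top).toLp f) =ᵐ[μ] g := by
  rw [h.map_eq]
  exact MemLp.coeFn_toLp _

theorem IsMarkov.integral_map (hS : IsMarkov S) (f : Lp ℝ 2 ν) : ∫ x, S f x ∂μ = ∫ y, f y ∂ν := by
  rw [← inner_const_one, ← inner_const_one, ← hS.adjoint_map_one,
    ContinuousLinearMap.adjoint_inner_right]

/-- Jensen's inequality for the square. -/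
theorem IsMarkov.sq_le_map_sq (hS : IsMarkov S) (h : IsMappedTo S f g)
    (hf2 : MemLp (f * f) 2 ν) : ∀ᵐ x ∂μ, g x * g x ≤ S (hf2.toLp (f * f)) x := by
  have hf := h.left.mono_exponent (p := 2) le_top
  -- Positivity of S applied to (f - q)². Rational q keep the exceptional sets countable in number;
  -- closedness then allows every real t, in particular t = g(x).
  have hq : ∀ q : ℚ, ∀ᵐ x ∂μ, 0 ≤ S (hf2.toLp (f * f)) x - 2 * q * g x + q * q := by
    intro q
    set F : Lp ℝ 2 ν := hf2.toLp (f * f) - (2 * q : ℝ) • hf.toLp f +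
      (q * q : ℝ) • Lp.const 2 ν (1 : ℝ)
    have hF : 0 ≤ F := by
      rw [← Lp.coeFn_nonneg]
      filter_upwards [Lp.coeFn_add (hf2.toLp (f * f) - (2 * q : ℝ) • hf.toLp f)
          ((q * q : ℝ) • Lp.const 2 ν (1 : ℝ)),
        Lp.coeFn_sub (hf2.toLp (f * f)) ((2 * q : ℝ) • hf.toLp f),
        Lp.coeFn_smul (2 * q : ℝ) (hf.toLp f),
        Lp.coeFn_smul (q * q : ℝ) (Lp.const 2 ν (1 : ℝ)),
        Lp.coeFn_const (p := 2) (μ := ν) (1 : ℝ), hf2.coeFn_toLp, hf.coeFn_toLp]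
        with y h1 h2 h3 h4 h5 h6 h7
      simp only [F, h1, Pi.add_apply, h2, Pi.sub_apply, h3, h4, Pi.smul_apply, h5, h6, h7,
        Pi.mul_apply, smul_eq_mul, Function.const_apply, Pi.zero_apply]
      nlinarith [sq_nonneg (f y - q)]
    have hSF := (Lp.coeFn_nonneg _).2 (hS.nonneg F hF)
    have e : S F = S (hf2.toLp (f * f)) - (2 * q : ℝ) • S (hf.toLp f) +
        (q * q : ℝ) • Lp.const 2 μ (1 : ℝ) := by
      simp only [F, map_add, map_sub, map_smul, hS.map_one]
    rw [e] at hSF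
    filter_upwards [hSF, Lp.coeFn_add (S (hf2.toLp (f * f)) - (2 * q : ℝ) • S (hf.toLp f))
          ((q * q : ℝ) • Lp.const 2 μ (1 : ℝ)),
        Lp.coeFn_sub (S (hf2.toLp (f * f))) ((2 * q : ℝ) • S (hf.toLp f)),
        Lp.coeFn_smul (2 * q : ℝ) (S (hf.toLp f)),
        Lp.coeFn_smul (q * q : ℝ) (Lp.const 2 μ (1 : ℝ)),
        Lp.coeFn_const (p := 2) (μ := μ) (1 : ℝ), h.ae_eq_map]
        with x h0 h1 h2 h3 h4 h5 h6
    simp only [h1, Pi.add_apply, h2, Pi.sub_apply, h3, h4, Pi.smul_apply, h5, h6,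
        smul_eq_mul, Function.const_apply, Pi.zero_apply, mul_one] at h0
    exact h0
  filter_upwards [ae_all_iff.2 hq] with x hx
  have hall : ∀ t : ℝ, 0 ≤ S (hf2.toLp (f * f)) x - 2 * t * g x + t * t := fun t =>
    Rat.denseRange_cast.induction_on (p := fun t : ℝ =>
      0 ≤ S (hf2.toLp (f * f)) x - 2 * t * g x + t * t) t
      (isClosed_le continuous_const (by fun_prop)) hx
  have := hall (g x)
  linarith

theorem integral_mul_self_eq (hf : MemLp f 2 ν) :
    ∫ y, (f * f) y ∂ν = ⟪hf.toLp f, hf.toLp f⟫_ℝ := by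
  rw [inner_L2_eq]
  refine integral_congr_ae ?_
  filter_upwards [hf.coeFn_toLp] with z hz
  rw [hz, Pi.mul_apply]

theorem toLp_treeFun_plant (W : Graphon μ) (a : TreeTerm) :
    (memLp_treeFun W.isUnitKernel (.plant a) 2).toLp (treeFun W.ker μ (.plant a)) =
      graphonOp W ((memLp_treeFun W.isUnitKernel a 2).toLp (treeFun W.ker μ a)) :=
  Lp.ext ((MemLp.coeFn_toLp _).trans (coeFn_graphonOp_toLp W _).symm)

/-- A Markov operator is multiplicative on pairs of functions that it and its adjoint exchange. -/
theorem IsMarkov.isMappedTo_sq (hS : IsMarkov S) (h : IsMappedTo S f g)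
    (h' : IsMappedTo S.adjoint g f) : IsMappedTo S (f * f) (g * g) := by
  have hl : MemLp (f * f) ∞ ν := h.left.mul h.left
  have hr : MemLp (g * g) ∞ μ := h.right.mul h.right
  have hf2 := hl.mono_exponent (p := 2) le_top
  have hg2 := hr.mono_exponent (p := 2) le_top
  refine ⟨hl, hr, ?_⟩
  have hle := hS.sq_le_map_sq h hf2
  have hgi : Integrable (g * g) μ := hg2.integrable (by norm_num)
  have hSi := integrable_of_L2 (S (hf2.toLp (f * f)))
  -- The two sides of Jensen's inequality have equal integrals: ∫ S(f²) = ∫ f² = ⟨S*g, S*g⟩ = ⟨g, S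
  -- S*g⟩ = ⟨g, Sf⟩ = ∫ g². Equality thus holds almost everywhere.
  have hint : ∫ x, (S (hf2.toLp (f * f)) x - (g * g) x) ∂μ = 0 := by
    have hfL := h.left.mono_exponent (p := 2) le_top
    have hgL := h.right.mono_exponent (p := 2) le_top
    rw [integral_sub hSi hgi, hS.integral_map, integral_congr_ae hf2.coeFn_toLp,
      integral_mul_self_eq hfL, integral_mul_self_eq hgL, sub_eq_zero]
    conv_lhs => rw [← h'.map_eq]
    rw [ContinuousLinearMap.adjoint_inner_left, h'.map_eq, h.map_eq]
  have hzero := (integral_eq_zero_iff_of_nonneg_ae (f := fun x =>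
    S (hf2.toLp (f * f)) x - (g * g) x) (by
      filter_upwards [hle] with x hx
      exact sub_nonneg.2 hx) (hSi.sub hgi)).1 hint
  refine Lp.ext (Filter.EventuallyEq.trans ?_ hg2.coeFn_toLp.symm)
  filter_upwards [hzero] with x hx
  exact sub_eq_zero.1 hx

theorem IsMarkov.isMappedTo_mul (hS : IsMarkov S) (h₁ : IsMappedTo S f g)
    (h₁' : IsMappedTo S.adjoint g f) (h₂ : IsMappedTo S f' g') (h₂' : IsMappedTo S.adjoint g' f') :
    IsMappedTo S (f * f') (g * g') := by
  -- Polarization: f f' is half of (f + f')² - f² - f'².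
  have h := ((hS.isMappedTo_sq (h₁.add h₂) (h₁'.add h₂')).add
    ((hS.isMappedTo_sq h₁ h₁').smul (-1))).add ((hS.isMappedTo_sq h₂ h₂').smul (-1))
  have h2 := h.smul (1 / 2)
  convert h2 using 1 <;>
  · ext x
    simp only [Pi.mul_apply, Pi.add_apply, Pi.smul_apply, smul_eq_mul]
    ring

/-- Both directions are carried through the induction because multiplicativity on products needs S
and its adjoint. The adjoint of the commutation relation handles `plant` for S*. -/
theorem IsMarkov.isMappedTo_treeFun (hS : IsMarkov S) {W : Graphon μ} {U : Graphon ν}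
    (h : graphonOp W ∘L S = S ∘L graphonOp U) (τ : TreeTerm) :
    IsMappedTo S (treeFun U.ker ν τ) (treeFun W.ker μ τ) ∧
      IsMappedTo S.adjoint (treeFun W.ker μ τ) (treeFun U.ker ν τ) := by
  have h' : graphonOp U ∘L S.adjoint = S.adjoint ∘L graphonOp W := by
    have := congrArg ContinuousLinearMap.adjoint h
    rw [ContinuousLinearMap.adjoint_comp, ContinuousLinearMap.adjoint_comp, adjoint_graphonOp,
      adjoint_graphonOp] at this
    exact this.symm
  induction τ with
  | point => exact ⟨hS.isMappedTo_const 1, hS.adjoint.isMappedTo_const 1⟩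
  | glue a b iha ihb =>
    refine ⟨hS.isMappedTo_mul iha.1 iha.2 ihb.1 ihb.2,
      hS.adjoint.isMappedTo_mul iha.2 ?_ ihb.2 ?_⟩
    · rw [ContinuousLinearMap.adjoint_adjoint]; exact iha.1
    · rw [ContinuousLinearMap.adjoint_adjoint]; exact ihb.1
  | plant a ih =>
    have hW := toLp_treeFun_plant W a
    have hU := toLp_treeFun_plant U a
    refine ⟨⟨memLp_treeFun U.isUnitKernel _ _, memLp_treeFun W.isUnitKernel _ _, ?_⟩,
      ⟨memLp_treeFun W.isUnitKernel _ _, memLp_treeFun U.isUnitKernel _ _, ?_⟩⟩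
    · rw [hU, hW, ← ih.1.map_eq]
      exact (DFunLike.congr_fun h _).symm
    · rw [hU, hW, ← ih.2.map_eq]
      exact (DFunLike.congr_fun h' _).symm

theorem IsMarkov.integral_treeFun_eq (hS : IsMarkov S) {W : Graphon μ} {U : Graphon ν}
    (h : graphonOp W ∘L S = S ∘L graphonOp U) (τ : TreeTerm) :
    ∫ x, treeFun W.ker μ τ x ∂μ = ∫ y, treeFun U.ker ν τ y ∂ν := by
  have hτ := (hS.isMappedTo_treeFun h τ).1
  rw [← integral_congr_ae hτ.ae_eq_map, hS.integral_map]
  exact integral_congr_ae (MemLp.coeFn_toLp _)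

/-! ### The Markov operator of a common quotient -/

theorem compLp_nonneg {Z : Type*} [MeasurableSpace Z] {ρ : Measure Z} {q : X → Z}
    (hq : MeasurePreserving q μ ρ) {f : Lp ℝ 2 ρ} (hf : 0 ≤ f) : 0 ≤ compLp hq f := by
  rw [← Lp.coeFn_nonneg] at hf ⊢
  filter_upwards [coeFn_compLp hq f, hq.quasiMeasurePreserving.ae hf] with x h1 h2
  rw [h1]
  exact h2

theorem compLp_const {Z : Type*} [MeasurableSpace Z] {ρ : Measure Z} [IsProbabilityMeasure ρ]
    {q : X → Z} (hq : MeasurePreserving q μ ρ) (c : ℝ) :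
    compLp hq (Lp.const 2 ρ c) = Lp.const 2 μ c := by
  refine Lp.ext ?_
  filter_upwards [coeFn_compLp hq (Lp.const 2 ρ c), Lp.coeFn_const (p := 2) (μ := μ) c,
    hq.quasiMeasurePreserving.ae (Lp.coeFn_const (p := 2) (μ := ρ) c)] with x h1 h2 h3
  rw [h1, h2, Function.comp_apply, h3]
  rfl

theorem adjoint_compLp_comp {Z : Type*} [MeasurableSpace Z] {ρ : Measure Z} {q : X → Z}
    (hq : MeasurePreserving q μ ρ) (f : Lp ℝ 2 ρ) : (compLp hq).adjoint (compLp hq f) = f :=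
  DFunLike.congr_fun ((ContinuousLinearMap.norm_map_iff_adjoint_comp_self (compLp hq)).1
    fun x => LinearIsometry.norm_map _ x) f

/-- Composition operators and their adjoints are positive, and since they are isometries fixing 1,
their adjoints fix 1 as well. -/
theorem isMarkov_compLp_comp_adjoint {Z : Type*} [MeasurableSpace Z] {ρ : Measure Z}
    [IsProbabilityMeasure ρ] {q : X → Z} {q' : Y → Z} (hq : MeasurePreserving q μ ρ)
    (hq' : MeasurePreserving q' ν ρ) : IsMarkov (compLp hq ∘L (compLp hq').adjoint) where
  nonneg _ hf := compLp_nonneg hq (adjoint_nonneg (fun _ h => compLp_nonneg hq' h) hf)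
  map_one := by
    rw [ContinuousLinearMap.comp_apply, ← compLp_const hq', adjoint_compLp_comp, compLp_const]
  adjoint_map_one := by
    rw [ContinuousLinearMap.adjoint_comp, ContinuousLinearMap.adjoint_adjoint,
      ContinuousLinearMap.comp_apply, ← compLp_const hq, adjoint_compLp_comp, compLp_const]

theorem IsFactor.graphonOp_compLp {Z : Type*} [MeasurableSpace Z] {ρ : Measure Z}
    [IsProbabilityMeasure ρ] {q : X → Z} {W : Graphon μ} {k : Z × Z → ℝ}
    (h : IsFactor W.ker μ k ρ q) {f g : Lp ℝ 2 ρ}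
    (hg : g =ᵐ[ρ] fun z => ∫ z', k (z, z') * f z' ∂ρ) :
    graphonOp W (compLp h.measurePreserving f) = compLp h.measurePreserving g := by
  refine Lp.ext ?_
  filter_upwards [coeFn_graphonOp W (compLp h.measurePreserving f),
    coeFn_compLp h.measurePreserving g, h.measurePreserving.quasiMeasurePreserving.ae hg,
    h.integral_eq f (Lp.stronglyMeasurable f).measurable (Lp.memLp f)] with x h1 h2 h3 h4
  rw [h1, h2, Function.comp_apply, h3, ← h4]
  refine integral_congr_ae ?_
  filter_upwards [coeFn_compLp h.measurePreserving f] with y hy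
  rw [hy, Function.comp_apply]

theorem exists_integral_op {Z : Type*} [MeasurableSpace Z] {ρ : Measure Z}
    [IsProbabilityMeasure ρ] {k : Z × Z → ℝ} (hk : IsUnitKernel k) (f : Lp ℝ 2 ρ) :
    ∃ g : Lp ℝ 2 ρ, g =ᵐ[ρ] fun z => ∫ z', k (z, z') * f z' ∂ρ := by
  have hL : MemLp (fun z => ∫ z', k (z, z') * f z' ∂ρ) 2 ρ := by
    refine MemLp.of_bound (hk.measurable_integral
      (Lp.stronglyMeasurable f).measurable).aestronglyMeasurable (∫ z', ‖f z'‖ ∂ρ)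
      (Filter.Eventually.of_forall fun z => ?_)
    refine norm_integral_le_of_norm_le (integrable_of_L2 f).norm
      (Filter.Eventually.of_forall fun z' => ?_)
    rw [norm_mul]
    exact mul_le_of_le_one_left (norm_nonneg _) (hk.norm_le_one _)
  exact ⟨hL.toLp _, hL.coeFn_toLp⟩

theorem exists_isMarkov_of_integral_treeFun_eq (W : Graphon μ) (U : Graphon ν)
    (h : ∀ τ, ∫ x, treeFun W.ker μ τ x ∂μ = ∫ y, treeFun U.ker ν τ y ∂ν) :
    ∃ S : Lp ℝ 2 ν →L[ℝ] Lp ℝ 2 μ, IsMarkov S ∧ graphonOp W ∘L S = S ∘L graphonOp U := by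
  obtain ⟨k, hk, hkW, hkU⟩ := exists_common_kernel W U h
  have hW := (generates_treeMap W).isFactor (minAlg_isLeast W).1 hk hkW
  have hU := (generates_treeMap U).isFactor (minAlg_isLeast U).1 hk hkU
  rw [← map_treeMap_eq W U h] at hU
  have := Measure.isProbabilityMeasure_map (μ := μ) (measurable_treeMap W).aemeasurable
  set J := compLp hW.measurePreserving
  set I := compLp hU.measurePreserving
  refine ⟨J ∘L I.adjoint, isMarkov_compLp_comp_adjoint _ _, ?_⟩
  -- A is the integral operator of k. Written in this form it is visibly self-adjoint, without any
  -- symmetry of k. Taking adjoints in T_U I = I A gives I* T_U = A I*, and then T_W J I* = J A I* =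
  -- J I* T_U.
  set A := I.adjoint ∘L graphonOp U ∘L I
  have hA : A.adjoint = A := by
    simp only [A, ContinuousLinearMap.adjoint_comp, ContinuousLinearMap.adjoint_adjoint,
      adjoint_graphonOp, ContinuousLinearMap.comp_assoc]
  have key : ∀ f, graphonOp W (J f) = J (A f) ∧ graphonOp U (I f) = I (A f) := by
    intro f
    obtain ⟨g, hg⟩ := exists_integral_op hk f
    have h1 := hW.graphonOp_compLp hg
    have h2 := hU.graphonOp_compLp hg
    have h3 : A f = g := by
      change I.adjoint (graphonOp U (I f)) = g
      rw [h2]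
      exact adjoint_compLp_comp _ _
    rw [h3]
    exact ⟨h1, h2⟩
  have hIA : I.adjoint ∘L graphonOp U = A ∘L I.adjoint := by
    have h1 : graphonOp U ∘L I = I ∘L A := ContinuousLinearMap.ext fun f => (key f).2
    have h2 := congrArg ContinuousLinearMap.adjoint h1
    rwa [ContinuousLinearMap.adjoint_comp, ContinuousLinearMap.adjoint_comp, adjoint_graphonOp,
      hA] at h2
  rw [ContinuousLinearMap.comp_assoc, hIA]
  exact ContinuousLinearMap.ext fun f => (key (I.adjoint f)).1

end Markov

end FracIso

namespace FracIso

/-! ### Countable generation of the spaces of iterated degree measures -/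

/-- Measures of mass at most 1 are compared on such a system; the whole space is included so that
total masses are compared too. -/
theorem exists_countable_isPiSystem (Z : Type*) [mZ : MeasurableSpace Z]
    [MeasurableSpace.CountablyGenerated Z] :
    ∃ S : Set (Set Z), S.Countable ∧ mZ = MeasurableSpace.generateFrom S ∧ IsPiSystem S ∧
      Set.univ ∈ S := by
  refine ⟨generateSetAlgebra (MeasurableSpace.countableGeneratingSet Z),
    countable_generateSetAlgebra (MeasurableSpace.countable_countableGeneratingSet), ?_, ?_, ?_⟩
  · rw [generateFrom_generateSetAlgebra_eq, MeasurableSpace.generateFrom_countableGeneratingSet]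
  · exact fun s hs t ht _ => isSetAlgebra_generateSetAlgebra.inter_mem hs ht
  · exact isSetAlgebra_generateSetAlgebra.univ_mem

theorem SubProb.isFiniteMeasure {Z : Type} [MeasurableSpace Z] (m : SubProb Z) :
    IsFiniteMeasure m.1 := ⟨m.2.trans_lt ENNReal.one_lt_top⟩

theorem SubProb.ext_of_generateFrom {Z : Type} [mZ : MeasurableSpace Z] {S : Set (Set Z)}
    (hS : mZ = MeasurableSpace.generateFrom S) (hpi : IsPiSystem S) (huniv : Set.univ ∈ S)
    {m m' : SubProb Z} (h : ∀ A ∈ S, m.1 A = m'.1 A) : m = m' := by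
  have := m.isFiniteMeasure
  exact Subtype.ext (ext_of_generate_finite S hS hpi h (h _ huniv))

/-- Evaluations on a countable π-system already generate the σ-algebra of `SubProb Z`, so countable
generation passes from each stage of the iteration to the next. -/
instance {Z : Type} [MeasurableSpace Z] [MeasurableSpace.CountablyGenerated Z] :
    MeasurableSpace.CountablyGenerated (SubProb Z) := by
  obtain ⟨S, hSc, hS, hpi, huniv⟩ := exists_countable_isPiSystem Z
  have := hSc.to_subtype
  let e : SubProb Z → S → ℝ≥0∞ := fun m A => m.1 A
  have he : (Subtype.instMeasurableSpace : MeasurableSpace (SubProb Z)) =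
      MeasurableSpace.comap e inferInstance := by
    refine le_antisymm ?_ ?_
    · have hA : ∀ A ∈ S, Measurable[MeasurableSpace.comap e inferInstance]
          fun m : SubProb Z => m.1 A := fun A hA =>
        (measurable_pi_apply (⟨A, hA⟩ : S)).comp (comap_measurable e)
      have hval : @Measurable _ _ (MeasurableSpace.comap e inferInstance) _
          (Subtype.val : SubProb Z → Measure Z) := by
        have : ∀ m : SubProb Z, IsFiniteMeasure m.1 := SubProb.isFiniteMeasure
        exact @Measurable.measure_of_isPiSystem _ _ (MeasurableSpace.comap e inferInstance) _
          (fun m : SubProb Z => m.1) _ S hS hpi hA (hA _ huniv)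
      exact hval.comap_le
    · refine Measurable.comap_le (measurable_pi_lambda _ fun A => ?_)
      have hA : MeasurableSet A.1 := by
        rw [hS]
        exact MeasurableSpace.measurableSet_generateFrom A.2
      exact (Measure.measurable_coe hA).comp measurable_subtype_coe
  rw [he]
  exact MeasurableSpace.CountablyGenerated.comap e

theorem countablyGenerated_idmUpTo : ∀ n, MeasurableSpace.CountablyGenerated (IDMUpTo n)
  | 0 => inferInstanceAs (MeasurableSpace.CountablyGenerated Unit)
  | n + 1 => by
    have := countablyGenerated_idmUpTo n
    exact inferInstanceAs (MeasurableSpace.CountablyGenerated (IDMUpTo n × SubProb (IDMUpTo n)))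

/-! ### Iterated degree measures determine tree densities -/

/-- The projection from `𝕄` to `M_n`. -/
def idmProj : (n : ℕ) → IDM → IDMUpTo n
  | 0, _ => ()
  | n + 1, z => ((idmProj n z, z (n + 1)) : IDMUpTo n × SubProb (IDMUpTo n))

theorem measurable_idmProj : ∀ n, Measurable (idmProj n)
  | 0 => measurable_const
  | n + 1 =>
    have h : Measurable fun z : IDM => ((idmProj n z, z (n + 1)) :
        IDMUpTo n × SubProb (IDMUpTo n)) :=
      (measurable_idmProj n).prodMk (measurable_pi_apply (X := DegSpace) (n + 1))
    h

section

variable {X Y : Type*} [MeasurableSpace X] [MeasurableSpace Y] {μ : Measure X} {ν : Measure Y}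
  [IsProbabilityMeasure μ] [IsProbabilityMeasure ν]

theorem idmProj_iterDeg (W : Graphon μ) (x : X) : ∀ n, idmProj n (iterDeg W x) = iterDegUpTo W n x
  | 0 => rfl
  | n + 1 => by
    change ((idmProj n (iterDeg W x), degMeasure W (iterDegUpTo W n) x) :
      IDMUpTo n × SubProb (IDMUpTo n)) = (iterDegUpTo W n x, degMeasure W (iterDegUpTo W n) x)
    rw [idmProj_iterDeg W x n]

theorem integral_degMeasure {Z : Type} [MeasurableSpace Z] (W : Graphon μ) {i : X → Z}
    (hi : Measurable i) {f : Z → ℝ} (hf : Measurable f) (x : X) :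
    ∫ z, f z ∂(degMeasure W i x).1 = ∫ y, W.ker (x, y) * f (i y) ∂μ := by
  rw [degMeasure, integral_map hi.aemeasurable hf.aestronglyMeasurable,
    integral_withDensity_ofReal (g := fun y => W.ker (x, y))
      (W.measurable_ker.comp measurable_prodMk_left)]
  simp only [max_eq_left (W.nonneg _)]

/-- The inclusion of `SubProb Z` into the measures on Z is itself a finite kernel. -/
theorem measurable_integral_subProb {Z : Type} [MeasurableSpace Z] {f : Z → ℝ}
    (hf : Measurable f) : Measurable fun m : SubProb Z => ∫ z, f z ∂m.1 := by
  let κ : ProbabilityTheory.Kernel (SubProb Z) Z := ⟨Subtype.val, measurable_subtype_coe⟩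
  have : ProbabilityTheory.IsFiniteKernel κ := ⟨⟨1, ENNReal.one_lt_top, fun m => m.2⟩⟩
  exact (hf.stronglyMeasurable.integral_kernel (κ := κ)).measurable

/-- Rooted tree functions are functions of the iterated degree measure. -/
theorem exists_treeFun_eq_comp_iterDegUpTo (W : Graphon μ) (U : Graphon ν) (τ : TreeTerm) :
    ∃ n, ∀ m, n ≤ m → ∃ f : IDMUpTo m → ℝ, Measurable f ∧
      (∀ x, treeFun W.ker μ τ x = f (iterDegUpTo W m x)) ∧
      ∀ y, treeFun U.ker ν τ y = f (iterDegUpTo U m y) := by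
  induction τ with
  | point => exact ⟨0, fun m _ => ⟨fun _ => 1, measurable_const, fun _ => rfl, fun _ => rfl⟩⟩
  | glue a b iha ihb =>
    obtain ⟨n, hn⟩ := iha
    obtain ⟨n', hn'⟩ := ihb
    -- Two trees are glued at a common level; this is why the claim is made for all levels from some
    -- n on.
    refine ⟨max n n', fun m hm => ?_⟩
    obtain ⟨f, hf, h1, h2⟩ := hn m ((le_max_left _ _).trans hm)
    obtain ⟨f', hf', h1', h2'⟩ := hn' m ((le_max_right _ _).trans hm)
    exact ⟨f * f', hf.mul hf', fun x => by rw [treeFun, h1, h1']; rfl,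
      fun y => by rw [treeFun, h2, h2']; rfl⟩
  | plant a ih =>
    obtain ⟨n, hn⟩ := ih
    refine ⟨n + 1, fun m hm => ?_⟩
    obtain ⟨m, rfl⟩ : ∃ m', m = m' + 1 := ⟨m - 1, by omega⟩
    obtain ⟨f, hf, h1, h2⟩ := hn m (by omega)
    -- Planting costs one level: it integrates f against the last degree measure. This does not
    -- involve the graphon, so one function serves both W and U.
    let g : IDMUpTo m × SubProb (IDMUpTo m) → ℝ := fun p => ∫ z, f z ∂p.2.1
    have hg : Measurable g := (measurable_integral_subProb hf).comp measurable_snd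
    refine ⟨g, hg, fun x => ?_, fun y => ?_⟩
    · change _ = ∫ z, f z ∂(degMeasure W (iterDegUpTo W m) x).1
      rw [integral_degMeasure W (measurable_iterDegUpTo W m) hf, treeFun]
      simp only [h1]
    · change _ = ∫ z, f z ∂(degMeasure U (iterDegUpTo U m) y).1
      rw [integral_degMeasure U (measurable_iterDegUpTo U m) hf, treeFun]
      simp only [h2]

theorem integral_treeFun_eq_of_didm_eq (W : Graphon μ) (U : Graphon ν) (h : didm W = didm U)
    (τ : TreeTerm) : ∫ x, treeFun W.ker μ τ x ∂μ = ∫ y, treeFun U.ker ν τ y ∂ν := by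
  obtain ⟨n, hn⟩ := exists_treeFun_eq_comp_iterDegUpTo W U τ
  obtain ⟨f, hf, h1, h2⟩ := hn n le_rfl
  have hm : Measurable fun z => f (idmProj n z) := hf.comp (measurable_idmProj n)
  simp only [h1, h2, ← idmProj_iterDeg]
  rw [← integral_map (f := fun z => f (idmProj n z)) (measurable_iterDeg W).aemeasurable
      hm.aestronglyMeasurable,
    ← integral_map (f := fun z => f (idmProj n z)) (measurable_iterDeg U).aemeasurable
      hm.aestronglyMeasurable]
  exact congrArg (fun m => ∫ z, f (idmProj n z) ∂m) h

end

/-! ### Iterated degree measures of a common quotient -/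

section

variable {Q : Type*} [MeasurableSpace Q] {ρ : Measure Q} [IsProbabilityMeasure ρ]
  {k : Q × Q → ℝ}

/-- The measures `A ↦ ∫_{G⁻¹(A)} k(z, z') dρ(z')`, for a kernel that need not be symmetric. -/
noncomputable def kerMeasure {Z : Type} [MeasurableSpace Z] (hk : IsUnitKernel k) (ρ : Measure Q)
    [IsProbabilityMeasure ρ] {G : Q → Z} (hG : Measurable G) (z : Q) : SubProb Z :=
  ⟨(ρ.withDensity fun z' => ENNReal.ofReal (k (z, z'))).map G, by
    rw [Measure.map_apply hG MeasurableSet.univ, Set.preimage_univ,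
      withDensity_apply _ MeasurableSet.univ, Measure.restrict_univ]
    calc ∫⁻ z', ENNReal.ofReal (k (z, z')) ∂ρ ≤ ∫⁻ _, 1 ∂ρ :=
          lintegral_mono fun z' => by simpa using hk.le_one (z, z')
      _ = 1 := by simp⟩

theorem kerMeasure_apply {Z : Type} [MeasurableSpace Z] (hk : IsUnitKernel k) {G : Q → Z}
    (hG : Measurable G) (z : Q) {A : Set Z} (hA : MeasurableSet A) :
    (kerMeasure hk ρ hG z).1 A = ∫⁻ z' in G ⁻¹' A, ENNReal.ofReal (k (z, z')) ∂ρ := by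
  rw [kerMeasure, Measure.map_apply hG hA, withDensity_apply _ (hG hA)]

theorem measurable_kerMeasure {Z : Type} [MeasurableSpace Z] (hk : IsUnitKernel k) {G : Q → Z}
    (hG : Measurable G) : Measurable (kerMeasure hk ρ hG) := by
  refine Measurable.subtype_mk (Measure.measurable_of_measurable_coe _ fun A hA => ?_)
  have h := fun z => kerMeasure_apply (ρ := ρ) hk hG z hA
  simp only [kerMeasure] at h
  simp only [h]
  exact hk.measurable.ennreal_ofReal.lintegral_prod_right' (ν := ρ.restrict (G ⁻¹' A))

theorem setLIntegral_ofReal_eq (hk : IsUnitKernel k) {B : Set Q} (hB : MeasurableSet B) (z : Q) :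
    ∫⁻ z' in B, ENNReal.ofReal (k (z, z')) ∂ρ =
      ENNReal.ofReal (∫ z', k (z, z') * B.indicator (fun _ => 1) z' ∂ρ) := by
  have hm : Measurable fun z' => k (z, z') := hk.measurable.comp measurable_prodMk_left
  have hi : Integrable (fun z' => k (z, z')) ρ := Integrable.of_bound hm.aestronglyMeasurable 1
    (Filter.Eventually.of_forall fun _ => hk.norm_le_one _)
  rw [← ofReal_integral_eq_lintegral_ofReal hi.integrableOn
    (Filter.Eventually.of_forall fun _ => hk.nonneg _), ← integral_indicator hB]
  congr 1
  refine integral_congr_ae (Filter.Eventually.of_forall fun z' => ?_)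
  by_cases hz : z' ∈ B <;> simp [hz]

variable {X Y : Type*} [MeasurableSpace X] [MeasurableSpace Y] {μ : Measure X} {ν : Measure Y}
  [IsProbabilityMeasure μ] [IsProbabilityMeasure ν]

/-- For a fixed set A this is the factor property for the indicator of G⁻¹(A), with a null set
depending on A. A countable π-system reduces these to a single null set. -/
theorem IsFactor.degMeasure_ae_eq {Z : Type} [MeasurableSpace Z]
    [MeasurableSpace.CountablyGenerated Z] {W : Graphon μ} {q : X → Q} (hk : IsUnitKernel k)
    (h : IsFactor W.ker μ k ρ q) {i : X → Z} (hi : Measurable i) {G : Q → Z} (hG : Measurable G)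
    (hiG : i =ᵐ[μ] G ∘ q) : ∀ᵐ x ∂μ, degMeasure W i x = kerMeasure hk ρ hG (q x) := by
  obtain ⟨S, hSc, hS, hpi, huniv⟩ := exists_countable_isPiSystem Z
  have hA : ∀ A ∈ S, ∀ᵐ x ∂μ, (degMeasure W i x).1 A = (kerMeasure hk ρ hG (q x)).1 A := by
    intro A hAS
    have hA : MeasurableSet A := by
      rw [hS]
      exact MeasurableSpace.measurableSet_generateFrom hAS
    have hm : Measurable ((G ⁻¹' A).indicator fun _ => (1 : ℝ)) :=
      measurable_const.indicator (hG hA)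
    filter_upwards [h.integral_eq _ hm ((memLp_const 1).indicator (hG hA))] with x hx
    rw [degMeasure_apply W hi x hA, kerMeasure_apply hk hG _ hA, setLIntegral_ofReal_eq hk (hG hA),
      setLIntegral_ofReal_eq W.isUnitKernel (hi hA), ← hx]
    congr 1
    refine integral_congr_ae ?_
    filter_upwards [hiG] with y hy
    congr 1
    have e : y ∈ i ⁻¹' A ↔ q y ∈ G ⁻¹' A := by
      rw [Set.mem_preimage, hy]
      rfl
    by_cases hqy : q y ∈ G ⁻¹' A
    · rw [Set.indicator_of_mem hqy, Set.indicator_of_mem (e.2 hqy)]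
    · rw [Set.indicator_of_notMem hqy, Set.indicator_of_notMem (mt e.1 hqy)]
  have hall := (ae_ball_iff hSc).2 hA
  filter_upwards [hall] with x hx
  exact SubProb.ext_of_generateFrom hS hpi huniv hx

/-- The map G is built from k and ρ alone, so the same G computes the degree measures of both
graphons. -/
theorem exists_iterDegUpTo_ae_eq {W : Graphon μ} {U : Graphon ν} {q : X → Q} {q' : Y → Q}
    (hk : IsUnitKernel k) (hW : IsFactor W.ker μ k ρ q) (hU : IsFactor U.ker ν k ρ q') :
    ∀ n, ∃ G : Q → IDMUpTo n, Measurable G ∧ iterDegUpTo W n =ᵐ[μ] G ∘ q ∧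
      iterDegUpTo U n =ᵐ[ν] G ∘ q'
  | 0 => ⟨fun _ => (), measurable_const, Filter.EventuallyEq.rfl, Filter.EventuallyEq.rfl⟩
  | n + 1 => by
    obtain ⟨G, hG, h1, h2⟩ := exists_iterDegUpTo_ae_eq hk hW hU n
    have := countablyGenerated_idmUpTo n
    have hm : Measurable fun z => (G z, kerMeasure hk ρ hG z) :=
      hG.prodMk (measurable_kerMeasure hk hG)
    refine ⟨fun z => ((G z, kerMeasure hk ρ hG z) : IDMUpTo n × SubProb (IDMUpTo n)), hm, ?_, ?_⟩
    · filter_upwards [h1, hW.degMeasure_ae_eq hk (measurable_iterDegUpTo W n) hG h1] with x hx hx'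
      exact Prod.ext hx hx'
    · filter_upwards [h2, hU.degMeasure_ae_eq hk (measurable_iterDegUpTo U n) hG h2] with x hx hx'
      exact Prod.ext hx hx'

theorem exists_iterDeg_ae_eq {W : Graphon μ} {U : Graphon ν} {q : X → Q} {q' : Y → Q}
    (hk : IsUnitKernel k) (hW : IsFactor W.ker μ k ρ q) (hU : IsFactor U.ker ν k ρ q') :
    ∃ H : Q → IDM, Measurable H ∧ iterDeg W =ᵐ[μ] H ∘ q ∧ iterDeg U =ᵐ[ν] H ∘ q' := by
  choose G hG hGW hGU using exists_iterDegUpTo_ae_eq hk hW hU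
  let last : ∀ n, IDMUpTo n → DegSpace n := fun n => match n with
    | 0 => fun _ => ()
    | n + 1 => fun p : IDMUpTo n × SubProb (IDMUpTo n) => p.2
  have hlast : ∀ n, Measurable (last n) := fun n => match n with
    | 0 => measurable_const
    | n + 1 => by
      have : Measurable fun p : IDMUpTo n × SubProb (IDMUpTo n) => p.2 := measurable_snd
      exact this
  have hiW : ∀ x n, iterDeg W x n = last n (iterDegUpTo W n x) := fun x n => by
    cases n <;> rfl
  have hiU : ∀ y n, iterDeg U y n = last n (iterDegUpTo U n y) := fun y n => by
    cases n <;> rfl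
  refine ⟨fun z n => last n (G n z), measurable_pi_lambda _ fun n => (hlast n).comp (hG n),
    ?_, ?_⟩
  · filter_upwards [ae_all_iff.2 hGW] with x hx
    funext n
    rw [hiW, hx n]
    rfl
  · filter_upwards [ae_all_iff.2 hGU] with y hy
    funext n
    rw [hiU, hy n]
    rfl

/-- Both maps to 𝕄 are, almost everywhere, one function of the respective tree maps, and these have
the same law. -/
theorem didm_eq_of_integral_treeFun_eq (W : Graphon μ) (U : Graphon ν)
    (h : ∀ τ, ∫ x, treeFun W.ker μ τ x ∂μ = ∫ y, treeFun U.ker ν τ y ∂ν) :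
    didm W = didm U := by
  obtain ⟨k, hk, hkW, hkU⟩ := exists_common_kernel W U h
  have hW := (generates_treeMap W).isFactor (minAlg_isLeast W).1 hk hkW
  have hU := (generates_treeMap U).isFactor (minAlg_isLeast U).1 hk hkU
  have hmap := map_treeMap_eq W U h
  rw [← hmap] at hU
  have := Measure.isProbabilityMeasure_map (μ := μ) (measurable_treeMap W).aemeasurable
  obtain ⟨H, hH, hHW, hHU⟩ := exists_iterDeg_ae_eq hk hW hU
  rw [didm, didm, Measure.map_congr hHW, Measure.map_congr hHU,
    ← Measure.map_map hH (measurable_treeMap W), ← Measure.map_map hH (measurable_treeMap U), hmap]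

end

end FracIso
theorem theorem1p2 {X Y : Type*} [MeasurableSpace X] [StandardBorelSpace X]
    [MeasurableSpace Y] [StandardBorelSpace Y]
    (μ : Measure X) [IsProbabilityMeasure μ] (ν : Measure Y) [IsProbabilityMeasure ν]
    (W : FracIso.Graphon μ) (U : FracIso.Graphon ν) :
    List.TFAE [
      ∀ (n : ℕ) (T : SimpleGraph (Fin n)), T.IsTree →
        FracIso.homDensity T W = FracIso.homDensity T U,
      FracIso.didm W = FracIso.didm U,
      FracIso.KerIso (FracIso.quotMeasure (FracIso.minAlg W)) (FracIso.quotMeasure (FracIso.minAlg U))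
        (FracIso.quotGraphon W (FracIso.minAlg W)) (FracIso.quotGraphon U (FracIso.minAlg U)),
      ∃ S : Lp ℝ 2 ν →L[ℝ] Lp ℝ 2 μ, FracIso.IsMarkov S ∧
        (FracIso.graphonOp W) ∘L S = S ∘L (FracIso.graphonOp U),
      ∃ (C : FracIso.SubAlg μ) (D : FracIso.SubAlg ν),
        FracIso.IsInvariant W C ∧ FracIso.IsInvariant U D ∧
        FracIso.WeakIso μ ν (FracIso.condKer W C) (FracIso.condKer U D)] := by
  -- The first condition becomes equality of tree integrals, to which each of the others is linked
  -- in both directions.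
  rw [FracIso.forall_homDensity_eq_iff]
  tfae_have 1 → 2 := FracIso.didm_eq_of_integral_treeFun_eq W U
  tfae_have 2 → 1 := FracIso.integral_treeFun_eq_of_didm_eq W U
  tfae_have 1 → 3 := FracIso.kerIso_of_integral_treeFun_eq W U
  tfae_have 3 → 1 := FracIso.integral_treeFun_eq_of_kerIso W U
  tfae_have 1 → 4 := FracIso.exists_isMarkov_of_integral_treeFun_eq W U
  tfae_have 4 → 1 := fun ⟨_, hS, h⟩ => hS.integral_treeFun_eq h
  tfae_have 1 → 5 := fun h => ⟨FracIso.minAlg W, FracIso.minAlg U,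
    (FracIso.minAlg_isLeast W).1, (FracIso.minAlg_isLeast U).1,
    FracIso.weakIso_of_integral_treeFun_eq W U h⟩
  tfae_have 5 → 1 := fun ⟨_, _, hC, hD, h⟩ => FracIso.integral_treeFun_eq_of_weakIso W U hC hD h
  tfae_finish
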